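/- **Model.** A network consists of $n$ nodes at distinct points of the Euclidean plane, with injective names in a set of $N\ge 2$ names, where $N \ge n$. There are a path-loss exponent $\alpha>2$, a threshold $\beta\ge1$, ambient noise $\mathcal N>0$, a common power $P>0$ and a parameter $\varepsilon_s\in[0,1)$. If exactly the nodes of $\mathcal T$ transmit in a round, then a node $u\notin\mathcal T$ receives the message of $v\in\mathcal T$ iff $$\frac{P\,\mathrm{dist}(v,u)^{-\alpha}}{\mathcal N+\sum_{w\in\mathcal T\setminus\{v\}}P\,\mathrm{dist}(w,u)^{-\alpha}}\ge\beta \quad\text{and}\quad \mathrm{dist}(v,u)\le(1-\varepsilon_s)r,\qquad r=(P/(\mathcal N\beta))^{1/\alpha}$$ (weak sensitivity). The communication graph joins distinct nodes at distance at most $(1-\varepsilon_s)r$ (weak connectivity); it is assumed connected. Rounds are synchronous. Initially only the source is awake and has the rumor; every other node is passive until it receives its first message. Every message carries the rumor and $O(\log N)$ control bits. A node knows only its name, $N$, and whether it is the source. Each node has its own sequence of independent fair random bits. Below, $L=\lceil\log_2N\rceil$ (names are regarded as elements of $[2^L]$), $d\ge 1$ is an integer and $\epsilon\in(0,1/2)$.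 **Selectors.** A family $S$ of subsets of $[M]$ is an $(M,x,y)$-selector if for every $A\subseteq[M]$ with $|A|=x$ at least $y$ elements $a\in A$ satisfy $B\cap A=\{a\}$ for some $B\in S$. Fix $c=0.99$. For $1\le x\le 2^L$ the algorithm uses $(2^L,x,\lceil cx\rceil)$-selectors $S_{L,x}$ of length at most $KxL$, for a constant $K$. **Algorithm Wireless_DFS.** The source starts with the token. A node is *unexplored* until a token owner first calls it; the source is never unexplored. * When $s$ owns the token for the first time, it records the node from which it got the token as its parent, becomes grey, and executes ESUN and LUN. * *ESUN.* Node $s$ transmits a call. Its neighbors that are unexplored then execute sub-stages $i=1,\dots,L$ of $dL$ rounds each; in every round of sub-stage $i$ each of them transmits its label with probability $2^{-i}$ (using $i$ random bits), and $n_i$ is the number of messages that $s$ receives in sub-stage $i$. Let $k$ be the highest $i$ with $n_i\ge\frac{dL}{8}(1-\epsilon)$; node $s$ declares the bound $x=2^k$. If there is no such $i$, then LUN is skipped. * *LUN.* For $j=0,\dots,\lceil\log_{1/(1-c)}x\rceil$: the nodes first called by $s$ whose labels $s$ has not yet announced transmit their labels according to the selector $S_{L,x_j}$ with $x_j=\lceil(1-c)^jx\rceil$;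 then $s$ announces one after another the labels it received, and the nodes announced become viewed by $s$. * After that, and whenever the token comes back to it, $s$ passes the token to an arbitrarily chosen node viewed by $s$ to which it has not passed the token yet; if there is none, $s$ becomes black and returns the token to its parent (the source simply becomes black). **Theorem.** (0) There are a constant $K$ and selectors $S_{L,x}$ as above, for all $L\ge1$ and $1\le x\le 2^L$. (1) For every $\epsilon\in(0,1/2)$ and every $a\in\mathbb N$ there is $d_0$ such that for every integer $d\ge d_0$ and every $K$ there is a constant $C$, depending on $\epsilon,a,d,K$ only, such that for all selectors of lengths at most $KxL$, all $N\ge 2$, all rules for the arbitrary choice (depending on the choosing node's name and the set it chooses from), all connected networks as above, all sources and all rumors: * with probability at least $1-n^{-a}$, within $C\,n\log_2^2N$ rounds every node has received the rumor and the traversal is complete (all nodes are black), so that Wireless_DFS accomplishes single-source broadcast from an uncoordinated start in $O(n\log^2N)$ rounds with high probability; * in every execution, every node uses at most $C\log_2^3N$ random bits. -/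

import Mathlib

/-! # Broadcast in SINR wireless networks: the model and the algorithm Wireless_DFS -/

noncomputable section

namespace SINR

/-! ## The physical model: weak sensitivity, weak connectivity -/

/-- A uniform wireless network with node set `V` in the Euclidean plane. The single number `ε` is
both the sensitivity and the connectivity parameter (weak connectivity). -/
structure Network (V : Type*) where
  /-- path-loss exponent -/
  α : ℝ
  /-- SINR threshold -/
  β : ℝ
  /-- ambient noise -/
  noise : ℝ
  /-- common transmission power -/
  power : ℝ
  /-- sensitivity and connectivity parameter -/
  ε : ℝ
  two_lt_α : 2 < α
  one_le_β : 1 ≤ β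
  noise_pos : 0 < noise
  power_pos : 0 < power
  ε_nonneg : 0 ≤ ε
  ε_lt_one : ε < 1
  /-- the positions of the nodes; distinct nodes occupy distinct points -/
  pos : V → EuclideanSpace ℝ (Fin 2)
  pos_injective : Function.Injective pos

namespace Network

variable {V : Type*} (net : Network V)

/-- The largest distance at which a lone transmission has SINR at least `β`. -/
def range : ℝ := (net.power / (net.noise * net.β)) ^ (1 / net.α)

/-- Strength at `u` of the signal transmitted by `v`. -/
def signal (v u : V) : ℝ := net.power * dist (net.pos v) (net.pos u) ^ (-net.α)

open Classical in
/-- The signal-to-interference-plus-noise ratio of the transmission from `v` to `u` when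
the nodes in `T` transmit. -/
def sinr [Fintype V] (v u : V) (T : Finset V) : ℝ :=
  net.signal v u / (net.noise + ∑ w ∈ T.erase v, net.signal w u)

/-- Weak sensitivity: when exactly the nodes in `T` transmit, `u` successfully receives the
message of `v`. -/
def Receives [Fintype V] (T : Finset V) (v u : V) : Prop :=
  v ∈ T ∧ u ∉ T ∧ net.β ≤ net.sinr v u T ∧
    dist (net.pos v) (net.pos u) ≤ (1 - net.ε) * net.range

/-- The communication graph. -/
def commGraph : SimpleGraph V where
  Adj u v := u ≠ v ∧ dist (net.pos u) (net.pos v) ≤ (1 - net.ε) * net.range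
  symm := ⟨fun _ _ h => ⟨h.1.symm, by rw [dist_comm]; exact h.2⟩⟩
  loopless := ⟨fun _ h => h.1 rfl⟩

end Network

/-! ## Randomized distributed algorithms and their synchronous executions -/

/-- A randomized distributed algorithm as run by a single node. In every round an awake node in
state `s` draws `coins s` fresh random bits, and from `s` and those bits decides whether to transmit
(and which control message) or to listen; it then moves to `next s m`, where `m` is what it received
(`none` if it received nothing, in particular if it transmitted). A node other than the source is
passive, and only listens, until it receives its first message. -/
structure Algorithm (Name Msg : Type) where
  State : Type
  /-- state of the source at the start -/
  start : Name → State
  /-- state of a node that has just been awoken by its first message -/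
  wake : Name → Msg → State
  coins : State → ℕ
  send : (s : State) → (Fin (coins s) → Bool) → Option Msg
  next : State → Option Msg → State

/-- What an awake node carries: the rumor, its local state, the number of random bits used. -/
structure Node (Rumor State : Type) where
  rumor : Rumor
  state : State
  used : ℕ

section Execution

variable {V Name Msg Rumor : Type} [Fintype V]
  (net : Network V) (A : Algorithm Name Msg) (name : V → Name)

/-- The configuration of the network; passive nodes carry `none`. -/
abbrev Config (V Rumor : Type) {Name Msg : Type} (A : Algorithm Name Msg) : Type :=
  V → Option (Node Rumor A.State)

/-- The message (rumor and control part) that `v` transmits in the current round, if any. The node's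
random bits are read off its own random tape `ω v`. -/
def outgoing (ω : V → ℕ → Bool) (c : Config V Rumor A) (v : V) : Option (Rumor × Msg) :=
  match c v with
  | none => none
  | some nd => (A.send nd.state fun i => ω v (nd.used + i)).map fun m => (nd.rumor, m)

open Classical in
/-- The set of transmitters of the current round. -/
def transmitters (ω : V → ℕ → Bool) (c : Config V Rumor A) : Finset V :=
  Finset.univ.filter fun v => (outgoing A ω c v).isSome

open Classical in
/-- The message that `u` receives in the current round, if any. As `β ≥ 1`, at most one
transmitter is received by `u`. -/
def incoming (ω : V → ℕ → Bool) (c : Config V Rumor A) (u : V) : Option (Rumor × Msg) :=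
  if h : ∃ v, net.Receives (transmitters A ω c) v u then outgoing A ω c h.choose else none

/-- One synchronous round. -/
def round (ω : V → ℕ → Bool) (c : Config V Rumor A) : Config V Rumor A := fun u =>
  match c u, incoming net A ω c u with
  | none, none => none
  | none, some (r, m) => some ⟨r, A.wake (name u) m, 0⟩
  | some nd, m =>
      some ⟨nd.rumor, A.next nd.state (m.map Prod.snd), nd.used + A.coins nd.state⟩

open Classical in
/-- The configuration after `t` rounds when the source starts alone with the rumor `r`. -/
def run (ω : V → ℕ → Bool) (source : V) (r : Rumor) : ℕ → Config V Rumor A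
  | 0 => fun v => if v = source then some ⟨r, A.start (name v), 0⟩ else none
  | t + 1 => round net A name ω (run ω source r t)

end Execution

/-- The law of a fair random bit. -/
def coin : MeasureTheory.Measure Bool := (PMF.uniformOfFintype Bool).toMeasure

instance : MeasureTheory.IsProbabilityMeasure coin := by
  unfold coin; infer_instance

/-- The law of the random bits: one for every node and every position of its random tape, all
fair and independent. -/
def coins (V : Type*) : MeasureTheory.Measure (V × ℕ → Bool) :=
  MeasureTheory.Measure.infinitePi fun _ => coin

/-! ## Selectors -/

/-- The family `S` of subsets of an `N`-element set is an `(N, x, y)`-selector: from every set `A`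
of size `x` at least `y` elements are selected, where `S i` selects `a` from `A` when
`S i ∩ A = {a}`. -/
def IsSelector (N x y : ℕ) (S : List (Finset (Fin N))) : Prop :=
  ∀ A : Finset (Fin N), A.card = x → y ≤ (A.filter fun a => ∃ B ∈ S, B ∩ A = {a}).card

/-- The fraction `c = 0.99` of the neighborhood learning routine. -/
def lunFraction : ℚ := 99 / 100

/-- `sel L x` is a `(2 ^ L, x, 0.99 x)`-selector of length at most `K x L`, whenever
`1 ≤ x ≤ 2 ^ L`. -/
def IsSelectorFamily (K : ℝ) (sel : (L : ℕ) → ℕ → List (Finset (Fin (2 ^ L)))) : Prop :=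
  ∀ L x : ℕ, 1 ≤ L → 1 ≤ x → x ≤ 2 ^ L →
    IsSelector (2 ^ L) x ⌈lunFraction * x⌉₊ (sel L x) ∧ ((sel L x).length : ℝ) ≤ K * x * L

/-! ## The algorithm Wireless_DFS -/

namespace WirelessDFS

/-- `log N`, with `N` rounded up to a power of two. -/
abbrev lg (N : ℕ) : ℕ := Nat.clog 2 N

/-- Control messages; each carries at most two numbers bounded by `O(N)`, that is, `O(log N)`
bits. -/
inductive Msg (N : ℕ) : Type
  /-- the token owner `s` starts ESUN -/
  | call (s : Fin N)
  /-- `v` transmits its label in ESUN or LUN -/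
  | reply (v : Fin N)
  /-- the token owner `s` asks its unexplored neighbors to execute the selector of parameter `x` -/
  | learn (s : Fin N) (x : Fin (2 ^ lg N + 1))
  /-- the token owner `s` announces that it has received the label `v` -/
  | viewed (s v : Fin N)
  /-- `s` passes the token to `v` -/
  | token (s v : Fin N)

inductive Color : Type
  | white | grey | black

/-- What a node knows about having been explored. -/
inductive Status (N : ℕ) : Type
  /-- has not yet been called by a token owner -/
  | unexplored
  /-- was first called by `s`, and `s` has not yet announced its label -/
  | called (s : Fin N)
  /-- its label has been learnt by the first token owner that called it -/
  | viewed

/-- What a node is doing in a round. -/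
inductive Phase (N : ℕ) : Type
  /-- only listens -/
  | idle
  /-- ESUN, as an unexplored neighbor; `t` rounds of it have passed -/
  | estimate (t : ℕ)
  /-- LUN, as an unexplored neighbor: round `t` of the selector of parameter `x` -/
  | select (x t : ℕ)
  /-- owner: about to call the unexplored neighbors to execute ESUN -/
  | calling
  /-- owner: ESUN, `t` rounds of it have passed; `cnt i` messages received in sub-stage `i` -/
  | counting (t : ℕ) (cnt : ℕ → ℕ)
  /-- owner: LUN for the bound `2 ^ k`, about to start iteration `j` -/
  | asking (k j : ℕ)
  /-- owner: stage 1 of iteration `j`, round `t` of the selector; the labels received so far -/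
  | learning (k j t : ℕ) (heard : List (Fin N))
  /-- owner: stage 2 of iteration `j`; the labels still to be announced -/
  | announcing (k j : ℕ) (queue : List (Fin N))
  /-- owner: about to pass the token on or to return it -/
  | passing

/-- The local state of a node. -/
structure State (N : ℕ) : Type where
  me : Fin N
  color : Color
  status : Status N
  /-- the node from which the token was received for the first time -/
  parent : Option (Fin N)
  /-- the nodes viewed by this node to which it has not yet passed the token -/
  pending : Finset (Fin N)
  phase : Phase N

/-- The constants and the arbitrary choices of the algorithm. -/
structure Params (N : ℕ) : Type where
  /-- every sub-stage of ESUN has `d log N` rounds -/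
  d : ℕ
  /-- the constant in the threshold of ESUN -/
  ε : ℝ
  /-- the selectors -/
  sel : (L : ℕ) → ℕ → List (Finset (Fin (2 ^ L)))
  /-- `pick s R` is the node that `s` chooses from `R` to pass the token to -/
  pick : Fin N → Finset (Fin N) → Fin N

variable {N : ℕ} (p : Params N)

/-- Number of rounds of a sub-stage of ESUN. -/
def Params.subLength : ℕ := p.d * lg N

/-- Number of rounds of stage 1 of ESUN: `log N` sub-stages. -/
def Params.esunLength : ℕ := lg N * p.subLength

/-- The sub-stage (numbered from `1`) of the round `t` (numbered from `0`) of ESUN. -/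
def Params.subStage (t : ℕ) : ℕ := t / p.subLength + 1

open Classical in
/-- Stage 2 of ESUN: the highest sub-stage with at least `(d log N / 8) (1 - ε)` successful
transmissions; `0` if there is none, in which case no unexplored neighbor is declared. -/
def Params.estimateExponent (cnt : ℕ → ℕ) : ℕ :=
  ((Finset.Icc 1 (lg N)).filter fun i =>
    (p.d * lg N : ℝ) / 8 * (1 - p.ε) ≤ (cnt i : ℝ)).sup id

/-- The parameter `(1 - c) ^ j * 2 ^ k`, rounded up, of the selector of iteration `j` of LUN. -/
def lunSize (k j : ℕ) : ℕ := ⌈(1 - lunFraction) ^ j * 2 ^ k⌉₊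

/-- The last iteration of LUN, `log 2 ^ k` to the base `1 / (1 - c) = 100`, rounded up. -/
def lunLast (k : ℕ) : ℕ := Nat.clog 100 (2 ^ k)

/-- Does the label `v` belong to the set of number `t` of the selector of parameter `x`? -/
def Params.Selected (x t : ℕ) (v : Fin N) : Prop :=
  ∃ B, (p.sel (lg N) x)[t]? = some B ∧ Fin.castLE (Nat.le_pow_clog one_lt_two N) v ∈ B

/-- Number of random bits drawn: in sub-stage `i` of ESUN, `i` bits per round. -/
def Params.coins (s : State N) : ℕ :=
  match s.phase with
  | .estimate t => p.subStage t
  | _ => 0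

open Classical in
/-- The transmission of a node in a round. In sub-stage `i` of ESUN an unexplored neighbor transmits
when all its `i` random bits come up `true`, so with probability `1 / 2 ^ i`. -/
def Params.send (s : State N) (bits : Fin (p.coins s) → Bool) : Option (Msg N) :=
  match s.phase with
  | .idle => none
  | .estimate _ => if ∀ i, bits i = true then some (.reply s.me) else none
  | .select x t => if p.Selected x t s.me then some (.reply s.me) else none
  | .calling => some (.call s.me)
  | .counting _ _ => none
  | .asking k j => some (.learn s.me (Fin.ofNat _ (lunSize k j)))
  | .learning _ _ _ _ => none
  | .announcing _ _ [] => none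
  | .announcing _ _ (v :: _) => some (.viewed s.me v)
  | .passing =>
      if s.pending.Nonempty then some (.token s.me (p.pick s.me s.pending))
      else s.parent.map fun q => .token s.me q

/-- How a node that only listens reacts to a received message. -/
def react (s : State N) (m : Msg N) : State N :=
  match m with
  | .call c =>
      match s.status with
      | .unexplored => { s with status := .called c, phase := .estimate 0 }
      | _ => s
  | .reply _ => s
  | .learn c x =>
      match s.status with
      | .called c' => if c' = c then { s with phase := .select x 0 } else s
      | _ => s
  | .viewed c v =>
      match s.status with
      | .called c' => if c' = c ∧ v = s.me then { s with status := .viewed } else s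
      | _ => s
  | .token q v =>
      if v = s.me then
        match s.color with
        | .white => { s with color := .grey, parent := some q, phase := .calling }
        | _ => { s with phase := .passing }
      else s

/-- The phase of the owner after iteration `j` of LUN. -/
def afterIteration (k j : ℕ) : Phase N :=
  if j < lunLast k then .asking k (j + 1) else .passing

/-- The label transmitted in a received message, added to the labels heard so far. -/
def hear (heard : List (Fin N)) (m : Option (Msg N)) : List (Fin N) :=
  match m with
  | some (.reply v) => if v ∈ heard then heard else heard ++ [v]
  | _ => heard

open Classical in
/-- The state after a round in which `m` was received. -/
def Params.next (s : State N) (m : Option (Msg N)) : State N :=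
  match s.phase with
  | .idle =>
      match m with
      | none => s
      | some m => react s m
  | .estimate t =>
      { s with phase := if t + 1 < p.esunLength then .estimate (t + 1) else .idle }
  | .select x t =>
      { s with phase :=
          if t + 1 < (p.sel (lg N) x).length then .select x (t + 1) else .idle }
  | .calling => { s with phase := .counting 0 fun _ => 0 }
  | .counting t cnt =>
      let cnt' : ℕ → ℕ := if m.isSome then
        Function.update cnt (p.subStage t) (cnt (p.subStage t) + 1) else cnt
      { s with phase :=
          if t + 1 < p.esunLength then .counting (t + 1) cnt'
          else if p.estimateExponent cnt' = 0 then .passing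
          else .asking (p.estimateExponent cnt') 0 }
  | .asking k j => { s with phase := .learning k j 0 [] }
  | .learning k j t heard =>
      { s with phase :=
          if t + 1 < (p.sel (lg N) (lunSize k j)).length then
            .learning k j (t + 1) (hear heard m)
          else .announcing k j (hear heard m) }
  | .announcing k j [] => { s with phase := afterIteration k j }
  | .announcing k j (v :: queue) =>
      { s with
        pending := insert v s.pending
        phase := if queue = [] then afterIteration k j else .announcing k j queue }
  | .passing =>
      if s.pending.Nonempty then
        { s with pending := s.pending.erase (p.pick s.me s.pending), phase := .idle }
      else { s with color := .black, phase := .idle }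

/-- A node that has not taken part in anything yet. -/
def fresh (v : Fin N) : State N where
  me := v
  color := .white
  status := .unexplored
  parent := none
  pending := ∅
  phase := .idle

/-- The algorithm Wireless_DFS. Initially the source possesses the token. -/
def algorithm : Algorithm (Fin N) (Msg N) where
  State := State N
  start v := { fresh v with color := .grey, status := .viewed, phase := .calling }
  wake v m := react (fresh v) m
  coins := p.coins
  send := p.send
  next := p.next

end WirelessDFS

end SINR

end

/-! Selectors. Colour the labels at random with `x` colours and keep one colour class. It isolates a
given element of an `x`-set with probability at least `1 / (4 x)`, and these events are disjoint, so
it isolates some element of a given hundredth of the set with probability at least `1 / 400`. There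
are at most `4 ^ (L x)` pairs of an `x`-set and such a subset, so `800 x L` greedily chosen classes
serve all of them (`exists_selector`).

Radio. Only two facts about the physical model are needed: a lone transmission reaches all neighbors
of the transmitter (`receives_singleton`), and whatever is received comes from a neighbor. What
happens when several nodes transmit is never analysed.

One exploration. Let `A` be the set of unexplored neighbors of the token owner. The number of
messages heard in a sub-stage lies between the number of rounds with a lone speaker and the number
of rounds with some speaker. If `2 ^ i` is between `|A|` and `2 |A|`, lone speakers are frequent; if
`2 ^ i ≥ 64 |A|`, any speakers are rare. By Hoeffding the event `Good` is likely, and on it `|A| ≤ 2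
^ k ≤ 64 |A|`. Each iteration of LUN then leaves at most one percent of its parameter, so LUN
announces all of `A` in `O(|A| L)` rounds (`Ready.iterate_explore`).

No conditioning. On `Good` the outcome of an exploration is the same for all random bits: all of `A`
is viewed. Hence the whole traversal, and with it the list of at most `3 n` sets to be explored, is
determined before any bit is drawn (`Traversal.exists_sets`). A node takes part in ESUN at most once
and draws no other bits, so `Good` for a set refers to fixed positions of the tapes of its members,
whenever the exploration takes place. A union bound over the list then suffices
(`Params.one_sub_le_measure_good`).

Time. A sum of node weights pays for each ESUN, each explored node and each move of the token. When
the token is gone, every viewed node is black and has only viewed neighbors, so connectivity makes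
all nodes black. -/

noncomputable section

/-! ### Existence of selectors. -/

namespace SINR

open Finset in
/-- Greedy covering: if every index is hit by a fraction `δ` of the candidates, then `ℓ` well-chosen
candidates miss at most a fraction `(1 - δ) ^ ℓ` of the indices. -/
theorem exists_list_hitting {ι β : Type*} [Fintype β] [Nonempty β] [DecidableEq ι]
    (hit : ι → β → Prop) [∀ i b, Decidable (hit i b)] (P : Finset ι) (δ : ℝ) (hδ : δ ≤ 1)
    (h : ∀ i ∈ P, δ * Fintype.card β ≤ ((univ.filter fun b => hit i b).card : ℝ)) (ℓ : ℕ) :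
    ∃ l : List β, l.length = ℓ ∧ ∃ Q ⊆ P, (∀ i ∈ P, i ∉ Q → ∃ b ∈ l, hit i b) ∧
      (Q.card : ℝ) ≤ (1 - δ) ^ ℓ * P.card := by
  induction ℓ with
  | zero => exact ⟨[], rfl, P, subset_rfl, fun i hi h => absurd hi h, by simp⟩
  | succ ℓ ih =>
    obtain ⟨l, hl, Q, hQP, hQ, hc⟩ := ih
    have hβ : (0 : ℝ) < Fintype.card β := by exact_mod_cast Fintype.card_pos
    have hdc : (∑ b : β, ((Q.filter fun i => hit i b).card : ℝ)) =
        ∑ i ∈ Q, ((univ.filter fun b => hit i b).card : ℝ) := by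
      simp only [Finset.card_filter, Nat.cast_sum]
      rw [Finset.sum_comm]
    have hsum : ∑ _b : β, δ * (Q.card : ℝ) ≤ ∑ b : β, ((Q.filter fun i => hit i b).card : ℝ) := by
      rw [hdc]
      calc ∑ _b : β, δ * (Q.card : ℝ) = ∑ _i ∈ Q, δ * Fintype.card β := by
            simp only [sum_const, nsmul_eq_mul, card_univ]; ring
        _ ≤ _ := sum_le_sum fun i hi => h i (hQP hi)
    -- By averaging over the candidates, some `b` hits at least a fraction `δ` of what is still
    -- missed.
    obtain ⟨b, -, hb⟩ := Finset.exists_le_of_sum_le univ_nonempty hsum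
    refine ⟨b :: l, by simp [hl], Q.filter fun i => ¬ hit i b, (filter_subset _ _).trans hQP,
      fun i hi hiQ => ?_, ?_⟩
    · by_cases hiQ' : i ∈ Q
      · exact ⟨b, by simp, by simpa [hiQ'] using hiQ⟩
      · obtain ⟨b', hb', h'⟩ := hQ i hi hiQ'
        exact ⟨b', List.mem_cons_of_mem _ hb', h'⟩
    have hadd : ((Q.filter fun i => hit i b).card : ℝ) + (Q.filter fun i => ¬ hit i b).card
        = Q.card := by
      exact_mod_cast Finset.card_filter_add_card_filter_not (s := Q) (fun i => hit i b)
    calc ((Q.filter fun i => ¬ hit i b).card : ℝ) ≤ (1 - δ) * Q.card := by linarith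
      _ ≤ (1 - δ) * ((1 - δ) ^ ℓ * P.card) := by
          apply mul_le_mul_of_nonneg_left hc; linarith
      _ = _ := by ring

theorem exists_list_hitting_all {ι β : Type*} [Fintype β] [Nonempty β]
    (hit : ι → β → Prop) [∀ i b, Decidable (hit i b)] (P : Finset ι) (δ : ℝ) (hδ : δ ≤ 1)
    (h : ∀ i ∈ P, δ * Fintype.card β ≤ ((Finset.univ.filter fun b => hit i b).card : ℝ)) (ℓ : ℕ)
    (hlt : (1 - δ) ^ ℓ * P.card < 1) :
    ∃ l : List β, l.length = ℓ ∧ ∀ i ∈ P, ∃ b ∈ l, hit i b := by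
  classical
  obtain ⟨l, hl, Q, -, hQ, hc⟩ := exists_list_hitting hit P δ hδ h ℓ
  have hlt' := hc.trans_lt hlt
  rw [Nat.cast_lt_one, Finset.card_eq_zero] at hlt'
  exact ⟨l, hl, fun i hi => hQ i hi (by simp [hlt'])⟩

/-- `(1 - 1 / m) ^ (m - 1) ≥ 1 / 4`. -/
theorem pow_le_four_mul_pred_pow (x : ℕ) (hx : 1 ≤ x) :
    (x : ℝ) ^ (x - 1) ≤ 4 * ((x - 1 : ℕ) : ℝ) ^ (x - 1) := by
  obtain ⟨m, rfl⟩ : ∃ m, x = m + 1 := ⟨x - 1, by omega⟩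
  simp only [Nat.add_sub_cancel]
  -- For `x = 1` the right-hand side is `4 * 0 ^ 0 = 4`.
  rcases Nat.eq_zero_or_pos m with rfl | hm
  · norm_num
  have hm' : (0 : ℝ) < m := by exact_mod_cast hm
  have h1 : (1 + 1 / (m : ℝ)) ^ m ≤ Real.exp 1 := by
    calc (1 + 1 / (m : ℝ)) ^ m ≤ (Real.exp (1 / m)) ^ m := by
          apply pow_le_pow_left₀ (by positivity)
          linarith [Real.add_one_le_exp (1 / (m : ℝ))]
      _ = Real.exp 1 := by
          rw [← Real.exp_nat_mul]; congr 1; field_simp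
  have h2 : Real.exp 1 ≤ 4 := by linarith [Real.exp_one_lt_d9]
  have h3 : ((m + 1 : ℕ) : ℝ) ^ m = (1 + 1 / (m : ℝ)) ^ m * (m : ℝ) ^ m := by
    rw [← mul_pow]; congr 1; push_cast; field_simp
  rw [h3]
  exact mul_le_mul_of_nonneg_right (h1.trans h2) (by positivity)

open Finset in
/-- The number of colorings with `x` colors in which `a` is the only element of `A` of color `0`. -/
theorem card_isolating {M x : ℕ} [NeZero x] (A : Finset (Fin M)) (a : Fin M) (ha : a ∈ A) :
    ((univ.filter fun f : Fin M → Fin x => ∀ b ∈ A, f b = 0 ↔ b = a).card) * x ^ A.card =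
      (x - 1) ^ (A.card - 1) * x ^ M := by
  have h1 : (univ.filter fun f : Fin M → Fin x => ∀ b ∈ A, f b = 0 ↔ b = a) =
      Fintype.piFinset fun b => if b = a then {0} else if b ∈ A then {0}ᶜ else univ := by
    ext f
    simp only [mem_filter, mem_univ, true_and, Fintype.mem_piFinset]
    refine forall_congr' fun b => ?_
    by_cases hb : b = a
    · subst hb; simp [ha]
    · by_cases hA : b ∈ A <;> simp [hb, hA]
  rw [h1, Fintype.card_piFinset]
  have h2 : ∀ b : Fin M, (if b = a then ({0} : Finset (Fin x))
      else if b ∈ A then {0}ᶜ else univ).card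
      = if b ∈ A then (if b = a then 1 else x - 1) else x := by
    intro b
    by_cases hb : b = a
    · subst hb; simp [ha]
    · by_cases hA : b ∈ A <;> simp [hb, hA, card_compl]
  simp only [h2]
  rw [Finset.prod_ite]
  have e1 : (univ.filter fun b => b ∈ A) = A := by ext; simp
  have e2 : (univ.filter fun b => b ∉ A).card = M - A.card := by
    rw [Finset.filter_not, e1, ← Finset.compl_eq_univ_sdiff, card_compl, Fintype.card_fin]
  rw [e1, prod_const, e2, ← Finset.mul_prod_erase A _ ha]
  have e3 : ∏ b ∈ A.erase a, (if b = a then 1 else x - 1) = (x - 1) ^ (A.card - 1) := by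
    rw [← card_erase_of_mem ha, ← prod_const]
    exact prod_congr rfl fun b hb => if_neg (ne_of_mem_erase hb)
  have hle : A.card ≤ M := by simpa using card_le_univ A
  rw [e3, if_pos rfl, one_mul, mul_assoc, ← pow_add, Nat.sub_add_cancel hle]

-- For `a ∈ U`, the events that `a` alone has color `0` in `A` are disjoint, and each has
-- probability `(1 / x) (1 - 1 / x) ^ (x - 1) ≥ 1 / (4 x)`. There are at least `x / 100` of them.
open Finset in
theorem le_card_hitting {M x : ℕ} [NeZero x] (A U : Finset (Fin M)) (hA : A.card = x) (hU : U ⊆ A)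
    (hUc : (x : ℝ) ≤ 100 * U.card) :
    (1 / 400 : ℝ) * Fintype.card (Fin M → Fin x) ≤
      ((univ.filter fun f : Fin M → Fin x =>
        ∃ a ∈ U, (univ.filter fun b => f b = 0) ∩ A = {a}).card : ℝ) := by
  have hx : 1 ≤ x := Nat.one_le_iff_ne_zero.2 (NeZero.ne x)
  have hx0 : (0 : ℝ) < x := by exact_mod_cast hx
  have h1 : (univ.filter fun f : Fin M → Fin x =>
        ∃ a ∈ U, (univ.filter fun b => f b = 0) ∩ A = {a}) =
      U.biUnion fun a => univ.filter fun f : Fin M → Fin x => ∀ b ∈ A, f b = 0 ↔ b = a := by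
    ext f
    simp only [mem_filter, mem_univ, true_and, mem_biUnion]
    refine exists_congr fun a => and_congr_right fun ha => ?_
    simp only [Finset.ext_iff, mem_inter, mem_filter, mem_univ, true_and, mem_singleton]
    refine forall_congr' fun b => ?_
    by_cases hb : b ∈ A
    · simp [hb]
    · have : b ≠ a := fun h => hb (h ▸ hU ha)
      simp [hb, this]
  rw [h1, card_biUnion]
  · push_cast
    have h2 : ∀ a ∈ U, (x : ℝ) ^ M / (4 * x) ≤
        ((univ.filter fun f : Fin M → Fin x => ∀ b ∈ A, f b = 0 ↔ b = a).card : ℝ) := by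
      intro a ha
      have h3 := card_isolating (x := x) A a (hU ha)
      rw [hA] at h3
      have h3' : ((univ.filter fun f : Fin M → Fin x => ∀ b ∈ A, f b = 0 ↔ b = a).card : ℝ)
          * (x : ℝ) ^ x = ((x - 1 : ℕ) : ℝ) ^ (x - 1) * (x : ℝ) ^ M := by exact_mod_cast h3
      have h4 := pow_le_four_mul_pred_pow x hx
      have h5 : (x : ℝ) ^ x = x * (x : ℝ) ^ (x - 1) := by
        rw [← pow_succ', Nat.sub_add_cancel hx]
      rw [div_le_iff₀ (by positivity)]
      have hp : (0 : ℝ) < (x : ℝ) ^ (x - 1) := by positivity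
      refine le_of_mul_le_mul_right ?_ hp
      calc (x : ℝ) ^ M * (x : ℝ) ^ (x - 1)
          ≤ (x : ℝ) ^ M * (4 * ((x - 1 : ℕ) : ℝ) ^ (x - 1)) := by gcongr
        _ = 4 * (((x - 1 : ℕ) : ℝ) ^ (x - 1) * (x : ℝ) ^ M) := by ring
        _ = _ := by rw [← h3', h5]; ring
    calc (1 / 400 : ℝ) * Fintype.card (Fin M → Fin x) = (x / 100) * ((x : ℝ) ^ M / (4 * x)) := by
          simp only [Fintype.card_fun, Fintype.card_fin]; push_cast; field_simp; norm_num
      _ ≤ U.card * ((x : ℝ) ^ M / (4 * x)) := by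
          apply mul_le_mul_of_nonneg_right _ (by positivity); linarith
      _ = ∑ _a ∈ U, (x : ℝ) ^ M / (4 * x) := by simp
      _ ≤ _ := sum_le_sum h2
  · intro a ha a' ha' hne
    rw [Function.onFun, Finset.disjoint_left]
    intro f hf hf'
    simp only [mem_filter, mem_univ, true_and] at hf hf'
    exact hne ((hf' a (hU ha)).1 ((hf a (hU ha)).2 rfl))

-- If a family fails at `A`, the elements that it does not select form a set `U` of at least `x /
-- 100` elements, none of which is isolated by a member of the family. So it is enough to hit all
-- pairs `(A, U)`, where hitting means isolating some element of `U` in `A`.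
open Finset in
theorem exists_selector (L x : ℕ) (hL : 1 ≤ L) (hx : 1 ≤ x) :
    ∃ S : List (Finset (Fin (2 ^ L))), IsSelector (2 ^ L) x ⌈lunFraction * x⌉₊ S ∧
      S.length = 800 * x * L := by
  have : NeZero x := ⟨by omega⟩
  classical
  let P : Finset (Finset (Fin (2 ^ L)) × Finset (Fin (2 ^ L))) :=
    (powersetCard x univ).biUnion fun A =>
      (A.powerset.filter fun U => (x : ℝ) ≤ 100 * U.card).image fun U => (A, U)
  have hP : ∀ A U : Finset (Fin (2 ^ L)),
      (A, U) ∈ P ↔ A.card = x ∧ U ⊆ A ∧ (x : ℝ) ≤ 100 * U.card := by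
    intro A U
    simp only [P, mem_biUnion, mem_powersetCard, mem_image, mem_filter, mem_powerset, subset_univ,
      true_and, Prod.mk.injEq]
    constructor
    · rintro ⟨A', h1, U', ⟨h2, h3⟩, rfl, rfl⟩; exact ⟨h1, h2, h3⟩
    · rintro ⟨h1, h2, h3⟩; exact ⟨A, h1, U, ⟨h2, h3⟩, rfl, rfl⟩
  have hPc : (P.card : ℝ) ≤ 4 ^ (L * x) := by
    have : P.card ≤ (2 ^ L) ^ x * 2 ^ x := by
      calc P.card ≤ (powersetCard x (univ : Finset (Fin (2 ^ L)))).card * 2 ^ x := by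
            refine card_biUnion_le_card_mul _ _ _ fun A hA => ?_
            refine card_image_le.trans ((card_filter_le _ _).trans ?_)
            rw [card_powerset, (mem_powersetCard.1 hA).2]
        _ ≤ _ := by
            rw [card_powersetCard, card_univ, Fintype.card_fin]
            exact Nat.mul_le_mul_right _ (Nat.choose_le_pow _ _)
    calc (P.card : ℝ) ≤ (2 ^ L) ^ x * 2 ^ x := by exact_mod_cast this
      _ ≤ (2 ^ L) ^ x * (2 ^ L) ^ x := by
          gcongr
          exact le_self_pow₀ (by norm_num) (by omega)
      _ = 4 ^ (L * x) := by rw [← mul_pow, ← mul_pow, pow_mul]; norm_num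
  -- The length `800 x L` turns the missed fraction into at most `exp (-2 L x)`, which beats the `4
  -- ^ (L x)` pairs because `e ^ 2 > 4`.
  have hlt : (1 - 1 / 400 : ℝ) ^ (800 * x * L) * P.card < 1 := by
    have e1 : (1 - 1 / 400 : ℝ) ^ (800 * x * L) ≤ Real.exp (-2) ^ (L * x) := by
      calc (1 - 1 / 400 : ℝ) ^ (800 * x * L) ≤ Real.exp (-(1 / 400)) ^ (800 * x * L) := by
            apply pow_le_pow_left₀ (by norm_num)
            linarith [Real.add_one_le_exp (-(1 / 400) : ℝ)]
        _ = Real.exp (-2) ^ (L * x) := by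
            rw [← Real.exp_nat_mul, ← Real.exp_nat_mul]; congr 1; push_cast; ring
    have e2 : Real.exp (-2) * 4 < 1 := by
      rw [Real.exp_neg, inv_mul_lt_iff₀ (Real.exp_pos _)]
      have : Real.exp 2 = Real.exp 1 * Real.exp 1 := by rw [← Real.exp_add]; norm_num
      nlinarith [Real.exp_one_gt_d9]
    calc (1 - 1 / 400 : ℝ) ^ (800 * x * L) * P.card
        ≤ Real.exp (-2) ^ (L * x) * 4 ^ (L * x) := by gcongr
      _ = (Real.exp (-2) * 4) ^ (L * x) := by rw [mul_pow]
      _ < 1 := pow_lt_one₀ (by positivity) e2 (Nat.mul_pos hL hx).ne'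
  obtain ⟨l, hl, hc⟩ := exists_list_hitting_all
    (fun (i : Finset (Fin (2 ^ L)) × Finset (Fin (2 ^ L))) (f : Fin (2 ^ L) → Fin x) =>
      ∃ a ∈ i.2, (univ.filter fun b => f b = 0) ∩ i.1 = {a}) P (1 / 400) (by norm_num)
    (by
      rintro ⟨A, U⟩ hi
      obtain ⟨h1, h2, h3⟩ := (hP A U).1 hi
      exact le_card_hitting A U h1 h2 h3) (800 * x * L) hlt
  refine ⟨l.map fun f => univ.filter fun b => f b = 0, fun A hA => ?_, by simp [hl]⟩
  by_contra hcon
  push Not at hcon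
  set good := A.filter fun a => ∃ B ∈ l.map fun f => univ.filter fun b => f b = 0, B ∩ A = {a}
    with hgood
  have hU : (A, A \ good) ∈ P := by
    refine (hP _ _).2 ⟨hA, sdiff_subset, ?_⟩
    have h1 : (good.card : ℚ) < lunFraction * x := Nat.lt_ceil.1 hcon
    have h2 : (A \ good).card + good.card = x := by
      rw [← hA]; exact card_sdiff_add_card_eq_card (filter_subset _ _)
    have h3 : (x : ℚ) ≤ 100 * (A \ good).card := by
      have h4 : ((A \ good).card : ℚ) + good.card = x := by exact_mod_cast h2
      rw [lunFraction] at h1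
      linarith
    exact_mod_cast h3
  obtain ⟨f, hf, a, ha, hfa⟩ := hc _ hU
  rw [mem_sdiff] at ha
  exact ha.2 (mem_filter.2 ⟨ha.1, _, List.mem_map_of_mem hf, hfa⟩)

theorem exists_selectorFamily :
    ∃ (K : ℝ) (sel : (L : ℕ) → ℕ → List (Finset (Fin (2 ^ L)))), IsSelectorFamily K sel := by
  choose S hS using exists_selector
  refine ⟨800, fun L x => if h : 1 ≤ L ∧ 1 ≤ x then S L x h.1 h.2 else [], ?_⟩
  intro L x hL hx _
  simp only [hL, hx, and_self, dite_true]
  refine ⟨(hS L x hL hx).1, ?_⟩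
  rw [(hS L x hL hx).2]
  push_cast
  exact le_rfl

end SINR

/-! ### Grouping of independent variables, and Hoeffding bounds for counts. -/

namespace SINR

open MeasureTheory ProbabilityTheory

/-- Random variables that are independent over all pairs of indices are independent when they are
grouped by the first index. -/
theorem iIndepFun_curry {Ω ι : Type*} {mΩ : MeasurableSpace Ω} {P : Measure Ω}
    [IsProbabilityMeasure P] {κ : ι → Type*} {𝓧 : (i : ι) → κ i → Type*}
    [m𝓧 : ∀ i j, MeasurableSpace (𝓧 i j)]
    {X : (i : ι) → (j : κ i) → Ω → 𝓧 i j} (mX : ∀ i j, Measurable (X i j))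
    (h : iIndepFun (fun (p : (i : ι) × κ i) ω => X p.1 p.2 ω) P) :
    iIndepFun (fun i ω j => X i j ω) P := by
  have : ∀ i j, IsProbabilityMeasure (P.map (X i j)) :=
    fun i j => Measure.isProbabilityMeasure_map (mX i j).aemeasurable
  have hc : (MeasurableEquiv.piCurry 𝓧) ∘ (fun ω p => X p.1 p.2 ω) = fun ω i j => X i j ω := by
    ext; simp [Sigma.curry]
  rw [iIndepFun_iff_map_fun_eq_infinitePi_map (by fun_prop), ← hc,
    ← Measure.map_map (by fun_prop) (by fun_prop),
    (iIndepFun_iff_map_fun_eq_infinitePi_map (by fun_prop)).1 h,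
    Measure.infinitePi_map_piCurry (fun i j => P.map (X i j))]
  congrm Measure.infinitePi fun i => ?_
  have hi : iIndepFun (fun j ω => X i j ω) P :=
    h.precomp (g := fun j => (⟨i, j⟩ : (i : ι) × κ i)) sigma_mk_injective
  rw [(iIndepFun_iff_map_fun_eq_infinitePi_map (by fun_prop)).1 hi]

section Hoeffding

variable {Ω : Type*} {mΩ : MeasurableSpace Ω} {μ : Measure Ω} [IsProbabilityMeasure μ]

open Finset in
/-- Lower tail for the number of occurrences among independent events. -/
theorem measure_card_le_le {Y : ℕ → Ω → Bool} (hY : ∀ t, Measurable (Y t)) (hi : iIndepFun Y μ)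
    (s : Finset ℕ) {q δ : ℝ} (hδ : 0 ≤ δ) (hq : ∀ t ∈ s, q ≤ μ.real {ω | Y t ω = true}) :
    μ.real {ω | ((s.filter fun t => Y t ω = true).card : ℝ) ≤ (q - δ) * s.card} ≤
      Real.exp (-(2 * δ ^ 2 * s.card)) := by
  set Z : ℕ → Ω → ℝ := fun t ω => if Y t ω = true then 1 else 0 with hZ
  have hf : Measurable fun b : Bool => if b = true then (1 : ℝ) else 0 := measurable_of_finite _
  have hZm : ∀ t, Measurable (Z t) := fun t => hf.comp (hY t)
  have hE : ∀ t, μ[Z t] = μ.real {ω | Y t ω = true} := by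
    intro t
    have hm : MeasurableSet {ω | Y t ω = true} := hY t (measurableSet_singleton true)
    rw [← integral_indicator_one hm]
    refine integral_congr_ae (ae_of_all _ fun ω => ?_)
    simp [hZ, Set.indicator_apply]
  -- The lower tail is the upper tail of the negated centred indicators; their range has length `1`,
  -- so they are sub-Gaussian with parameter `1 / 4`.
  have hind : iIndepFun (fun t ω => -(Z t ω - μ[Z t])) μ :=
    hi.comp (fun t b => -((if b = true then (1 : ℝ) else 0) - ∫ x, Z t x ∂μ))
      (fun t => measurable_of_finite _)
  have hsub : ∀ t ∈ s, HasSubgaussianMGF (fun ω => -(Z t ω - μ[Z t])) ((‖(1 : ℝ) - 0‖₊ / 2) ^ 2) μ :=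
    fun t _ => (hasSubgaussianMGF_of_mem_Icc (a := 0) (b := 1) (hZm t).aemeasurable
      (ae_of_all _ fun ω => by simp only [hZ]; split <;> simp)).neg
  have h := HasSubgaussianMGF.measure_sum_ge_le_of_iIndepFun hind hsub
    (ε := δ * s.card) (by positivity)
  refine (measureReal_mono ?_).trans (h.trans (le_of_eq ?_))
  · intro ω hω
    simp only [Set.mem_ofPred_eq] at hω ⊢
    have h1 : ∑ t ∈ s, Z t ω = ((s.filter fun t => Y t ω = true).card : ℝ) := by
      simp [hZ]
    have h2 : (s.card : ℝ) * q ≤ ∑ t ∈ s, μ[Z t] := by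
      rw [← nsmul_eq_mul, ← sum_const]
      exact sum_le_sum fun t ht => (hq t ht).trans_eq (hE t).symm
    rw [sum_neg_distrib, sum_sub_distrib, h1]
    nlinarith
  · rcases Nat.eq_zero_or_pos s.card with h0 | h0
    · simp [h0]
    · have : (0 : ℝ) < s.card := by exact_mod_cast h0
      congr 1
      simp
      field_simp

/-- Upper tail for the number of occurrences among independent events. -/
theorem measure_le_card_le {Y : ℕ → Ω → Bool} (hY : ∀ t, Measurable (Y t)) (hi : iIndepFun Y μ)
    (s : Finset ℕ) {q δ : ℝ} (hδ : 0 ≤ δ) (hq : ∀ t ∈ s, μ.real {ω | Y t ω = true} ≤ q) :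
    μ.real {ω | (q + δ) * s.card ≤ ((s.filter fun t => Y t ω = true).card : ℝ)} ≤
      Real.exp (-(2 * δ ^ 2 * s.card)) := by
  have hn : Measurable fun b : Bool => !b := measurable_of_finite _
  refine (measureReal_mono ?_).trans (measure_card_le_le (Y := fun t ω => !(Y t ω))
    (fun t => hn.comp (hY t)) (hi.comp (fun _ b => !b) fun _ => hn) s (q := 1 - q) hδ ?_)
  · intro ω hω
    simp only [Set.mem_ofPred_eq] at hω ⊢
    have h1 := Finset.card_filter_add_card_filter_not (s := s) (fun t => Y t ω = true)
    have h2 : ((s.filter fun t => Y t ω = true).card : ℝ)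
      + (s.filter fun t => ¬ Y t ω = true).card = s.card := by exact_mod_cast h1
    have h3 : (s.filter fun t => (!(Y t ω)) = true) = s.filter fun t => ¬ Y t ω = true := by
      apply Finset.filter_congr; intro t _; simp
    rw [h3]
    linarith
  · intro t ht
    have h1 : {ω | (!(Y t ω)) = true} = {ω | Y t ω = true}ᶜ := by ext; simp
    have hm : MeasurableSet {ω | Y t ω = true} := hY t (measurableSet_singleton true)
    rw [h1, probReal_compl_eq_one_sub hm]
    linarith [hq t ht]

end Hoeffding

/-! ### Transmissions in ESUN as events on the random tapes. -/

namespace WirelessDFS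

variable {N : ℕ} (p : Params N)

/-- The number of bits that a node uses in the first `t` rounds of ESUN. -/
def Params.tape (t : ℕ) : ℕ := ∑ i ∈ Finset.range t, p.subStage i

/-- In round `t` of its ESUN, `v` transmits its label. -/
def Params.Speaks {V : Type*} (ω : V → ℕ → Bool) (t : ℕ) (v : V) : Prop :=
  ∀ i < p.subStage t, ω v (p.tape t + i) = true

theorem Params.tape_succ (t : ℕ) : p.tape (t + 1) = p.tape t + p.subStage t :=
  Finset.sum_range_succ _ _

theorem Params.tape_mono {s t : ℕ} (h : s ≤ t) : p.tape s ≤ p.tape t :=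
  Finset.sum_le_sum_of_subset (Finset.range_mono h)

/-- Consecutive rounds read consecutive segments of the tape, so a position determines its round and
its offset. The disjointness of the segments is the source of all independence below. -/
theorem Params.tape_add_inj {s t i j : ℕ} (hi : i < p.subStage s) (hj : j < p.subStage t)
    (h : p.tape s + i = p.tape t + j) : s = t ∧ i = j := by
  have key : ∀ s t i j, i < p.subStage s → p.tape s + i = p.tape t + j → t ≤ s := by
    intro s t i j hi h
    by_contra hlt
    have := p.tape_mono (show s + 1 ≤ t by omega)
    rw [p.tape_succ] at this
    omega
  have : s = t := le_antisymm (key t s j i hj h.symm) (key s t i j hi h)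
  subst this
  exact ⟨rfl, by omega⟩

section Speaking

variable {V : Type*}

open Classical in
/-- `Speaks`, as a random variable. -/
def Params.speaks (v : V) (t : ℕ) (ω : V × ℕ → Bool) : Bool :=
  decide (p.Speaks (fun u i => ω (u, i)) t v)

instance : IsProbabilityMeasure (SINR.coins V) := by unfold SINR.coins; infer_instance

theorem Params.speaks_eq_true (v : V) (t : ℕ) (ω : V × ℕ → Bool) :
    p.speaks v t ω = true ↔ ∀ j : Fin (p.subStage t), ω (v, p.tape t + j) = true := by
  simp only [speaks, decide_eq_true_iff]
  exact ⟨fun h j => h j j.2, fun h i hi => h ⟨i, hi⟩⟩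

theorem Params.measurable_speaks (v : V) (t : ℕ) : Measurable (p.speaks v t) := by
  have h1 : p.speaks v t = (fun b : Fin (p.subStage t) → Bool => decide (∀ j, b j = true)) ∘
      fun ω j => ω (v, p.tape t + j) := by
    funext ω
    rw [Bool.eq_iff_iff, p.speaks_eq_true, Function.comp, decide_eq_true_iff]
  rw [h1]
  exact (measurable_of_finite _).comp (by fun_prop)

theorem Params.iIndepFun_speaks :
    iIndepFun (fun (x : V × ℕ) => p.speaks x.1 x.2) (SINR.coins V) := by
  have h0 : iIndepFun (fun (x : V × ℕ) (ω : V × ℕ → Bool) => ω x) (SINR.coins V) :=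
    iIndepFun_infinitePi (X := fun _ b => b) fun _ => measurable_id
  have hinj : Function.Injective
      fun (y : (x : V × ℕ) × Fin (p.subStage x.2)) => (y.1.1, p.tape y.1.2 + y.2) := by
    rintro ⟨⟨v, s⟩, i⟩ ⟨⟨w, t⟩, j⟩ h
    simp only [Prod.mk.injEq] at h
    obtain ⟨h1, h2⟩ := p.tape_add_inj i.2 j.2 h.2
    dsimp only at h1
    obtain ⟨rfl⟩ := h.1
    subst h1
    rw [Fin.ext h2]
  have h1 := iIndepFun_curry (P := SINR.coins V) (κ := fun x : V × ℕ => Fin (p.subStage x.2))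
    (X := fun x j (ω : V × ℕ → Bool) => ω (x.1, p.tape x.2 + j)) (fun _ _ => by fun_prop)
    (h0.precomp hinj)
  have h2 := h1.comp (fun x b => decide (∀ j, b j = true)) fun _ => measurable_of_finite _
  convert! h2 using 2 with x
  funext ω
  simp only [speaks, Speaks, Function.comp]
  congr 1
  exact propext ⟨fun h j => h j j.2, fun h i hi => h ⟨i, hi⟩⟩

/-- Busy and lone rounds are functions `g` of the set of speakers of a round; this is the
independence across rounds that Hoeffding needs. -/
theorem Params.iIndepFun_speaks_round [Fintype V] {β : Type*} [MeasurableSpace β] (g : (V → Bool) → β) :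
    iIndepFun (fun t ω => g fun v => p.speaks v t ω) (SINR.coins V) := by
  have hinj : Function.Injective fun (y : (_ : ℕ) × V) => (y.2, y.1) := by
    rintro ⟨s, v⟩ ⟨t, w⟩ h
    simp only [Prod.mk.injEq] at h
    rw [h.1, h.2]
  have h1 := iIndepFun_curry (P := SINR.coins V) (κ := fun _ : ℕ => V)
    (X := fun t v => p.speaks v t) (fun t v => p.measurable_speaks v t)
    (p.iIndepFun_speaks.precomp hinj)
  exact h1.comp (fun _ => g) fun _ => measurable_of_finite _

theorem Params.measurable_speaks_round [Fintype V] {β : Type*} [MeasurableSpace β] (g : (V → Bool) → β)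
    (t : ℕ) : Measurable fun ω => g fun v => p.speaks v t ω :=
  (measurable_of_finite g).comp (measurable_pi_lambda _ fun v => p.measurable_speaks v t)

theorem coin_singleton (b : Bool) : coin {b} = 2⁻¹ := by
  rw [coin, PMF.toMeasure_apply_singleton _ _ (measurableSet_singleton b)]
  simp

theorem Params.measureReal_speaks (v : V) (t : ℕ) :
    (SINR.coins V).real {ω | p.speaks v t ω = true} = (1 / 2) ^ p.subStage t := by
  classical
  have h1 : {ω | p.speaks v t ω = true} =
      Set.pi (((Finset.range (p.subStage t)).image fun i => (v, p.tape t + i) :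
        Finset (V × ℕ)) : Set (V × ℕ)) fun _ => {true} := by
    ext ω
    rw [Set.mem_ofPred_eq, speaks, decide_eq_true_iff]
    simp [Speaks, Set.mem_pi]
  rw [h1, measureReal_def, SINR.coins, Measure.infinitePi_pi _ fun _ _ => measurableSet_singleton _,
    Finset.prod_const, coin_singleton, Finset.card_image_of_injective, Finset.card_range]
  · simp
  · intro i j h
    simpa using h

open Finset in
theorem Params.measureReal_exists_speaks_le (A : Finset V) (t : ℕ) :
    (SINR.coins V).real {ω | ∃ v ∈ A, p.speaks v t ω = true} ≤
      A.card * (1 / 2) ^ p.subStage t := by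
  have h1 : {ω | ∃ v ∈ A, p.speaks v t ω = true} =
      ⋃ v ∈ A, {ω | p.speaks v t ω = true} := by
    ext; simp
  rw [h1]
  refine (measureReal_biUnion_finset_le _ _).trans ?_
  simp [p.measureReal_speaks]

-- Split according to the lone speaker: the cases are disjoint, and each is an intersection of
-- independent events over `A`.
open Finset Classical in
theorem Params.measureReal_existsUnique_speaks (A : Finset V) (t : ℕ) :
    (SINR.coins V).real {ω | ∃ v ∈ A, ∀ w ∈ A, p.speaks w t ω = true ↔ w = v} =
      A.card * ((1 / 2) ^ p.subStage t * (1 - (1 / 2) ^ p.subStage t) ^ (A.card - 1)) := by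
  have h1 : {ω | ∃ v ∈ A, ∀ w ∈ A, p.speaks w t ω = true ↔ w = v} =
      ⋃ v ∈ A, ⋂ w ∈ A, p.speaks w t ⁻¹' {decide (w = v)} := by
    ext ω
    simp only [Set.mem_ofPred_eq, Set.mem_iUnion, Set.mem_iInter,
      Set.mem_preimage, Set.mem_singleton_iff, exists_prop]
    refine exists_congr fun v => and_congr_right fun _ => forall₂_congr fun w _ => ?_
    by_cases h : w = v <;> simp [h]
  have hm : ∀ v ∈ A, MeasurableSet (⋂ w ∈ A, p.speaks w t ⁻¹' {decide (w = v)}) := fun v _ =>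
    Finset.measurableSet_biInter _ fun w _ => p.measurable_speaks w t (measurableSet_singleton _)
  have hd : Set.PairwiseDisjoint (A : Set V)
      fun v => ⋂ w ∈ A, p.speaks w t ⁻¹' {decide (w = v)} := by
    intro v hv v' hv' hne
    rw [Function.onFun, Set.disjoint_left]
    intro ω hω hω'
    simp only [Set.mem_iInter, Set.mem_preimage, Set.mem_singleton_iff] at hω hω'
    have e1 := hω v hv
    have e2 := hω' v hv
    rw [e1] at e2
    simp at e2
    exact hne e2
  have hind : iIndepFun (fun v => p.speaks v t) (SINR.coins V) :=
    p.iIndepFun_speaks.precomp (g := fun v : V => (v, t)) fun v w h => by simpa using h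
  have hterm : ∀ v ∈ A, (SINR.coins V).real (⋂ w ∈ A, p.speaks w t ⁻¹' {decide (w = v)}) =
      (1 / 2) ^ p.subStage t * (1 - (1 / 2) ^ p.subStage t) ^ (A.card - 1) := by
    intro v hv
    rw [measureReal_def, hind.measure_inter_preimage_eq_mul A fun _ _ => measurableSet_singleton _,
      ENNReal.toReal_prod, ← Finset.mul_prod_erase A _ hv]
    have hv1 : ((SINR.coins V) (p.speaks v t ⁻¹' {decide (v = v)})).toReal = (1 / 2) ^ p.subStage t := by
      rw [← p.measureReal_speaks v t, measureReal_def]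
      congr 2
      ext; simp
    rw [hv1, Finset.prod_congr rfl (g := fun _ => 1 - (1 / 2 : ℝ) ^ p.subStage t), prod_const,
      card_erase_of_mem hv]
    intro w hw
    have hm : MeasurableSet {ω | p.speaks w t ω = true} :=
      p.measurable_speaks w t (measurableSet_singleton true)
    rw [← p.measureReal_speaks w t, ← probReal_compl_eq_one_sub hm, measureReal_def]
    congr 2
    ext; simp [ne_of_mem_erase hw]
  rw [h1, measureReal_biUnion_finset hd hm, Finset.sum_congr rfl hterm, sum_const, nsmul_eq_mul]

end Speaking

end WirelessDFS

end SINR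

/-! ### ESUN estimates given sets well with high probability. -/

namespace SINR

open MeasureTheory ProbabilityTheory

namespace WirelessDFS

variable {N : ℕ} (p : Params N) {V : Type*}

/-- The number of messages for which a sub-stage of ESUN counts. -/
def Params.threshold : ℝ := (p.d * lg N : ℝ) / 8 * (1 - p.ε)

open Classical in
/-- The number of rounds of sub-stage `i` among the first `T` rounds in which some element of `A` transmits. -/
def Params.busyCount (ω : V → ℕ → Bool) (A : Finset V) (T i : ℕ) : ℕ :=
  ((Finset.range T).filter fun t => p.subStage t = i ∧ ∃ v ∈ A, p.Speaks ω t v).card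

open Classical in
/-- The number of rounds of sub-stage `i` among the first `T` rounds in which exactly one element of `A` transmits. -/
def Params.loneCount (ω : V → ℕ → Bool) (A : Finset V) (T i : ℕ) : ℕ :=
  ((Finset.range T).filter fun t =>
    p.subStage t = i ∧ ∃ v ∈ A, ∀ w ∈ A, p.Speaks ω t w ↔ w = v).card

/-- Here `b` tells whether the owner receives something in round `T`. This lemma and the next one
keep its counter between the lone count and the busy count. Equality may fail on both sides, since a
message may or may not get through simultaneous transmissions. -/
theorem Params.le_busyCount_succ {ω : V → ℕ → Bool} {A : Finset V} {T : ℕ} {b : Bool}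
    (hb : b = true → ∃ v ∈ A, p.Speaks ω T v) (i : ℕ) :
    p.busyCount ω A T i + (if p.subStage T = i ∧ b = true then 1 else 0) ≤
      p.busyCount ω A (T + 1) i := by
  simp only [busyCount, Finset.card_filter, Finset.sum_range_succ]
  refine Nat.add_le_add_left ?_ _
  split_ifs with h1 h2
  · exact le_rfl
  · exact absurd ⟨h1.1, hb h1.2⟩ h2
  · exact Nat.zero_le _
  · exact le_rfl

theorem Params.loneCount_succ_le {ω : V → ℕ → Bool} {A : Finset V} {T : ℕ} {b : Bool}
    (hb : (∃ v ∈ A, ∀ w ∈ A, p.Speaks ω T w ↔ w = v) → b = true) (i : ℕ) :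
    p.loneCount ω A (T + 1) i ≤
      p.loneCount ω A T i + if p.subStage T = i ∧ b = true then 1 else 0 := by
  simp only [loneCount, Finset.card_filter, Finset.sum_range_succ]
  refine Nat.add_le_add_left ?_ _
  split_ifs with h1 h2 h2
  · exact le_rfl
  · exact absurd ⟨h1.1, hb h1.2⟩ h2
  · exact Nat.zero_le _
  · exact le_rfl

/-- ESUN estimates the size of the set `A` well: no sub-stage with far too low transmission
probability is busy, and one that is not too high for `A` has many rounds with a lone
transmission. -/
def Params.Good (ω : V → ℕ → Bool) (A : Finset V) : Prop :=
  (∀ i ∈ Finset.Icc 1 (lg N), 64 * A.card ≤ 2 ^ i → (p.busyCount ω A p.esunLength i : ℝ) < p.threshold) ∧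
  (A.Nonempty → ∃ i ∈ Finset.Icc 1 (lg N), A.card ≤ 2 ^ i ∧ p.threshold ≤ p.loneCount ω A p.esunLength i)

/-- The rounds of sub-stage `i`. -/
def Params.stage (i : ℕ) : Finset ℕ := Finset.Ico ((i - 1) * p.subLength) (i * p.subLength)

theorem Params.card_stage {i : ℕ} (hi : 1 ≤ i) : (p.stage i).card = p.subLength := by
  rw [stage, Nat.card_Ico, ← Nat.sub_mul]
  have : i - (i - 1) = 1 := by omega
  rw [this, one_mul]

theorem Params.mem_stage_iff {i : ℕ} (hd : 0 < p.subLength) (h1 : 1 ≤ i) (h2 : i ≤ lg N) (t : ℕ) :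
    t ∈ p.stage i ↔ t ∈ Finset.range p.esunLength ∧ p.subStage t = i := by
  obtain ⟨j, rfl⟩ : ∃ j, i = j + 1 := ⟨i - 1, by omega⟩
  rw [stage, Finset.mem_Ico, Finset.mem_range, subStage, Nat.add_sub_cancel, esunLength,
    Nat.add_right_cancel_iff, Nat.div_eq_iff hd]
  have h3 : (j + 1) * p.subLength ≤ lg N * p.subLength := Nat.mul_le_mul_right _ h2
  rw [Nat.succ_mul] at *
  omega

theorem Params.filter_stage {i : ℕ} (hd : 0 < p.subLength) (h1 : 1 ≤ i) (h2 : i ≤ lg N)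
    (q : ℕ → Prop) [DecidablePred q] [DecidablePred fun t => p.subStage t = i ∧ q t] :
    (Finset.range p.esunLength).filter (fun t => p.subStage t = i ∧ q t) =
      (p.stage i).filter q := by
  ext t
  rw [Finset.mem_filter, Finset.mem_filter, p.mem_stage_iff hd h1 h2, and_assoc]

/-- The worst case is `m = 2 ^ i`, which is `pow_le_four_mul_pred_pow`. -/
theorem quarter_le_one_sub_pow {m i : ℕ} (hm : m ≤ 2 ^ i) :
    (1 / 4 : ℝ) ≤ (1 - (1 / 2) ^ i) ^ (m - 1) := by
  have hx : 1 ≤ 2 ^ i := Nat.one_le_two_pow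
  have h1 := pow_le_four_mul_pred_pow (2 ^ i) hx
  have hpos : (0 : ℝ) < ((2 ^ i : ℕ) : ℝ) := by positivity
  have h2 : (1 - (1 / 2 : ℝ) ^ i) = ((2 ^ i - 1 : ℕ) : ℝ) / ((2 ^ i : ℕ) : ℝ) := by
    rw [Nat.cast_sub hx]
    field_simp
    push_cast
    rw [sub_mul, ← mul_pow]
    norm_num
  have h0 : (0 : ℝ) ≤ 1 - (1 / 2 : ℝ) ^ i := by rw [h2]; positivity
  have h3 : (1 - (1 / 2 : ℝ) ^ i) ≤ 1 := by
    have : (0 : ℝ) ≤ (1 / 2 : ℝ) ^ i := by positivity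
    linarith
  calc (1 / 4 : ℝ) ≤ (1 - (1 / 2) ^ i) ^ (2 ^ i - 1) := by
        rw [h2, div_pow, le_div_iff₀ (by positivity)]
        linarith
    _ ≤ _ := pow_le_pow_of_le_one h0 h3 (by omega)

section Tail

variable [Fintype V]

-- A round is busy with probability at most `|A| / 2 ^ i ≤ 1 / 64`, whereas `ε < 1 / 2` puts the
-- threshold above `1 / 16` of the rounds. The margin is `3 / 64`, and `2 (3 / 64) ^ 2 ≥ 1 / 256`.
open Classical in
theorem Params.measure_busy_le (A : Finset V) (hd : 0 < p.subLength) (hε : p.ε < 1 / 2) {i : ℕ}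
    (hi : i ∈ Finset.Icc 1 (lg N)) (hA : 64 * A.card ≤ 2 ^ i) :
    (SINR.coins V).real {ω | p.threshold ≤ p.busyCount (fun u j => ω (u, j)) A p.esunLength i} ≤
      Real.exp (-(1 / 256 * p.subLength)) := by
  obtain ⟨h1, h2⟩ := Finset.mem_Icc.1 hi
  have h := measure_le_card_le (μ := SINR.coins V)
    (Y := fun t ω => decide (∃ v ∈ A, p.speaks v t ω = true))
    (p.measurable_speaks_round fun b => decide (∃ v ∈ A, b v = true))
    (p.iIndepFun_speaks_round fun b => decide (∃ v ∈ A, b v = true))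
    (p.stage i) (q := 1 / 64) (δ := 3 / 64) (by norm_num) (by
      intro t ht
      simp only [decide_eq_true_iff]
      refine (p.measureReal_exists_speaks_le A t).trans ?_
      rw [((p.mem_stage_iff hd h1 h2 t).1 ht).2, one_div_pow, mul_one_div,
        div_le_div_iff₀ (by positivity) (by norm_num)]
      have : (64 * A.card : ℝ) ≤ 2 ^ i := by exact_mod_cast hA
      linarith)
  rw [p.card_stage h1] at h
  refine (measureReal_mono ?_).trans (h.trans (Real.exp_le_exp.2 ?_))
  · intro ω hω
    rw [Set.mem_ofPred_eq] at hω ⊢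
    rw [busyCount, p.filter_stage hd h1 h2] at hω
    have e : (p.stage i).filter (fun t => decide (∃ v ∈ A, p.speaks v t ω = true) = true) =
        (p.stage i).filter fun t => ∃ v ∈ A, p.Speaks (fun u j => ω (u, j)) t v := by
      refine Finset.filter_congr fun t _ => ?_
      simp only [decide_eq_true_iff, speaks]
    rw [e]
    refine le_trans ?_ hω
    have : (p.subLength : ℝ) = p.d * lg N := by rw [subLength]; push_cast; ring
    rw [threshold, ← this]
    have h0 : (0 : ℝ) ≤ p.subLength := by positivity
    nlinarith
  · have h0 : (0 : ℝ) ≤ p.subLength := by positivity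
    nlinarith

-- A round has a lone speaker with probability `|A| 2 ^ (-i) (1 - 2 ^ (-i)) ^ (|A| - 1) ≥ 1 / 2 * 1
-- / 4`. The threshold is `1 - ε` times an eighth of the rounds, so the margin is `ε / 8`.
open Classical in
theorem Params.measure_quiet_le (A : Finset V) (hd : 0 < p.subLength) (hε : 0 ≤ p.ε) {i : ℕ}
    (hi : i ∈ Finset.Icc 1 (lg N)) (hA : A.card ≤ 2 ^ i) (hA' : 2 ^ i ≤ 2 * A.card) :
    (SINR.coins V).real {ω | (p.loneCount (fun u j => ω (u, j)) A p.esunLength i : ℝ)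
        < p.threshold} ≤ Real.exp (-(p.ε ^ 2 / 32 * p.subLength)) := by
  obtain ⟨h1, h2⟩ := Finset.mem_Icc.1 hi
  have h := measure_card_le_le (μ := SINR.coins V)
    (Y := fun t ω => decide (∃ v ∈ A, ∀ w ∈ A, p.speaks w t ω = true ↔ w = v))
    (p.measurable_speaks_round fun b => decide (∃ v ∈ A, ∀ w ∈ A, b w = true ↔ w = v))
    (p.iIndepFun_speaks_round fun b => decide (∃ v ∈ A, ∀ w ∈ A, b w = true ↔ w = v))
    (p.stage i) (q := 1 / 8) (δ := p.ε / 8) (by positivity) (by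
      intro t ht
      simp only [decide_eq_true_iff]
      rw [p.measureReal_existsUnique_speaks A t, ((p.mem_stage_iff hd h1 h2 t).1 ht).2, ← mul_assoc]
      have h3 : (1 / 2 : ℝ) ≤ A.card * (1 / 2) ^ i := by
        rw [one_div_pow, mul_one_div, div_le_div_iff₀ (by norm_num) (by positivity)]
        have : (2 ^ i : ℝ) ≤ 2 * A.card := by exact_mod_cast hA'
        linarith
      have h4 := quarter_le_one_sub_pow hA
      calc (1 / 8 : ℝ) = 1 / 2 * (1 / 4) := by norm_num
        _ ≤ _ := mul_le_mul h3 h4 (by norm_num) (by positivity))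
  rw [p.card_stage h1] at h
  refine (measureReal_mono ?_).trans (h.trans (Real.exp_le_exp.2 ?_))
  · intro ω hω
    rw [Set.mem_ofPred_eq] at hω ⊢
    rw [loneCount, p.filter_stage hd h1 h2] at hω
    have e : (p.stage i).filter
        (fun t => decide (∃ v ∈ A, ∀ w ∈ A, p.speaks w t ω = true ↔ w = v) = true) =
        (p.stage i).filter
          fun t => ∃ v ∈ A, ∀ w ∈ A, p.Speaks (fun u j => ω (u, j)) t w ↔ w = v := by
      refine Finset.filter_congr fun t _ => ?_
      simp only [decide_eq_true_iff, speaks]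
    rw [e]
    refine hω.le.trans ?_
    have : (p.subLength : ℝ) = p.d * lg N := by rw [subLength]; push_cast; ring
    rw [threshold, ← this]
    apply le_of_eq
    ring
  · apply le_of_eq
    ring

/-- All sub-stages that are too high enter a union bound, whereas for lone speakers a single
suitable sub-stage is enough: `lg N + 1` bad events. The common exponent `ε ^ 2 / 64` is below `1 /
256` because `ε < 1 / 2`. -/
theorem Params.measure_not_good_le (A : Finset V) (hL : 1 ≤ lg N) (hd : 1 ≤ p.d) (hε : 0 ≤ p.ε)
    (hε' : p.ε < 1 / 2) (hA : A.card ≤ 2 ^ lg N) :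
    (SINR.coins V).real {ω | ¬ p.Good (fun u j => ω (u, j)) A} ≤
      (lg N + 1) * Real.exp (-(p.ε ^ 2 / 64 * p.subLength)) := by
  classical
  have hs : 0 < p.subLength := Nat.mul_pos hd hL
  set bad1 : ℕ → Set (V × ℕ → Bool) := fun i =>
    {ω | 64 * A.card ≤ 2 ^ i ∧ p.threshold ≤ p.busyCount (fun u j => ω (u, j)) A p.esunLength i} with hb1
  have he : ∀ i ∈ Finset.Icc 1 (lg N), (SINR.coins V).real (bad1 i) ≤
      Real.exp (-(p.ε ^ 2 / 64 * p.subLength)) := by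
    intro i hi
    by_cases h : 64 * A.card ≤ 2 ^ i
    · simp only [hb1, h, true_and]
      refine (p.measure_busy_le A hs hε' hi h).trans (Real.exp_le_exp.2 ?_)
      have h0 : (0 : ℝ) ≤ p.subLength := by positivity
      have : p.ε ^ 2 ≤ 1 / 4 := by nlinarith
      nlinarith
    · simp only [hb1, h, false_and]
      simp [Real.exp_nonneg]
  have hbad1 : (SINR.coins V).real (⋃ i ∈ Finset.Icc 1 (lg N), bad1 i) ≤
      lg N * Real.exp (-(p.ε ^ 2 / 64 * p.subLength)) := by
    refine (measureReal_biUnion_finset_le _ _).trans ((Finset.sum_le_sum he).trans ?_)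
    simp
  have hcover1 : ∀ ω, ω ∉ (⋃ i ∈ Finset.Icc 1 (lg N), bad1 i) → ∀ i ∈ Finset.Icc 1 (lg N),
      64 * A.card ≤ 2 ^ i → (p.busyCount (fun u j => ω (u, j)) A p.esunLength i : ℝ) < p.threshold := by
    intro ω hω i hi h64
    by_contra hcon
    exact hω (Set.mem_biUnion hi ⟨h64, not_lt.1 hcon⟩)
  rcases A.eq_empty_or_nonempty with rfl | hne
  · refine (measureReal_mono (s₂ := ⋃ i ∈ Finset.Icc 1 (lg N), bad1 i) ?_
      (measure_ne_top _ _)).trans (hbad1.trans ?_)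
    · intro ω hω
      by_contra hcon
      exact hω ⟨hcover1 ω hcon, fun h => absurd h Finset.not_nonempty_empty⟩
    · nlinarith [Real.exp_nonneg (-(p.ε ^ 2 / 64 * p.subLength))]
  · obtain ⟨i, hi, hi1, hi2⟩ : ∃ i ∈ Finset.Icc 1 (lg N), A.card ≤ 2 ^ i ∧ 2 ^ i ≤ 2 * A.card := by
      have hc : 1 ≤ A.card := hne.card_pos
      -- Sub-stages are numbered from `1`, while `Nat.clog 2 1 = 0`; a single node is therefore
      -- served by sub-stage `1`.
      rcases hc.eq_or_lt with h1 | h1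
      · exact ⟨1, by simp [hL], by omega, by omega⟩
      · refine ⟨Nat.clog 2 A.card, ?_, Nat.le_pow_clog one_lt_two _, ?_⟩
        · rw [Finset.mem_Icc]
          exact ⟨Nat.clog_pos one_lt_two h1, Nat.clog_le_of_le_pow hA⟩
        · have h2 := Nat.pow_pred_clog_lt_self one_lt_two h1
          have h3 : Nat.clog 2 A.card = (Nat.clog 2 A.card).pred + 1 :=
            (Nat.succ_pred_eq_of_pos (Nat.clog_pos one_lt_two h1)).symm
          rw [h3, pow_succ]
          omega
    set bad2 : Set (V × ℕ → Bool) := {ω | (p.loneCount (fun u j => ω (u, j)) A p.esunLength i : ℝ)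
        < p.threshold} with hbad2
    have hq : (SINR.coins V).real bad2 ≤ Real.exp (-(p.ε ^ 2 / 32 * p.subLength)) :=
      p.measure_quiet_le A hs hε hi hi1 hi2
    refine (measureReal_mono (s₂ := (⋃ i ∈ Finset.Icc 1 (lg N), bad1 i) ∪ bad2) ?_
      (measure_ne_top _ _)).trans ((measureReal_union_le _ _).trans
        ((add_le_add hbad1 hq).trans ?_))
    · intro ω hω
      by_contra hcon
      rw [Set.mem_union, not_or] at hcon
      exact hω ⟨hcover1 ω hcon.1, fun _ => ⟨i, hi, hi1, not_lt.1 hcon.2⟩⟩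
    · rw [add_mul, one_mul]
      refine add_le_add le_rfl (Real.exp_le_exp.2 ?_)
      have h0 : (0 : ℝ) ≤ p.subLength := by positivity
      nlinarith [sq_nonneg p.ε]

/-- With high probability, ESUN estimates well the sizes of polynomially many given sets. -/
theorem Params.one_sub_le_measure_good (hN : 2 ≤ N) (hV : 1 ≤ Fintype.card V)
    (hVN : Fintype.card V ≤ N) (hε : 0 < p.ε) (hε' : p.ε < 1 / 2) (a : ℕ)
    (hd : ((a + 4 : ℕ) : ℝ) * 64 / p.ε ^ 2 ≤ p.d) (𝒜 : List (Finset V))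
    (h𝒜 : 𝒜.length ≤ 3 * Fintype.card V) :
    1 - 1 / (Fintype.card V : ℝ) ^ a ≤
      (SINR.coins V).real {ω | ∀ A ∈ 𝒜, p.Good (fun u j => ω (u, j)) A} := by
  classical
  have hL : 1 ≤ lg N := Nat.clog_pos one_lt_two hN
  have hd1 : 1 ≤ p.d := by
    have : (0 : ℝ) < ((a + 4 : ℕ) : ℝ) * 64 / p.ε ^ 2 := by positivity
    exact_mod_cast this.trans_le hd
  have hN2 : N ≤ 2 ^ lg N := Nat.le_pow_clog one_lt_two N
  have hcard : ∀ A : Finset V, A.card ≤ 2 ^ lg N := fun A =>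
    (Finset.card_le_univ A).trans (hVN.trans hN2)
  set bad : Set (V × ℕ → Bool) := ⋃ A ∈ 𝒜.toFinset, {ω | ¬ p.Good (fun u j => ω (u, j)) A} with hbad
  -- Four of the `a + 4` powers of `2 ^ lg N` are spent on the union bound: one on `lg N + 1` and
  -- three on the length of the list, at most `4 * 2 ^ lg N`. The other `a` dominate `n ^ a`.
  have hE : Real.exp (-(p.ε ^ 2 / 64 * p.subLength)) ≤ 1 / 2 ^ ((a + 4) * lg N) := by
    rw [Real.exp_neg, ← one_div]
    apply one_div_le_one_div_of_le (by positivity)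
    have h1 : ((a + 4 : ℕ) : ℝ) * lg N ≤ p.ε ^ 2 / 64 * p.subLength := by
      rw [subLength]
      push_cast
      rw [div_le_iff₀ (by positivity)] at hd
      have : (0 : ℝ) ≤ lg N := by positivity
      push_cast at hd
      nlinarith
    calc (2 : ℝ) ^ ((a + 4) * lg N) ≤ Real.exp 1 ^ ((a + 4) * lg N) := by
          gcongr
          linarith [Real.exp_one_gt_d9]
      _ = Real.exp (((a + 4 : ℕ) : ℝ) * lg N) := by
          rw [← Real.exp_nat_mul]; congr 1; push_cast; ring
      _ ≤ _ := Real.exp_le_exp.2 h1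
  have hb : (SINR.coins V).real bad ≤ 1 / (Fintype.card V : ℝ) ^ a := by
    have hlen : (𝒜.toFinset.card : ℝ) ≤ 4 * 2 ^ lg N := by
      have h1 : 𝒜.toFinset.card ≤ 4 * 2 ^ lg N := by
        have := 𝒜.toFinset_card_le
        omega
      exact_mod_cast h1
    have hL2 : (lg N + 1 : ℝ) ≤ 2 ^ lg N := by exact_mod_cast Nat.lt_two_pow_self (n := lg N)
    have h4 : (4 : ℝ) ≤ 2 ^ lg N * 2 ^ lg N := by
      have : (2 : ℝ) ≤ 2 ^ lg N := by
        calc (2 : ℝ) = 2 ^ 1 := by norm_num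
          _ ≤ _ := by gcongr; norm_num
      nlinarith
    have hVa : (Fintype.card V : ℝ) ^ a ≤ 2 ^ (a * lg N) := by
      rw [mul_comm, pow_mul]
      gcongr
      exact_mod_cast hVN.trans hN2
    calc (SINR.coins V).real bad
        ≤ ∑ A ∈ 𝒜.toFinset, (SINR.coins V).real {ω | ¬ p.Good (fun u j => ω (u, j)) A} :=
          measureReal_biUnion_finset_le _ _
      _ ≤ ∑ _A ∈ 𝒜.toFinset, (2 : ℝ) ^ lg N * (1 / 2 ^ ((a + 4) * lg N)) := by
          refine Finset.sum_le_sum fun A _ => ?_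
          refine (p.measure_not_good_le A hL hd1 hε.le hε' (hcard A)).trans ?_
          gcongr
      _ = 𝒜.toFinset.card * ((2 : ℝ) ^ lg N * (1 / 2 ^ ((a + 4) * lg N))) := by simp
      _ ≤ (4 * 2 ^ lg N) * ((2 : ℝ) ^ lg N * (1 / 2 ^ ((a + 4) * lg N))) := by gcongr
      _ ≤ ((2 ^ lg N * 2 ^ lg N) * 2 ^ lg N) * ((2 : ℝ) ^ lg N * (1 / 2 ^ ((a + 4) * lg N))) := by
          gcongr
      _ = 1 / 2 ^ (a * lg N) := by
          rw [add_mul, pow_add]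
          have : (2 : ℝ) ^ (4 * lg N) = 2 ^ lg N * 2 ^ lg N * 2 ^ lg N * 2 ^ lg N := by
            rw [mul_comm, pow_mul]; ring
          rw [this]
          field_simp
      _ ≤ _ := one_div_le_one_div_of_le (by positivity) hVa
  have huniv : (1 : ℝ) ≤ (SINR.coins V).real bad +
      (SINR.coins V).real {ω | ∀ A ∈ 𝒜, p.Good (fun u j => ω (u, j)) A} := by
    rw [← probReal_univ (μ := SINR.coins V)]
    refine (measureReal_mono ?_).trans (measureReal_union_le _ _)
    intro ω _
    by_cases h : ∀ A ∈ 𝒜, p.Good (fun u j => ω (u, j)) A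
    · exact Or.inr h
    · left
      push Not at h
      obtain ⟨A, hA, hg⟩ := h
      exact Set.mem_biUnion (List.mem_toFinset.2 hA) hg
  linarith

end Tail

end WirelessDFS

end SINR

set_option linter.unusedSectionVars false

/-! ### Reception of a lone transmission. -/

namespace SINR

namespace Network

variable {V : Type*} [Fintype V] (net : Network V)

theorem Receives.adj {net : Network V} {T : Finset V} {v u : V} (h : net.Receives T v u) :
    net.commGraph.Adj v u :=
  ⟨fun e => h.2.1 (e ▸ h.1), h.2.2.2⟩

/-- A lone transmission is received by all neighbors of the transmitter. -/
theorem receives_singleton {v u : V} (h : net.commGraph.Adj v u) : net.Receives {v} v u := by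
  classical
  refine ⟨Finset.mem_singleton_self v, fun hu => h.1 (Finset.mem_singleton.1 hu).symm, ?_, h.2⟩
  have hd : 0 < dist (net.pos v) (net.pos u) := dist_pos.2 (net.pos_injective.ne h.1)
  have hβ : 0 < net.β := one_pos.trans_le net.one_le_β
  have hα : 0 < net.α := two_pos.trans net.two_lt_α
  have hq : 0 < net.power / (net.noise * net.β) := div_pos net.power_pos (mul_pos net.noise_pos hβ)
  have hr : 0 < net.range := Real.rpow_pos_of_pos hq _
  have hle : dist (net.pos v) (net.pos u) ≤ net.range := by
    refine h.2.trans ?_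
    nlinarith [net.ε_nonneg]
  have h1 : dist (net.pos v) (net.pos u) ^ net.α ≤ net.power / (net.noise * net.β) := by
    calc dist (net.pos v) (net.pos u) ^ net.α ≤ net.range ^ net.α :=
          Real.rpow_le_rpow hd.le hle hα.le
      _ = _ := by
          rw [range, ← Real.rpow_mul hq.le, one_div_mul_cancel hα.ne', Real.rpow_one]
  have hp : 0 < dist (net.pos v) (net.pos u) ^ net.α := Real.rpow_pos_of_pos hd _
  rw [sinr]
  have he : (({v} : Finset V).erase v) = ∅ := by simp
  rw [he, Finset.sum_empty, add_zero, signal, Real.rpow_neg hd.le, le_div_iff₀ net.noise_pos,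
    ← div_eq_mul_inv, le_div_iff₀ hp]
  rw [le_div_iff₀ (mul_pos net.noise_pos hβ)] at h1
  linarith

end Network

/-! ### Executions in which passive nodes are treated as listening nodes. -/

namespace WirelessDFS

variable {N : ℕ} (p : Params N) {V : Type} (net : Network V) (ω : V → ℕ → Bool)

/-- The message transmitted by `v` in the current round. The local states and the numbers of used
bits are given by `c`, a node that is not awake being in the state `fresh`. -/
def Params.emit (c : V → State N × ℕ) (v : V) : Option (Msg N) :=
  p.send (c v).1 fun i => ω v ((c v).2 + i)

theorem Params.emit_of_idle {c : V → State N × ℕ} {v : V} (h : (c v).1.phase = .idle) :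
    p.emit ω c v = none := by
  simp only [emit, send, h]

variable [Fintype V]

open Classical in
/-- The transmitters of the current round. -/
def Params.emitters (c : V → State N × ℕ) : Finset V :=
  Finset.univ.filter fun v => (p.emit ω c v).isSome

open Classical in
/-- The message that `u` receives in the current round. -/
def Params.heard (c : V → State N × ℕ) (u : V) : Option (Msg N) :=
  if h : ∃ v, net.Receives (p.emitters ω c) v u then p.emit ω c h.choose else none

/-- One round. -/
def Params.step (c : V → State N × ℕ) (u : V) : State N × ℕ :=
  (p.next (c u).1 (p.heard net ω c u), (c u).2 + p.coins (c u).1)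

/-- The configuration at the start. -/
def initial (name : V → Fin N) (source : V) (v : V) : State N × ℕ :=
  open Classical in
  (if v = source then { fresh (name v) with color := .grey, status := .viewed, phase := .calling }
    else fresh (name v), 0)

theorem Params.mem_emitters {c : V → State N × ℕ} {v : V} :
    v ∈ p.emitters ω c ↔ (p.emit ω c v).isSome := by
  simp [emitters]

section Simulation

variable {Rumor : Type} (name : V → Fin N) (source : V) (r : Rumor)

/-- `c` describes the configuration `c₀` in which all awake nodes know the rumor `r`. -/
def Describes (c : V → State N × ℕ) (c₀ : Config V Rumor (algorithm p)) : Prop :=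
  ∀ v, (c₀ v = none ∧ c v = (fresh (name v), 0)) ∨ c₀ v = some ⟨r, (c v).1, (c v).2⟩

variable {name r p}

theorem Describes.outgoing_eq {c : V → State N × ℕ} {c₀ : Config V Rumor (algorithm p)}
    (h : Describes p name r c c₀) (v : V) :
    outgoing (algorithm p) ω c₀ v = (p.emit ω c v).map fun m => (r, m) := by
  rcases h v with ⟨h1, h2⟩ | h1
  -- A passive node transmits nothing, and neither does a `fresh` one, whose phase is idle.
  · rw [p.emit_of_idle ω (by rw [h2]; rfl)]
    simp only [outgoing, h1]
    rfl
  · simp only [outgoing, h1, Params.emit]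
    rfl

theorem Describes.incoming_eq {c : V → State N × ℕ} {c₀ : Config V Rumor (algorithm p)}
    (h : Describes p name r c c₀) (u : V) :
    incoming net (algorithm p) ω c₀ u = (p.heard net ω c u).map fun m => (r, m) := by
  have ht : transmitters (algorithm p) ω c₀ = p.emitters ω c := by
    ext v
    simp [transmitters, Params.emitters, h.outgoing_eq ω v]
  unfold incoming Params.heard
  rw [ht]
  split_ifs with hv
  · exact h.outgoing_eq ω _
  · rfl

/-- Waking up with `m` means applying `react` to the `fresh` state, which is exactly what an idle
node does with a received message. So passive nodes can be replaced by `fresh` ones for good. -/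
theorem Describes.round {c : V → State N × ℕ} {c₀ : Config V Rumor (algorithm p)}
    (h : Describes p name r c c₀) :
    Describes p name r (p.step net ω c) (round net (algorithm p) name ω c₀) := by
  intro u
  have hin := h.incoming_eq net ω u
  rcases h u with ⟨h1, h2⟩ | h1
  · cases hm : p.heard net ω c u with
    | none =>
      rw [hm] at hin
      left
      simp only [SINR.round, h1, hin, Params.step, hm, h2]
      exact ⟨rfl, rfl⟩
    | some m =>
      rw [hm] at hin
      right
      simp only [SINR.round, h1, hin, Params.step, hm, h2]
      rfl
  · right
    simp only [SINR.round, h1, hin, Params.step]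
    cases p.heard net ω c u <;> rfl

theorem describes_run (t : ℕ) :
    Describes p name r ((p.step net ω)^[t] (initial name source))
      (run net (algorithm p) name ω source r t) := by
  induction t with
  | zero =>
    intro v
    by_cases hv : v = source
    · right
      simp only [run, Function.iterate_zero, id, initial, hv, if_true]
      rfl
    · left
      simp [run, initial, hv]
  | succ t ih =>
    rw [Function.iterate_succ_apply']
    exact ih.round net ω

end Simulation

/-! ### The number of random bits used, in every execution. -/

section RandomBits

/-- The random bits are used in ESUN only, and a node takes part in it at most once. -/
structure Params.Frugal (σ : State N) (u : ℕ) : Prop where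
  unexplored : σ.status = .unexplored → u = 0 ∧ ∀ t, σ.phase ≠ .estimate t
  estimate : ∀ t, σ.phase = .estimate t → u = p.tape t ∧ t < p.esunLength
  le : u ≤ p.tape p.esunLength

variable {p}

/-- The only way into the phase `estimate` is the reaction of an unexplored node to a call, and that
node is never unexplored again. No other phase draws bits. -/
theorem Params.Frugal.next {σ : State N} {u : ℕ} (hs : 0 < p.esunLength) (h : p.Frugal σ u)
    (m : Option (Msg N)) : p.Frugal (p.next σ m) (u + p.coins σ) := by
  obtain ⟨me, color, status, parent, pending, phase⟩ := σ
  obtain ⟨h1, h2, h3⟩ := h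
  dsimp only at h1 h2
  cases phase with
  | estimate t =>
    obtain ⟨hu, ht⟩ := h2 t rfl
    have hst : status ≠ .unexplored := fun e => (h1 e).2 t rfl
    have hc : u + p.coins ⟨me, color, status, parent, pending, .estimate t⟩ = p.tape (t + 1) := by
      rw [p.tape_succ, hu]; rfl
    rw [hc]
    refine ⟨fun e => absurd e hst, ?_, p.tape_mono (by omega)⟩
    intro t' ht'
    simp only [Params.next] at ht'
    split_ifs at ht' with hlt
    · cases ht'
      exact ⟨rfl, hlt⟩
  | idle =>
    cases m with
    | none => exact ⟨h1, h2, h3⟩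
    | some m =>
      change p.Frugal (react _ m) u
      unfold react
      cases m with
      | call s =>
        dsimp only
        split
        · refine ⟨fun e => by simp at e, fun t e => ?_, h3⟩
          cases e
          exact ⟨(h1 rfl).1, hs⟩
        · exact ⟨h1, h2, h3⟩
      | reply _ => exact ⟨h1, h2, h3⟩
      | learn c x =>
        dsimp only
        split
        · split_ifs
          · refine ⟨fun e => ⟨(h1 e).1, fun t e => by simp at e⟩, fun t e => by simp at e, h3⟩
          · exact ⟨h1, h2, h3⟩
        · exact ⟨h1, h2, h3⟩
      | viewed c v =>
        dsimp only
        split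
        · split_ifs
          · exact ⟨fun e => by simp at e, fun t e => by simp at e, h3⟩
          · exact ⟨h1, h2, h3⟩
        · exact ⟨h1, h2, h3⟩
      | token q v =>
        dsimp only
        split_ifs
        · split
          · exact ⟨fun e => ⟨(h1 e).1, fun t e => by simp at e⟩, fun t e => by simp at e, h3⟩
          · exact ⟨fun e => ⟨(h1 e).1, fun t e => by simp at e⟩, fun t e => by simp at e, h3⟩
        · exact ⟨h1, h2, h3⟩
  | announcing k j q =>
    cases q with
    | nil =>
      refine ⟨fun e => ⟨(h1 e).1, fun t e => ?_⟩, fun t e => ?_, h3⟩ <;>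
      · simp only [Params.next, afterIteration] at e
        split_ifs at e
    | cons v q =>
      refine ⟨fun e => ⟨(h1 e).1, fun t e => ?_⟩, fun t e => ?_, h3⟩ <;>
      · simp only [Params.next, afterIteration] at e
        split_ifs at e
  | passing =>
    simp only [Params.next]
    split_ifs
    · exact ⟨fun e => ⟨(h1 e).1, fun t e => by simp at e⟩, fun t e => by simp at e, h3⟩
    · exact ⟨fun e => ⟨(h1 e).1, fun t e => by simp at e⟩, fun t e => by simp at e, h3⟩
  | select x t =>
    refine ⟨fun e => ⟨(h1 e).1, fun t e => ?_⟩, fun t e => ?_, h3⟩ <;>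
    · simp only [Params.next] at e
      split_ifs at e
  | calling =>
    exact ⟨fun e => ⟨(h1 e).1, fun t e => by simp [Params.next] at e⟩,
      fun t e => by simp [Params.next] at e, h3⟩
  | counting t cnt =>
    refine ⟨fun e => ⟨(h1 e).1, fun t e => ?_⟩, fun t e => ?_, h3⟩ <;>
    · simp only [Params.next] at e
      split_ifs at e
  | asking k j =>
    exact ⟨fun e => ⟨(h1 e).1, fun t e => by simp [Params.next] at e⟩,
      fun t e => by simp [Params.next] at e, h3⟩
  | learning k j t heard =>
    refine ⟨fun e => ⟨(h1 e).1, fun t e => ?_⟩, fun t e => ?_, h3⟩ <;>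
    · simp only [Params.next] at e
      split_ifs at e

theorem Params.frugal_run (hs : 0 < p.esunLength) (name : V → Fin N) (source : V) (t : ℕ) (v : V) :
    p.Frugal ((p.step net ω)^[t] (initial name source) v).1
      ((p.step net ω)^[t] (initial name source) v).2 := by
  induction t with
  | zero =>
    simp only [Function.iterate_zero, id, initial]
    split_ifs
    · exact ⟨fun e => by simp at e, fun t e => by simp at e, Nat.zero_le _⟩
    · exact ⟨fun _ => ⟨rfl, fun t e => by simp [fresh] at e⟩, fun t e => by simp [fresh] at e,
        Nat.zero_le _⟩
  | succ t ih =>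
    rw [Function.iterate_succ_apply']
    exact ih.next hs _

/-- ESUN has `d (lg N) ^ 2` rounds with at most `lg N` bits in each. -/
theorem Params.tape_esunLength_le : p.tape p.esunLength ≤ p.d * lg N ^ 3 := by
  calc p.tape p.esunLength ≤ ∑ _t ∈ Finset.range p.esunLength, lg N := by
        refine Finset.sum_le_sum fun t ht => ?_
        rw [Finset.mem_range, esunLength] at ht
        exact Nat.div_lt_of_lt_mul (by rwa [mul_comm] at ht)
    _ = p.d * lg N ^ 3 := by
        simp only [Finset.sum_const, Finset.card_range, smul_eq_mul, esunLength, subLength]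
        ring

end RandomBits

end WirelessDFS

end SINR

/-! ### Single rounds of an exploration. -/

namespace SINR

namespace WirelessDFS

variable {N : ℕ} {p : Params N} {V : Type} [Fintype V] {net : Network V} {ω : V → ℕ → Bool}

section Reception

variable {c : V → State N × ℕ}

/-- Weak sensitivity contains the distance bound of the communication graph, so this holds under any
interference. -/
theorem Params.exists_emit_of_heard {u : V} {m : Msg N} (h : p.heard net ω c u = some m) :
    ∃ v, net.commGraph.Adj v u ∧ p.emit ω c v = some m := by
  rw [heard] at h
  split_ifs at h with hv
  exact ⟨_, hv.choose_spec.adj, h⟩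

theorem Params.heard_of_lone {s u : V} {m : Msg N} (hs : p.emit ω c s = some m)
    (ho : ∀ v, v ≠ s → p.emit ω c v = none) (h : net.commGraph.Adj s u) :
    p.heard net ω c u = some m := by
  have he : p.emitters ω c = {s} := by
    ext v
    rw [p.mem_emitters, Finset.mem_singleton]
    constructor
    · intro hv
      by_contra hne
      simp [ho v hne] at hv
    · rintro rfl
      simp [hs]
  have hex : ∃ v, net.Receives (p.emitters ω c) v u := ⟨s, he ▸ net.receives_singleton h⟩
  rw [heard, dif_pos hex]
  have hmem : ∀ v ∈ p.emitters ω c, p.emit ω c v = some m := fun v hv => by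
    rw [he, Finset.mem_singleton] at hv
    rw [hv, hs]
  exact hmem _ hex.choose_spec.1

theorem Params.heard_of_not_adj {s u : V} (ho : ∀ v, v ≠ s → p.emit ω c v = none)
    (h : ¬ net.commGraph.Adj s u) : p.heard net ω c u = none := by
  by_contra hne
  obtain ⟨m, hm⟩ := Option.ne_none_iff_exists'.1 hne
  obtain ⟨v, hv, hvm⟩ := Params.exists_emit_of_heard hm
  by_cases hvs : v = s
  · exact h (hvs ▸ hv)
  · simp [ho v hvs] at hvm

theorem Params.next_idle_none {σ : State N} (h : σ.phase = .idle) : p.next σ none = σ := by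
  simp [next, h]

theorem Params.next_idle_some {σ : State N} (h : σ.phase = .idle) (m : Msg N) :
    p.next σ (some m) = react σ m := by
  simp [next, h]

theorem Params.coins_of_idle {σ : State N} (h : σ.phase = .idle) : p.coins σ = 0 := by
  simp [coins, h]

/-- A node that only listens is not affected by a message that does not concern it. -/
theorem Params.step_of_idle {u : V} (h : (c u).1.phase = .idle)
    (hm : ∀ m, p.heard net ω c u = some m → react (c u).1 m = (c u).1) :
    p.step net ω c u = c u := by
  rw [step, Params.coins_of_idle h, Nat.add_zero]
  cases hh : p.heard net ω c u with
  | none => rw [Params.next_idle_none h]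
  | some m => rw [Params.next_idle_some h, hm m hh]

open Classical in
/-- A round in which `s` transmits and the other nodes listen. -/
theorem Params.step_of_lone {s v : V} {m : Msg N} (hm : p.emit ω c s = some m)
    (hidle : ∀ w, w ≠ s → (c w).1.phase = .idle) (hvs : v ≠ s) :
    p.step net ω c v = (if net.commGraph.Adj s v then react (c v).1 m else (c v).1, (c v).2) := by
  have ho : ∀ w, w ≠ s → p.emit ω c w = none := fun w hw => p.emit_of_idle ω (hidle w hw)
  rw [Params.step, Params.coins_of_idle (hidle v hvs)]
  split_ifs with hadj
  · rw [Params.heard_of_lone hm ho hadj, Params.next_idle_some (hidle v hvs)]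
    rfl
  · rw [Params.heard_of_not_adj ho hadj, Params.next_idle_none (hidle v hvs)]
    rfl

end Reception

variable [DecidableEq V]

variable {name : V → Fin N} {st : V → State N} {s : V} {A : Finset V}

/-- The node `s` is about to explore the set `A` of its unexplored neighbors. -/
structure Ready (net : Network V) (name : V → Fin N) (st : V → State N) (s : V) (A : Finset V) :
    Prop where
  injective : Function.Injective name
  me : (st s).me = name s
  idle : ∀ v, v ≠ s → (st v).phase = .idle
  not_called : ∀ v x, (st v).status ≠ .called x
  mem_iff : ∀ v, v ∈ A ↔ net.commGraph.Adj s v ∧ (st v).status = .unexplored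
  eq_fresh : ∀ v ∈ A, st v = fresh (name v)

/-- The configuration while `s` explores `A`: the nodes in `R` have been called by `s`, but not yet
announced by it. -/
def arena (name : V → Fin N) (st : V → State N) (s : V) (A : Finset V) (pend : Finset (Fin N))
    (ph : Phase N) (R : Finset V) (ph' : Phase N) (used : V → ℕ) (v : V) : State N × ℕ :=
  (if v = s then { st s with pending := pend, phase := ph }
    else if v ∈ R then { fresh (name v) with status := .called (name s), phase := ph' }
    else if v ∈ A then { fresh (name v) with status := .viewed }
    else st v, used v)

theorem Ready.notMem (h : Ready net name st s A) : s ∉ A := fun hs =>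
  ((h.mem_iff s).1 hs).1.1 rfl

section Arena

variable {pend : Finset (Fin N)} {ph ph' : Phase N} {R : Finset V} {used : V → ℕ} {v : V}

theorem arena_self : arena name st s A pend ph R ph' used s =
    ({ st s with pending := pend, phase := ph }, used s) := by
  simp [arena]

theorem arena_called (hv : v ∈ R) (hs : v ≠ s) : arena name st s A pend ph R ph' used v =
    ({ fresh (name v) with status := .called (name s), phase := ph' }, used v) := by
  simp [arena, hv, hs]

/-- The bystanders: they listen, and no message sent during the exploration concerns them, since
they are not called and those among them that hear the owner are already explored. -/
theorem Ready.arena_other (h : Ready net name st s A) (hv : v ∉ R) (hs : v ≠ s) :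
    (arena name st s A pend ph R ph' used v).1.phase = .idle ∧
    (∀ x, (arena name st s A pend ph R ph' used v).1.status ≠ .called x) ∧
    (net.commGraph.Adj s v → (arena name st s A pend ph R ph' used v).1.status ≠ .unexplored) := by
  simp only [arena, hv, hs, if_false]
  split_ifs with hA
  · exact ⟨rfl, fun x => by simp, fun _ => by simp⟩
  · exact ⟨h.idle v hs, h.not_called v, fun hadj hun => hA ((h.mem_iff v).2 ⟨hadj, hun⟩)⟩

theorem arena_congr_other {pend₂ : Finset (Fin N)} {ph₂ ph₂' : Phase N} (hv : v ∉ R) (hs : v ≠ s) :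
    arena name st s A pend ph R ph' used v = arena name st s A pend₂ ph₂ R ph₂' used v := by
  simp [arena, hv, hs]

end Arena

/-- First round of ESUN. -/
theorem Ready.step_calling (h : Ready net name st s A) (hph : (st s).phase = .calling)
    (used : V → ℕ) :
    p.step net ω (fun v => (st v, used v)) =
      arena name st s A (st s).pending (.counting 0 fun _ => 0) A (.estimate 0) used := by
  have hs : p.emit ω (fun v => (st v, used v)) s = some (.call (name s)) := by
    simp [Params.emit, Params.send, hph, h.me]
  have ho : ∀ v, v ≠ s → p.emit ω (fun v => (st v, used v)) v = none := fun v hv =>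
    p.emit_of_idle ω (h.idle v hv)
  funext v
  by_cases hv : v = s
  · subst hv
    rw [arena_self]
    simp [Params.step, Params.next, Params.coins, hph]
  by_cases hA : v ∈ A
  · rw [arena_called hA hv]
    have hadj := ((h.mem_iff v).1 hA).1
    simp only [Params.step]
    rw [Params.heard_of_lone hs ho hadj, Params.next_idle_some (h.idle v hv),
      Params.coins_of_idle (h.idle v hv), h.eq_fresh v hA]
    rfl
  · rw [Params.step_of_idle (h.idle v hv)]
    · simp [arena, hv, hA]
    · intro m hm
      by_cases hadj : net.commGraph.Adj s v
      · rw [Params.heard_of_lone hs ho hadj] at hm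
        cases hm
        have hun : (st v).status ≠ .unexplored := fun e => hA ((h.mem_iff v).2 ⟨hadj, e⟩)
        simp only [react]
      · rw [Params.heard_of_not_adj ho hadj] at hm
        cases hm

/-- Rounds in which the owner listens and the called nodes transmit their labels. -/
theorem Ready.step_listening (h : Ready net name st s A) {pend : Finset (Fin N)} {ph ph' : Phase N}
    {R : Finset V} {used : V → ℕ}
    (hs : p.emit ω (arena name st s A pend ph R ph' used) s = none)
    (hr : ∀ v ∈ R, ∀ m, p.emit ω (arena name st s A pend ph R ph' used) v = some m →
      m = .reply (name v)) {v : V} (hv : v ∉ R) (hvs : v ≠ s) :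
    p.step net ω (arena name st s A pend ph R ph' used) v =
      arena name st s A pend ph R ph' used v := by
  refine Params.step_of_idle (h.arena_other hv hvs).1 fun m hm => ?_
  obtain ⟨w, -, hw⟩ := Params.exists_emit_of_heard hm
  by_cases hws : w = s
  · rw [hws, hs] at hw
    cases hw
  by_cases hwR : w ∈ R
  · rw [hr w hwR m hw]
    rfl
  · rw [p.emit_of_idle ω (h.arena_other hwR hws).1] at hw
    cases hw

/-- What the owner hears in a round in which it listens: the label of a transmitting called node,
and certainly something if exactly one of them transmits. -/
theorem Ready.heard_listening (h : Ready net name st s A) {pend : Finset (Fin N)} {ph ph' : Phase N}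
    {R : Finset V} {used : V → ℕ} (hR : R ⊆ A) {talk : V → Prop}
    (hs : p.emit ω (arena name st s A pend ph R ph' used) s = none)
    (hr : ∀ v ∈ R, talk v →
      p.emit ω (arena name st s A pend ph R ph' used) v = some (.reply (name v)))
    (hr' : ∀ v ∈ R, ¬ talk v → p.emit ω (arena name st s A pend ph R ph' used) v = none) :
    (∀ m, p.heard net ω (arena name st s A pend ph R ph' used) s = some m →
      ∃ v ∈ R, talk v ∧ m = .reply (name v)) ∧
    ∀ v ∈ R, (∀ w ∈ R, talk w ↔ w = v) →
      p.heard net ω (arena name st s A pend ph R ph' used) s = some (.reply (name v)) := by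
  have ho : ∀ w, w ∉ R → p.emit ω (arena name st s A pend ph R ph' used) w = none := by
    intro w hw
    by_cases hws : w = s
    · rw [hws, hs]
    · exact p.emit_of_idle ω (h.arena_other hw hws).1
  constructor
  · intro m hm
    obtain ⟨w, -, hw⟩ := Params.exists_emit_of_heard hm
    by_cases hwR : w ∈ R
    · by_cases ht : talk w
      · rw [hr w hwR ht] at hw
        cases hw
        exact ⟨w, hwR, ht, rfl⟩
      · rw [hr' w hwR ht] at hw
        cases hw
    · rw [ho w hwR] at hw
      cases hw
  · intro v hv hlone
    refine Params.heard_of_lone (hr v hv ((hlone v hv).2 rfl)) (fun w hw => ?_)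
      ((h.mem_iff v).1 (hR hv)).1.symm
    by_cases hwR : w ∈ R
    · exact hr' w hwR fun ht => hw ((hlone w hwR).1 ht)
    · exact ho w hwR

/-- The bits used by the called nodes after `t` rounds of ESUN. -/
def Params.usedAfter (p : Params N) (A : Finset V) (used : V → ℕ) (t : ℕ) (v : V) : ℕ :=
  if v ∈ A then p.tape t else used v

section ESUN

variable {pend : Finset (Fin N)} {used : V → ℕ} {t : ℕ} {cnt : ℕ → ℕ}

/-- The configuration in round `t` of ESUN. -/
abbrev esunArena (p : Params N) (name : V → Fin N) (st : V → State N) (s : V) (A : Finset V)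
    (pend : Finset (Fin N)) (used : V → ℕ) (t : ℕ) (cnt : ℕ → ℕ) : V → State N × ℕ :=
  arena name st s A pend (.counting t cnt) A (.estimate t) (p.usedAfter A used t)

theorem Ready.emit_esun_speaks (h : Ready net name st s A) {v : V} (hv : v ∈ A)
    (ht : p.Speaks ω t v) :
    p.emit ω (esunArena p name st s A pend used t cnt) v = some (.reply (name v)) := by
  have hvs : v ≠ s := fun e => h.notMem (e ▸ hv)
  have e : esunArena p name st s A pend used t cnt v =
      ({ fresh (name v) with status := .called (name s), phase := .estimate t }, p.tape t) := by
    rw [esunArena, arena_called hv hvs, Params.usedAfter, if_pos hv]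
  rw [Params.emit, e]
  simp only [Params.send]
  rw [if_pos]
  · rfl
  · intro i
    exact ht i i.2

theorem Ready.emit_esun_not_speaks (h : Ready net name st s A) {v : V} (hv : v ∈ A)
    (ht : ¬ p.Speaks ω t v) :
    p.emit ω (esunArena p name st s A pend used t cnt) v = none := by
  have hvs : v ≠ s := fun e => h.notMem (e ▸ hv)
  have e : esunArena p name st s A pend used t cnt v =
      ({ fresh (name v) with status := .called (name s), phase := .estimate t }, p.tape t) := by
    rw [esunArena, arena_called hv hvs, Params.usedAfter, if_pos hv]
  rw [Params.emit, e]
  simp only [Params.send]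
  rw [if_neg]
  exact fun hall => ht fun i hi => hall ⟨i, hi⟩

/-- The counters after a round of ESUN in which the owner received `m`. -/
def Params.count (p : Params N) (t : ℕ) (cnt : ℕ → ℕ) (m : Option (Msg N)) : ℕ → ℕ :=
  if m.isSome then Function.update cnt (p.subStage t) (cnt (p.subStage t) + 1) else cnt

/-- Of the message `m` heard by the owner only two implications are kept, as its fate among
simultaneous transmissions depends on the geometry. Until the last round only the owner's counters
depend on `ω`. -/
theorem Ready.step_esun (h : Ready net name st s A) :
    ∃ m : Option (Msg N), (m.isSome → ∃ v ∈ A, p.Speaks ω t v) ∧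
      ((∃ v ∈ A, ∀ w ∈ A, p.Speaks ω t w ↔ w = v) → m.isSome) ∧
      p.step net ω (esunArena p name st s A pend used t cnt) =
        if t + 1 < p.esunLength then esunArena p name st s A pend used (t + 1) (p.count t cnt m)
        else arena name st s A pend (if p.estimateExponent (p.count t cnt m) = 0 then .passing
          else .asking (p.estimateExponent (p.count t cnt m)) 0) A .idle
          (p.usedAfter A used (t + 1)) := by
  have hs : p.emit ω (esunArena p name st s A pend used t cnt) s = none := by
    rw [Params.emit, esunArena, arena_self]
    simp [Params.send]
  obtain ⟨h1, h2⟩ := h.heard_listening (talk := p.Speaks ω t) subset_rfl hs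
    (fun v hv => h.emit_esun_speaks hv) (fun v hv => h.emit_esun_not_speaks hv)
  refine ⟨p.heard net ω (esunArena p name st s A pend used t cnt) s, ?_, ?_, ?_⟩
  · intro hm
    obtain ⟨m, hm⟩ := Option.isSome_iff_exists.1 hm
    obtain ⟨v, hv, ht, -⟩ := h1 m hm
    exact ⟨v, hv, ht⟩
  · rintro ⟨v, hv, hlone⟩
    rw [h2 v hv hlone]
    rfl
  · funext v
    by_cases hvs : v = s
    · subst hvs
      have hu : ∀ t, p.usedAfter A used t v = used v := fun t => if_neg h.notMem
      rw [Params.step]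
      generalize p.heard net ω (esunArena p name st v A pend used t cnt) v = m
      have hn : p.next { st v with pending := pend, phase := .counting t cnt } m =
          { st v with
            pending := pend
            phase := if t + 1 < p.esunLength then .counting (t + 1) (p.count t cnt m)
              else if p.estimateExponent (p.count t cnt m) = 0 then .passing
              else .asking (p.estimateExponent (p.count t cnt m)) 0 } := rfl
      rw [esunArena, arena_self, hn]
      split_ifs with hlt <;> simp only [esunArena, arena_self, hu] <;> rfl
    · by_cases hA : v ∈ A
      · have hu : ∀ t, p.usedAfter A used t v = p.tape t := fun t => if_pos hA
        rw [Params.step]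
        generalize p.heard net ω (esunArena p name st s A pend used t cnt) v = m
        rw [esunArena, arena_called hA hvs]
        split_ifs with hlt <;>
          simp [arena_called hA hvs, hu, Params.next, Params.coins, hlt, p.tape_succ]
      · rw [h.step_listening hs _ hA hvs]
        · split_ifs <;> simp [arena, hvs, hA, Params.usedAfter]
        · intro w hw m hm
          by_cases ht : p.Speaks ω t w
          · rw [h.emit_esun_speaks hw ht] at hm
            cases hm; rfl
          · rw [h.emit_esun_not_speaks hw ht] at hm
            cases hm

end ESUN

end WirelessDFS

end SINR

/-! ### The declared bound, the parameters of LUN, and the outcome of ESUN. -/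

namespace SINR

namespace WirelessDFS

variable {N : ℕ} {p : Params N} {V : Type} [Fintype V] {net : Network V} {ω : V → ℕ → Bool}

section Estimate

variable {A : Finset V} {cnt : ℕ → ℕ}

/-- If ESUN estimates `A` well, the declared bound is right up to a constant factor. -/
theorem Params.Good.estimateExponent (h : p.Good ω A)
    (hcnt : ∀ i, p.loneCount ω A p.esunLength i ≤ cnt i ∧
      cnt i ≤ p.busyCount ω A p.esunLength i) :
    (A = ∅ → p.estimateExponent cnt = 0) ∧
    (A.Nonempty → p.estimateExponent cnt ≠ 0 ∧ p.estimateExponent cnt ≤ lg N ∧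
      A.card ≤ 2 ^ p.estimateExponent cnt ∧ 2 ^ p.estimateExponent cnt ≤ 64 * A.card) := by
  classical
  -- A sub-stage that reaches the threshold was often busy, so by `Good` its transmission
  -- probability was not too low for `A`. Applied to the highest such sub-stage, this bounds the
  -- declared value from above.
  have hmem : ∀ i ∈ Finset.Icc 1 (lg N), p.threshold ≤ cnt i → 2 ^ i < 64 * A.card := by
    intro i hi hle
    by_contra hlt
    have h1 := h.1 i hi (not_lt.1 hlt)
    have h2 : (cnt i : ℝ) ≤ p.busyCount ω A p.esunLength i := by exact_mod_cast (hcnt i).2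
    linarith
  -- The supremum of the empty set is `0`, so a nonzero value is attained by some sub-stage.
  have hsup : p.estimateExponent cnt ≠ 0 → p.estimateExponent cnt ∈ Finset.Icc 1 (lg N) ∧
      p.threshold ≤ cnt (p.estimateExponent cnt) := by
    intro hne
    have hs : ((Finset.Icc 1 (lg N)).filter fun i =>
        (p.d * lg N : ℝ) / 8 * (1 - p.ε) ≤ (cnt i : ℝ)).Nonempty := by
      rw [Finset.nonempty_iff_ne_empty]
      intro he
      apply hne
      rw [Params.estimateExponent]
      convert! Finset.sup_empty
    obtain ⟨k, hk, hk'⟩ := Finset.exists_mem_eq_sup _ hs id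
    have : p.estimateExponent cnt = k := by
      rw [Params.estimateExponent]
      convert! hk'
    rw [this]
    exact ⟨(Finset.mem_filter.1 hk).1, (Finset.mem_filter.1 hk).2⟩
  have hle : ∀ i ∈ Finset.Icc 1 (lg N), p.threshold ≤ cnt i → i ≤ p.estimateExponent cnt := by
    intro i hi hc
    rw [Params.estimateExponent]
    exact Finset.le_sup (f := id) (Finset.mem_filter.2 ⟨hi, hc⟩)
  constructor
  · intro hA
    by_contra hne
    have := hmem _ (hsup hne).1 (hsup hne).2
    simp [hA] at this
  · intro hA
    obtain ⟨i, hi, hc, hl⟩ := h.2 hA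
    have hik := hle i hi (hl.trans (by exact_mod_cast (hcnt i).1))
    have hi1 := (Finset.mem_Icc.1 hi).1
    have hne : p.estimateExponent cnt ≠ 0 := by omega
    exact ⟨hne, (Finset.mem_Icc.1 (hsup hne).1).2,
      hc.trans (Nat.pow_le_pow_right two_pos hik), (hmem _ (hsup hne).1 (hsup hne).2).le⟩

end Estimate

section LunSize

theorem lunSize_le (k j : ℕ) : lunSize k j ≤ 2 ^ k := by
  rw [lunSize, Nat.ceil_le, lunFraction]
  push_cast
  have h1 : (1 - 99 / 100 : ℚ) ^ j ≤ 1 := pow_le_one₀ (by norm_num) (by norm_num)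
  have h2 : (0 : ℚ) < 2 ^ k := by positivity
  nlinarith

theorem one_le_lunSize (k j : ℕ) : 1 ≤ lunSize k j := by
  rw [lunSize, Nat.one_le_ceil_iff, lunFraction]
  positivity

/-- If only one percent of the parameter of iteration `j` remains, the next parameter is large
enough. Rounding up does no harm, because `lunSize k j ≤ 100 * lunSize k (j + 1)`. -/
theorem le_lunSize_succ {k j u : ℕ} (h : 100 * u ≤ lunSize k j) : u ≤ lunSize k (j + 1) := by
  have h1 : (1 - lunFraction) ^ j * 2 ^ k ≤ (100 * lunSize k (j + 1) : ℕ) := by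
    have := Nat.le_ceil ((1 - lunFraction) ^ (j + 1) * 2 ^ k)
    rw [pow_succ] at this
    rw [lunSize, pow_succ]
    push_cast
    have e : (1 - lunFraction) = 1 / 100 := by rw [lunFraction]; norm_num
    rw [e] at this ⊢
    linarith
  have h2 : lunSize k j ≤ 100 * lunSize k (j + 1) := Nat.ceil_le.2 h1
  omega

theorem lunSize_lunLast_le (k : ℕ) : lunSize k (lunLast k) ≤ 1 := by
  rw [lunSize, Nat.ceil_le, lunFraction, lunLast]
  have h : 2 ^ k ≤ 100 ^ Nat.clog 100 (2 ^ k) := Nat.le_pow_clog (by norm_num) _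
  have h' : (2 : ℚ) ^ k ≤ 100 ^ Nat.clog 100 (2 ^ k) := by exact_mod_cast h
  have e : (1 - 99 / 100 : ℚ) = 1 / 100 := by norm_num
  rw [e, one_div_pow, one_div_mul_eq_div, div_le_iff₀ (by positivity)]
  simpa using h'

theorem lunLast_lt (k : ℕ) : lunLast k + 1 ≤ 2 ^ k := by
  have h : lunLast k ≤ k := Nat.clog_le_of_le_pow (Nat.pow_le_pow_left (by norm_num) k)
  have := Nat.lt_two_pow_self (n := k)
  omega

/-- The geometric series contributes at most `2 * 2 ^ k`. Rounding up adds at most one per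
iteration, hence at most `2 ^ k` by `lunLast_lt`. -/
theorem sum_lunSize_le (k : ℕ) : ∑ j ∈ Finset.range (lunLast k + 1), lunSize k j ≤ 3 * 2 ^ k := by
  have key : ∀ n : ℕ, ((∑ j ∈ Finset.range n, lunSize k j : ℕ) : ℚ) ≤
      2 ^ k * (2 - 2 * (1 / 100) ^ n) + n := by
    intro n
    induction n with
    | zero =>
      simp
    | succ n ih =>
      rw [Finset.sum_range_succ]
      have h1 : (lunSize k n : ℚ) ≤ (1 / 100) ^ n * 2 ^ k + 1 := by
        have e : (1 - lunFraction) = 1 / 100 := by rw [lunFraction]; norm_num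
        rw [lunSize, e]
        exact (Nat.ceil_lt_add_one (by positivity)).le
      push_cast at ih ⊢
      rw [pow_succ]
      have h2 : (0 : ℚ) ≤ (1 / 100) ^ n * 2 ^ k := by positivity
      nlinarith
  have h := key (lunLast k + 1)
  have h1 : ((lunLast k + 1 : ℕ) : ℚ) ≤ 2 ^ k := by exact_mod_cast lunLast_lt k
  have h2 : (0 : ℚ) ≤ 2 ^ k * (1 / 100) ^ (lunLast k + 1) := by positivity
  have h3 : ((∑ j ∈ Finset.range (lunLast k + 1), lunSize k j : ℕ) : ℚ) ≤ (3 * 2 ^ k : ℕ) := by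
    push_cast at h h1 ⊢
    nlinarith
  exact_mod_cast h3

end LunSize

section Selectors

variable {name : V → Fin N}

/-- When at most `x` nodes execute the selector of parameter `x`, all but one percent of `x` of them
transmit alone in some round. -/
theorem card_not_isolated_le {K : ℝ} (hsel : IsSelectorFamily K p.sel) (hL : 1 ≤ lg N)
    (hname : Function.Injective name) {x : ℕ} (hx : 1 ≤ x) (hx' : x ≤ 2 ^ lg N) {R U : Finset V}
    (hR : R.card ≤ x) (hUR : U ⊆ R) (hU : ∀ v ∈ U, ¬ ∃ t < (p.sel (lg N) x).length,
      ∀ w ∈ R, p.Selected x t (name w) ↔ w = v) :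
    100 * U.card ≤ x := by
  classical
  set e : V → Fin (2 ^ lg N) := fun v => Fin.castLE (Nat.le_pow_clog one_lt_two N) (name v) with he
  have hinj : Function.Injective e := fun v w h => hname (Fin.castLE_injective _ h)
  -- A selector speaks of sets of size exactly `x`, so `R` is enlarged to such a set; an element of
  -- `R` that is isolated in the larger set is also isolated in `R`.
  obtain ⟨A', hA', -, hc⟩ := Finset.exists_subsuperset_card_eq (n := x) (Finset.subset_univ (R.image e))
    (by rwa [Finset.card_image_of_injective _ hinj]) (by simpa using hx')
  have hS := (hsel (lg N) x hL hx hx').1 A' hc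
  set good := A'.filter fun a => ∃ B ∈ p.sel (lg N) x, B ∩ A' = {a} with hgood
  have hsub : U.image e ⊆ A' \ good := by
    intro a ha
    obtain ⟨v, hv, rfl⟩ := Finset.mem_image.1 ha
    rw [Finset.mem_sdiff]
    refine ⟨hA' (Finset.mem_image_of_mem e (hUR hv)), fun hg => hU v hv ?_⟩
    rw [hgood, Finset.mem_filter] at hg
    obtain ⟨B, hB, hBA⟩ := hg.2
    obtain ⟨t, ht, rfl⟩ := List.mem_iff_getElem.1 hB
    refine ⟨t, ht, fun w hw => ?_⟩
    have hwA : e w ∈ A' := hA' (Finset.mem_image_of_mem e hw)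
    calc p.Selected x t (name w) ↔ e w ∈ (p.sel (lg N) x)[t] := by
          simp [Params.Selected, List.getElem?_eq_getElem ht, he]
      _ ↔ e w ∈ (p.sel (lg N) x)[t] ∩ A' := by simp [hwA]
      _ ↔ w = v := by rw [hBA, Finset.mem_singleton, hinj.eq_iff]
  have h1 : U.card + good.card ≤ x := by
    rw [← Finset.card_image_of_injective U hinj, ← hc,
      ← Finset.card_sdiff_add_card_eq_card (Finset.filter_subset _ _ : good ⊆ A')]
    exact Nat.add_le_add_right (Finset.card_le_card hsub) _
  have h2 : lunFraction * x ≤ good.card := (Nat.le_ceil _).trans (by exact_mod_cast hS)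
  have h3 : (U.card : ℚ) + good.card ≤ x := by exact_mod_cast h1
  have h4 : (100 * U.card : ℚ) ≤ x := by
    rw [lunFraction] at h2
    linarith
  exact_mod_cast h4

end Selectors

variable [DecidableEq V]

variable {name : V → Fin N} {st : V → State N} {s : V} {A : Finset V}

section ESUN

variable {pend : Finset (Fin N)} {used : V → ℕ}

theorem Params.count_apply (t : ℕ) (cnt : ℕ → ℕ) (m : Option (Msg N)) (i : ℕ) :
    p.count t cnt m i = cnt i + if p.subStage t = i ∧ m.isSome then 1 else 0 := by
  by_cases hm : m.isSome
  · by_cases hi : p.subStage t = i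
    · subst hi; simp [count, hm]
    · simp [count, hm, hi, Function.update_of_ne (Ne.symm hi)]
  · simp [count, hm]

/-- The last round changes the phase instead of the counter `t`, so it is left to
`iterate_esun_all`. -/
theorem Ready.iterate_esun (h : Ready net name st s A) (T : ℕ) (hT : T < p.esunLength) :
    ∃ cnt : ℕ → ℕ, (∀ i, p.loneCount ω A T i ≤ cnt i ∧ cnt i ≤ p.busyCount ω A T i) ∧
      (p.step net ω)^[T] (esunArena p name st s A pend used 0 fun _ => 0) =
        esunArena p name st s A pend used T cnt := by
  induction T with
  | zero => exact ⟨fun _ => 0, fun i => by simp [Params.loneCount], rfl⟩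
  | succ T ih =>
    obtain ⟨cnt, hcnt, hrun⟩ := ih (by omega)
    obtain ⟨m, hm1, hm2, hstep⟩ :=
      h.step_esun (p := p) (ω := ω) (pend := pend) (used := used) (t := T) (cnt := cnt)
    refine ⟨p.count T cnt m, fun i => ?_, ?_⟩
    · rw [Params.count_apply]
      exact ⟨(p.loneCount_succ_le hm2 i).trans (Nat.add_le_add_right (hcnt i).1 _),
        (Nat.add_le_add_right (hcnt i).2 _).trans (p.le_busyCount_succ hm1 i)⟩
    · rw [Function.iterate_succ_apply', hrun, hstep, if_pos hT]

/-- The outcome of ESUN. -/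
theorem Ready.iterate_esun_all (h : Ready net name st s A) (hs : 0 < p.esunLength)
    (hu : ∀ v ∈ A, used v = 0) :
    ∃ cnt : ℕ → ℕ, (∀ i, p.loneCount ω A p.esunLength i ≤ cnt i ∧
        cnt i ≤ p.busyCount ω A p.esunLength i) ∧
      (p.step net ω)^[p.esunLength]
          (arena name st s A pend (.counting 0 fun _ => 0) A (.estimate 0) used) =
        arena name st s A pend (if p.estimateExponent cnt = 0 then .passing
          else .asking (p.estimateExponent cnt) 0) A .idle (p.usedAfter A used p.esunLength) := by
  obtain ⟨T, hT⟩ : ∃ T, p.esunLength = T + 1 := ⟨p.esunLength - 1, by omega⟩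
  obtain ⟨cnt, hcnt, hrun⟩ :=
    h.iterate_esun (p := p) (ω := ω) (pend := pend) (used := used) T (by omega)
  obtain ⟨m, hm1, hm2, hstep⟩ :=
    h.step_esun (p := p) (ω := ω) (pend := pend) (used := used) (t := T) (cnt := cnt)
  have h0 : p.usedAfter A used 0 = used := by
    funext v
    by_cases hv : v ∈ A
    · simp [Params.usedAfter, hv, hu v hv, Params.tape]
    · simp [Params.usedAfter, hv]
  refine ⟨p.count T cnt m, fun i => ?_, ?_⟩
  · rw [Params.count_apply, hT]
    exact ⟨(p.loneCount_succ_le hm2 i).trans (Nat.add_le_add_right (hcnt i).1 _),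
      (Nat.add_le_add_right (hcnt i).2 _).trans (p.le_busyCount_succ hm1 i)⟩
  · rw [esunArena, h0] at hrun
    rw [hT, Function.iterate_succ_apply', hrun, hstep, if_neg (by omega)]

end ESUN

end WirelessDFS

end SINR

/-! ### LUN, and the complete exploration of the unexplored neighbors. -/

namespace SINR

namespace WirelessDFS

variable {N : ℕ} {p : Params N} {V : Type} [Fintype V] {net : Network V} {ω : V → ℕ → Bool}
variable [DecidableEq V]

variable {name : V → Fin N} {st : V → State N} {s : V} {A R : Finset V} {pend : Finset (Fin N)}
  {used : V → ℕ} {k j : ℕ}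

theorem react_learn_of_not_called {σ : State N} (h : ∀ x, σ.status ≠ .called x) (c : Fin N)
    (x : Fin (2 ^ lg N + 1)) : react σ (.learn c x) = σ := by
  simp only [react]

theorem react_viewed_of_not_called {σ : State N} (h : ∀ x, σ.status ≠ .called x) (c v : Fin N) :
    react σ (.viewed c v) = σ := by
  simp only [react]

open Classical in
/-- In a round in which only the owner may transmit, the nodes are affected as described by
`react`. -/
theorem Ready.step_owner (h : Ready net name st s A) {ph : Phase N} {m : Msg N}
    (hm : p.emit ω (arena name st s A pend ph R .idle used) s = some m) {v : V} (hvs : v ≠ s) :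
    p.step net ω (arena name st s A pend ph R .idle used) v =
      (if net.commGraph.Adj s v then react (arena name st s A pend ph R .idle used v).1 m
        else (arena name st s A pend ph R .idle used v).1, used v) := by
  refine Params.step_of_lone hm (fun w hw => ?_) hvs
  by_cases hwR : w ∈ R
  · rw [arena_called hwR hw]
  · exact (h.arena_other hwR hw).1

/-- First round of an iteration of LUN. -/
theorem Ready.step_asking (h : Ready net name st s A) (hR : R ⊆ A) (hk : lunSize k j ≤ 2 ^ lg N) :
    p.step net ω (arena name st s A pend (.asking k j) R .idle used) =
      arena name st s A pend (.learning k j 0 []) R (.select (lunSize k j) 0) used := by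
  have hs : p.emit ω (arena name st s A pend (.asking k j) R .idle used) s =
      some (.learn (name s) (Fin.ofNat _ (lunSize k j))) := by
    rw [Params.emit, arena_self]
    simp [Params.send, h.me]
  funext v
  by_cases hvs : v = s
  · subst hvs
    rw [Params.step]
    simp only [arena_self]
    rfl
  rw [h.step_owner hs hvs]
  by_cases hv : v ∈ R
  · rw [if_pos ((h.mem_iff v).1 (hR hv)).1, arena_called hv hvs, arena_called hv hvs]
    -- The message carries the parameter modulo `2 ^ lg N + 1`; nothing is lost, since it is at most
    -- `2 ^ lg N`.
    have hval : ((Fin.ofNat (2 ^ lg N + 1) (lunSize k j) : Fin _) : ℕ) = lunSize k j := by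
      rw [Fin.val_ofNat, Nat.mod_eq_of_lt (by omega)]
    simp only [react, if_true, hval]
  · rw [react_learn_of_not_called (h.arena_other hv hvs).2.1, ite_self]
    exact arena_congr_other hv hvs

/-- A round in which the owner announces a label. -/
theorem Ready.step_announcing (h : Ready net name st s A) (hR : R ⊆ A) {w : V} (hw : w ∈ R)
    (q : List (Fin N)) :
    p.step net ω (arena name st s A pend (.announcing k j (name w :: q)) R .idle used) =
      arena name st s A (insert (name w) pend)
        (if q = [] then afterIteration k j else .announcing k j q) (R.erase w) .idle used := by
  have hs : p.emit ω (arena name st s A pend (.announcing k j (name w :: q)) R .idle used) s =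
      some (.viewed (name s) (name w)) := by
    rw [Params.emit, arena_self]
    simp [Params.send, h.me]
  funext v
  by_cases hvs : v = s
  · subst hvs
    rw [Params.step]
    simp only [arena_self]
    simp [Params.next, Params.coins]
  rw [h.step_owner hs hvs]
  by_cases hv : v ∈ R
  · rw [if_pos ((h.mem_iff v).1 (hR hv)).1, arena_called hv hvs]
    by_cases hvw : v = w
    · subst hvw
      simp only [react, arena, hvs, hR hv, if_true, if_false, true_and, Finset.notMem_erase]
      simp [fresh]
    · rw [arena_called (Finset.mem_erase.2 ⟨hvw, hv⟩) hvs]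
      have hne : name w ≠ name v := fun e => hvw (h.injective e).symm
      simp [react, fresh, hne]
  · rw [react_viewed_of_not_called (h.arena_other hv hvs).2.1, ite_self]
    have hv' : v ∉ R.erase w := fun e => hv (Finset.mem_of_mem_erase e)
    simp [arena, hv, hv', hvs]

/-- Stage 2 of an iteration of LUN. -/
theorem Ready.iterate_announcing (h : Ready net name st s A) (q : List (Fin N)) :
    ∀ (R : Finset V) (pend : Finset (Fin N)), R ⊆ A → q.Nodup → (∀ y ∈ q, ∃ v ∈ R, y = name v) →
    (p.step net ω)^[max 1 q.length]
        (arena name st s A pend (.announcing k j q) R .idle used) =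
      arena name st s A (pend ∪ q.toFinset) (afterIteration k j)
        (R.filter fun v => name v ∉ q) .idle used := by
  induction q with
  -- With nothing to announce, the owner still spends one silent round; hence `max 1`.
  | nil =>
    intro R pend hR _ _
    have hs : p.emit ω (arena name st s A pend (.announcing k j []) R .idle used) s = none := by
      rw [Params.emit, arena_self]
      simp [Params.send]
    have hnone : ∀ v ∈ R,
        p.emit ω (arena name st s A pend (.announcing k j []) R .idle used) v = none := by
      intro v hv
      have hvs : v ≠ s := fun e => h.notMem (e ▸ hR hv)
      exact p.emit_of_idle ω (by rw [arena_called hv hvs])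
    simp only [List.length_nil, Nat.max_zero, Function.iterate_one, List.toFinset_nil,
      Finset.union_empty, List.not_mem_nil, not_false_eq_true, Finset.filter_true]
    funext v
    by_cases hvs : v = s
    · subst hvs
      rw [Params.step]
      simp only [arena_self]
      rfl
    rw [Params.step_of_idle]
    · simp [arena, hvs]
    · by_cases hv : v ∈ R
      · rw [arena_called hv hvs]
      · exact (h.arena_other hv hvs).1
    · intro m hm
      obtain ⟨w, -, hwm⟩ := Params.exists_emit_of_heard hm
      by_cases hws : w = s
      · rw [hws, hs] at hwm; cases hwm
      by_cases hw : w ∈ R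
      · rw [hnone w hw] at hwm; cases hwm
      · rw [p.emit_of_idle ω (h.arena_other hw hws).1] at hwm; cases hwm
  | cons y q ih =>
    intro R pend hR hq hy
    obtain ⟨w, hw, rfl⟩ := hy y (List.mem_cons_self)
    have hstep := h.step_announcing (p := p) (ω := ω) (pend := pend) (used := used) (k := k) (j := j)
      hR hw q
    rw [List.nodup_cons] at hq
    by_cases hqn : q = []
    · subst hqn
      simp only [List.length_cons, List.length_nil, Nat.zero_add, max_self, Function.iterate_one]
      rw [hstep, if_pos rfl]
      congr 1
      · ext x; simp
      · ext v
        simp only [Finset.mem_erase, Finset.mem_filter, List.mem_singleton, h.injective.eq_iff]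
        tauto
    · have hlen : 1 ≤ q.length := List.length_pos_iff.2 hqn
      have hmax : max 1 (name w :: q).length = max 1 q.length + 1 := by
        rw [List.length_cons]; omega
      rw [hmax, Function.iterate_succ_apply, hstep, if_neg hqn,
        ih _ _ ((Finset.erase_subset _ _).trans hR) hq.2]
      · congr 1
        · ext x; simp
        · ext v
          simp only [Finset.mem_erase, Finset.mem_filter, List.mem_cons, h.injective.eq_iff]
          tauto
      · intro y hyq
        obtain ⟨v, hv, rfl⟩ := hy y (List.mem_cons_of_mem _ hyq)
        exact ⟨v, Finset.mem_erase.2 ⟨fun e => hq.1 (e ▸ hyq), hv⟩, rfl⟩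

/-- A round of stage 1 of an iteration of LUN. -/
theorem Ready.step_learning (h : Ready net name st s A) (hR : R ⊆ A) (t : ℕ)
    (hd : List (Fin N)) :
    ∃ m : Option (Msg N), (∀ m', m = some m' → ∃ v ∈ R, m' = .reply (name v)) ∧
      (∀ v ∈ R, (∀ w ∈ R, p.Selected (lunSize k j) t (name w) ↔ w = v) →
        m = some (.reply (name v))) ∧
      p.step net ω (arena name st s A pend (.learning k j t hd) R (.select (lunSize k j) t) used) =
        if t + 1 < (p.sel (lg N) (lunSize k j)).length then
          arena name st s A pend (.learning k j (t + 1) (hear hd m)) R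
            (.select (lunSize k j) (t + 1)) used
        else arena name st s A pend (.announcing k j (hear hd m)) R .idle used := by
  have hs : p.emit ω
      (arena name st s A pend (.learning k j t hd) R (.select (lunSize k j) t) used) s = none := by
    rw [Params.emit, arena_self]
    simp [Params.send]
  have hns : ∀ v ∈ R, v ≠ s := fun v hv e => h.notMem (e ▸ hR hv)
  have hr : ∀ v ∈ R, p.Selected (lunSize k j) t (name v) → p.emit ω
      (arena name st s A pend (.learning k j t hd) R (.select (lunSize k j) t) used) v =
        some (.reply (name v)) := by
    intro v hv ht
    rw [Params.emit, arena_called hv (hns v hv)]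
    simp only [Params.send]
    exact if_pos ht
  have hr' : ∀ v ∈ R, ¬ p.Selected (lunSize k j) t (name v) → p.emit ω
      (arena name st s A pend (.learning k j t hd) R (.select (lunSize k j) t) used) v = none := by
    intro v hv ht
    rw [Params.emit, arena_called hv (hns v hv)]
    simp only [Params.send]
    exact if_neg ht
  obtain ⟨h1, h2⟩ := h.heard_listening (talk := fun v => p.Selected (lunSize k j) t (name v))
    hR hs hr hr'
  refine ⟨p.heard net ω (arena name st s A pend (.learning k j t hd) R
    (.select (lunSize k j) t) used) s, fun m hm => ?_, h2, ?_⟩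
  · obtain ⟨v, hv, -, e⟩ := h1 m hm
    exact ⟨v, hv, e⟩
  · funext v
    by_cases hvs : v = s
    · subst hvs
      rw [Params.step]
      generalize p.heard net ω (arena name st v A pend (.learning k j t hd) R
        (.select (lunSize k j) t) used) v = m
      have hn : p.next { st v with pending := pend, phase := .learning k j t hd } m =
          { st v with
            pending := pend
            phase := if t + 1 < (p.sel (lg N) (lunSize k j)).length then
                .learning k j (t + 1) (hear hd m)
              else .announcing k j (hear hd m) } := rfl
      rw [arena_self, hn]
      split_ifs with hlt <;> simp only [arena_self] <;> rfl
    · by_cases hv : v ∈ R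
      · rw [Params.step]
        generalize p.heard net ω (arena name st s A pend (.learning k j t hd) R
          (.select (lunSize k j) t) used) v = m
        rw [arena_called hv hvs]
        split_ifs with hlt <;> simp [arena_called hv hvs, Params.next, Params.coins, hlt]
      · rw [h.step_listening hs _ hv hvs]
        · split_ifs <;> exact arena_congr_other hv hvs
        · intro w hw m hm
          by_cases ht : p.Selected (lunSize k j) t (name w)
          · rw [hr w hw ht] at hm
            cases hm; rfl
          · rw [hr' w hw ht] at hm
            cases hm

/-- The labels `hd` were received in the first `T` rounds of stage 1. -/
structure Learnt (p : Params N) (name : V → Fin N) (R : Finset V) (x T : ℕ)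
    (hd : List (Fin N)) : Prop where
  nodup : hd.Nodup
  mem : ∀ y ∈ hd, ∃ v ∈ R, y = name v
  isolated : ∀ v ∈ R, (∃ t < T, ∀ w ∈ R, p.Selected x t (name w) ↔ w = v) → name v ∈ hd

theorem mem_hear {hd : List (Fin N)} {y v : Fin N} :
    y ∈ hear hd (some (.reply v)) ↔ y ∈ hd ∨ y = v := by
  simp only [hear]
  split_ifs with hv
  · constructor
    · exact Or.inl
    · rintro (h | rfl)
      · exact h
      · exact hv
  · simp

theorem Learnt.hear {x T : ℕ} {hd : List (Fin N)} (h : Learnt p name R x T hd)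
    {m : Option (Msg N)} (hm1 : ∀ m', m = some m' → ∃ v ∈ R, m' = .reply (name v))
    (hm2 : ∀ v ∈ R, (∀ w ∈ R, p.Selected x T (name w) ↔ w = v) → m = some (.reply (name v))) :
    Learnt p name R x (T + 1) (hear hd m) := by
  cases m with
  | none =>
    refine ⟨h.nodup, h.mem, fun v hv ⟨t, ht, hlone⟩ => ?_⟩
    rcases Nat.lt_succ_iff_lt_or_eq.1 ht with ht | rfl
    · exact h.isolated v hv ⟨t, ht, hlone⟩
    · cases hm2 v hv hlone
  | some m' =>
    obtain ⟨u, hu, rfl⟩ := hm1 m' rfl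
    refine ⟨?_, fun y hy => ?_, fun v hv ⟨t, ht, hlone⟩ => ?_⟩
    · simp only [WirelessDFS.hear]
      split_ifs with hmem
      · exact h.nodup
      · rw [← List.concat_eq_append]
        exact h.nodup.concat hmem
    · rcases mem_hear.1 hy with hy | rfl
      · exact h.mem y hy
      · exact ⟨u, hu, rfl⟩
    · rw [mem_hear]
      rcases Nat.lt_succ_iff_lt_or_eq.1 ht with ht | rfl
      · exact Or.inl (h.isolated v hv ⟨t, ht, hlone⟩)
      · have := hm2 v hv hlone
        simp only [Option.some.injEq, Msg.reply.injEq] at this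
        exact Or.inr this.symm

/-- The final round is again treated apart, because it changes the phase. The `max 1` is there
because stage 1 takes one round even when the selector is an empty list. -/
theorem Ready.iterate_learning (h : Ready net name st s A) (hR : R ⊆ A) (T : ℕ)
    (hT : T < max 1 (p.sel (lg N) (lunSize k j)).length) :
    ∃ hd, Learnt p name R (lunSize k j) T hd ∧
      (p.step net ω)^[T] (arena name st s A pend (.learning k j 0 []) R
          (.select (lunSize k j) 0) used) =
        arena name st s A pend (.learning k j T hd) R (.select (lunSize k j) T) used := by
  induction T with
  | zero => exact ⟨[], ⟨List.nodup_nil, by simp, by simp⟩, rfl⟩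
  | succ T ih =>
    obtain ⟨hd, hl, hrun⟩ := ih (by omega)
    obtain ⟨m, hm1, hm2, hstep⟩ := h.step_learning (p := p) (ω := ω) (pend := pend) (used := used)
      (k := k) (j := j) hR T hd
    refine ⟨hear hd m, hl.hear hm1 hm2, ?_⟩
    rw [Function.iterate_succ_apply', hrun, hstep, if_pos (by omega)]

/-- Stage 1 of an iteration of LUN. -/
theorem Ready.iterate_learning_all (h : Ready net name st s A) (hR : R ⊆ A) :
    ∃ hd, Learnt p name R (lunSize k j) (p.sel (lg N) (lunSize k j)).length hd ∧
      (p.step net ω)^[max 1 (p.sel (lg N) (lunSize k j)).length]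
          (arena name st s A pend (.learning k j 0 []) R (.select (lunSize k j) 0) used) =
        arena name st s A pend (.announcing k j hd) R .idle used := by
  set ℓ := (p.sel (lg N) (lunSize k j)).length with hℓ
  obtain ⟨T, hT⟩ : ∃ T, max 1 ℓ = T + 1 := ⟨max 1 ℓ - 1, by omega⟩
  obtain ⟨hd, hl, hrun⟩ := h.iterate_learning (p := p) (ω := ω) (pend := pend) (used := used)
    (k := k) (j := j) hR T (by omega)
  obtain ⟨m, hm1, hm2, hstep⟩ := h.step_learning (p := p) (ω := ω) (pend := pend) (used := used)
    (k := k) (j := j) hR T hd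
  have hl' := hl.hear hm1 hm2
  refine ⟨hear hd m, ⟨hl'.nodup, hl'.mem, fun v hv ⟨t, ht, hlone⟩ =>
    hl'.isolated v hv ⟨t, by omega, hlone⟩⟩, ?_⟩
  rw [hT, Function.iterate_succ_apply', hrun, hstep, if_neg (by omega)]

/-- An iteration of LUN. -/
theorem Ready.iterate_lun (h : Ready net name st s A) (hR : R ⊆ A) {K : ℝ} {κ : ℕ}
    (hsel : IsSelectorFamily K p.sel) (hκ : K ≤ κ) (hL : 1 ≤ lg N) (hk : k ≤ lg N)
    (hRc : R.card ≤ lunSize k j) :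
    ∃ t, ∃ R' ⊆ R, 100 * R'.card ≤ lunSize k j ∧
      t + R'.card ≤ 3 + κ * lunSize k j * lg N + R.card ∧
      (p.step net ω)^[t] (arena name st s A pend (.asking k j) R .idle used) =
        arena name st s A (pend ∪ (R \ R').image name) (afterIteration k j) R' .idle used := by
  have hx : lunSize k j ≤ 2 ^ lg N := (lunSize_le k j).trans (Nat.pow_le_pow_right two_pos hk)
  have hx1 := one_le_lunSize k j
  obtain ⟨hd, hl, hrun⟩ := h.iterate_learning_all (p := p) (ω := ω) (pend := pend) (used := used)
    (k := k) (j := j) hR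
  have hann := h.iterate_announcing (p := p) (ω := ω) (k := k) (j := j) (used := used) hd R pend hR
    hl.nodup hl.mem
  have hlen : (p.sel (lg N) (lunSize k j)).length ≤ κ * lunSize k j * lg N := by
    have h1 := (hsel (lg N) (lunSize k j) hL hx1 hx).2
    have h2 : ((p.sel (lg N) (lunSize k j)).length : ℝ) ≤ (κ * lunSize k j * lg N : ℕ) := by
      push_cast
      exact h1.trans (by gcongr)
    exact_mod_cast h2
  have himg : (R \ R.filter fun v => name v ∉ hd).image name = hd.toFinset := by
    ext y
    simp only [Finset.mem_image, Finset.mem_sdiff, Finset.mem_filter, List.mem_toFinset]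
    constructor
    · rintro ⟨v, ⟨hv, hn⟩, rfl⟩
      by_contra hcon
      exact hn ⟨hv, hcon⟩
    · intro hy
      obtain ⟨v, hv, rfl⟩ := hl.mem y hy
      exact ⟨v, ⟨hv, fun hn => hn.2 hy⟩, rfl⟩
  have hcard : hd.length + (R.filter fun v => name v ∉ hd).card = R.card := by
    rw [← List.toFinset_card_of_nodup hl.nodup, ← himg,
      Finset.card_image_of_injective _ h.injective,
      Finset.card_sdiff_add_card_eq_card (Finset.filter_subset _ _)]
  -- One round to ask and at most one extra for each `max 1` give the constant `3`. The
  -- announcements number `R.card - R'.card`; bounding `t + R'.card` lets them telescope over the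
  -- iterations.
  refine ⟨max 1 hd.length + (max 1 (p.sel (lg N) (lunSize k j)).length + 1),
    R.filter fun v => name v ∉ hd, Finset.filter_subset _ _, ?_, ?_, ?_⟩
  · refine card_not_isolated_le (name := name) hsel hL h.injective hx1 hx hRc
      (Finset.filter_subset _ _) fun v hv hiso => ?_
    rw [Finset.mem_filter] at hv
    exact hv.2 (hl.isolated v hv.1 hiso)
  · omega
  · rw [Function.iterate_add_apply, Function.iterate_add_apply, Function.iterate_one,
      h.step_asking hR hx, hrun, hann, himg]

/-- LUN from iteration `j` on. -/
theorem Ready.iterate_lun_from (h : Ready net name st s A) {K : ℝ} {κ : ℕ}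
    (hsel : IsSelectorFamily K p.sel) (hκ : K ≤ κ) (hL : 1 ≤ lg N) (hk : k ≤ lg N) (i : ℕ) :
    ∀ (j : ℕ) (R : Finset V) (pend : Finset (Fin N)), j + i = lunLast k → R ⊆ A →
      R.card ≤ lunSize k j →
    ∃ t ≤ (∑ i ∈ Finset.Ico j (lunLast k + 1), (3 + κ * lunSize k i * lg N)) + R.card,
      (p.step net ω)^[t] (arena name st s A pend (.asking k j) R .idle used) =
        arena name st s A (pend ∪ R.image name) .passing ∅ .idle used := by
  induction i with
  | zero =>
    intro j R pend hj hR hRc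
    obtain ⟨t, R', hR', hc, ht, hrun⟩ := h.iterate_lun (p := p) (ω := ω) (pend := pend)
      (used := used) hR hsel hκ hL hk hRc
    have hj' : j = lunLast k := by omega
    have hlast := lunSize_lunLast_le k
    rw [hj'] at hc
    -- The last parameter is at most `1`, and a hundred times the number of remaining nodes does not
    -- exceed it.
    have hR0 : R' = ∅ := Finset.card_eq_zero.1 (by omega)
    subst hR0
    refine ⟨t, ?_, ?_⟩
    · rw [← hj', Nat.Ico_succ_singleton, Finset.sum_singleton]
      simpa using ht
    · rw [hrun, Finset.sdiff_empty, afterIteration, if_neg (by omega)]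
  | succ i ih =>
    intro j R pend hj hR hRc
    obtain ⟨t, R', hR', hc, ht, hrun⟩ := h.iterate_lun (p := p) (ω := ω) (pend := pend)
      (used := used) hR hsel hκ hL hk hRc
    obtain ⟨t', ht', hrun'⟩ := ih (j + 1) R' (pend ∪ (R \ R').image name) (by omega)
      (hR'.trans hR) (le_lunSize_succ hc)
    refine ⟨t' + t, ?_, ?_⟩
    · rw [Finset.sum_eq_sum_Ico_succ_bot (by omega)]
      omega
    · rw [Function.iterate_add_apply, hrun, afterIteration, if_pos (by omega), hrun',
        Finset.union_assoc, ← Finset.image_union, Finset.sdiff_union_of_subset hR']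

/-- The number of rounds of ESUN, together with the calling round. -/
def Params.esunCost (p : Params N) : ℕ := 1 + p.esunLength

/-- A bound for the number of rounds of LUN per explored node. -/
def lunCost (N κ : ℕ) : ℕ := 193 + 192 * (κ * lg N)

theorem sum_lun_le (κ : ℕ) :
    ∑ i ∈ Finset.range (lunLast k + 1), (3 + κ * lunSize k i * lg N) ≤
      2 ^ k * (3 + 3 * (κ * lg N)) := by
  have h1 := sum_lunSize_le k
  have h2 := lunLast_lt k
  calc ∑ i ∈ Finset.range (lunLast k + 1), (3 + κ * lunSize k i * lg N)
      = 3 * (lunLast k + 1) + (κ * lg N) * ∑ i ∈ Finset.range (lunLast k + 1), lunSize k i := by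
        rw [Finset.sum_add_distrib, Finset.mul_sum]
        congr 1
        · simp [mul_comm]
        · exact Finset.sum_congr rfl fun i _ => by ring
    _ ≤ 3 * 2 ^ k + (κ * lg N) * (3 * 2 ^ k) := by gcongr
    _ = _ := by ring

/-- Exploring the unexplored neighbors. -/
theorem Ready.iterate_explore (h : Ready net name st s A) (hph : (st s).phase = .calling)
    {K : ℝ} {κ : ℕ} (hsel : IsSelectorFamily K p.sel) (hκ : K ≤ κ) (hL : 1 ≤ lg N)
    (hs : 0 < p.esunLength) (hu : ∀ v ∈ A, used v = 0) (hgood : p.Good ω A) :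
    ∃ t ≤ p.esunCost + lunCost N κ * A.card, ∃ used' : V → ℕ, (∀ v ∉ A, used' v = used v) ∧
      (p.step net ω)^[t] (fun v => (st v, used v)) =
        arena name st s A ((st s).pending ∪ A.image name) .passing ∅ .idle used' := by
  obtain ⟨cnt, hcnt, hrun⟩ := h.iterate_esun_all (p := p) (ω := ω) (pend := (st s).pending) hs hu
  have hcall := h.step_calling (p := p) (ω := ω) hph used
  obtain ⟨he1, he2⟩ := hgood.estimateExponent hcnt
  have hu' : ∀ v ∉ A, p.usedAfter A used p.esunLength v = used v := fun v hv => if_neg hv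
  rcases A.eq_empty_or_nonempty with hA | hA
  · refine ⟨p.esunLength + 1, by rw [Params.esunCost]; omega, _, hu', ?_⟩
    rw [Function.iterate_add_apply, Function.iterate_one, hcall, hrun, if_pos (he1 hA)]
    subst hA
    simp
  · obtain ⟨h0, hkL, hle, hge⟩ := he2 hA
    set k := p.estimateExponent cnt with hk
    have hsize : lunSize k 0 = 2 ^ k := by
      rw [lunSize, pow_zero, one_mul]
      exact_mod_cast Nat.ceil_natCast (R := ℚ) (2 ^ k)
    obtain ⟨t, ht, hlun⟩ := h.iterate_lun_from (p := p) (ω := ω)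
      (used := p.usedAfter A used p.esunLength) hsel hκ hL hkL (lunLast k) 0 A (st s).pending
      (by omega) subset_rfl (by rw [hsize]; exact hle)
    refine ⟨t + (p.esunLength + 1), ?_, _, hu', ?_⟩
    · have h1 := sum_lun_le (N := N) (k := k) κ
      rw [← Finset.range_eq_Ico] at ht
      -- The estimate `2 ^ k ≤ 64 |A|` turns the cost into one per explored node. With one
      -- announcement each, `64 * 3 + 1 = 193` and `64 * 3 = 192` are the constants of `lunCost`.
      have h2 : 2 ^ k * (3 + 3 * (κ * lg N)) ≤ 64 * A.card * (3 + 3 * (κ * lg N)) := by gcongr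
      have h3 : 64 * A.card * (3 + 3 * (κ * lg N)) + A.card = lunCost N κ * A.card := by
        rw [lunCost]; ring
      rw [Params.esunCost]
      omega
    · rw [Function.iterate_add_apply, Function.iterate_add_apply, Function.iterate_one, hcall, hrun,
        if_neg h0, hlun]

end WirelessDFS

end SINR

/-! ### Invariants of the depth-first traversal, and its potential. -/

namespace SINR

namespace WirelessDFS

variable {N : ℕ} {p : Params N} {V : Type} [Fintype V] {net : Network V} {ω : V → ℕ → Bool}
variable [DecidableEq V]

variable {name : V → Fin N} {source : V} {st : V → State N} {stk : List V}

/-- Every node of the list got the token from the next one, and the last one from nobody. -/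
def ParentChain (net : Network V) (name : V → Fin N) (st : V → State N) : List V → Prop
  | [] => True
  | [a] => (st a).parent = none
  | a :: b :: l =>
      (st a).parent = some (name b) ∧ net.commGraph.Adj a b ∧ ParentChain net name st (b :: l)

theorem ParentChain.congr {st' : V → State N} :
    ∀ {l : List V}, ParentChain net name st l → (∀ v ∈ l, (st' v).parent = (st v).parent) →
      ParentChain net name st' l
  | [], _, _ => trivial
  | [a], h, hp => (hp a (by simp)).trans h
  | a :: b :: l, h, hp => ⟨(hp a (by simp)).trans h.1, h.2.1,
      ParentChain.congr h.2.2 fun v hv => hp v (List.mem_cons_of_mem _ hv)⟩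

theorem ParentChain.tail {a : V} : ∀ {l : List V}, ParentChain net name st (a :: l) →
    ParentChain net name st l
  | [], _ => trivial
  | _ :: _, h => h.2.2

/-- The traversal is between two actions of the token owner; the list `stk` is the path of grey
nodes from the token owner to the source. -/
structure Traversal (net : Network V) (name : V → Fin N) (source : V) (st : V → State N)
    (stk : List V) : Prop where
  injective : Function.Injective name
  me : ∀ v, (st v).me = name v
  status : ∀ v, st v = fresh (name v) ∨ (st v).status = .viewed
  idle : ∀ v, stk.head? ≠ some v → (st v).phase = .idle
  owner : ∀ v, stk.head? = some v →
    ((st v).phase = .calling ∧ (st v).pending = ∅) ∨ (st v).phase = .passing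
  nodup : stk.Nodup
  grey : ∀ v, v ∈ stk ↔ (st v).color = .grey
  chain : ParentChain net name st stk
  pend : ∀ v x, x ∈ (st v).pending → ∃ w, name w = x ∧ net.commGraph.Adj v w ∧
    (st w).color = .white ∧ (st w).status = .viewed
  pend_unique : ∀ v v' x, x ∈ (st v).pending → x ∈ (st v').pending → v = v'
  pend_grey : ∀ w, (st w).color = .white → (st w).status = .viewed →
    ∃ v ∈ stk, name w ∈ (st v).pending
  white : ∀ w, (st w).color = .white → (st w).pending = ∅
  explored : ∀ v, (st v).color ≠ .white → (st v).phase ≠ .calling →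
    ∀ w, net.commGraph.Adj v w → (st w).status = .viewed
  source_color : (st source).color ≠ .white

theorem Traversal.viewed_of_color (h : Traversal net name source st stk) {v : V}
    (hv : (st v).color ≠ .white) : (st v).status = .viewed := by
  rcases h.status v with e | e
  · rw [e] at hv
    exact absurd rfl hv
  · exact e

theorem Traversal.eq_fresh (h : Traversal net name source st stk) {v : V}
    (hv : (st v).status = .unexplored) : st v = fresh (name v) := by
  rcases h.status v with e | e
  · exact e
  · rw [e] at hv
    cases hv

/-- When no token owner is left, everything has been explored. -/
theorem Traversal.black (h : Traversal net name source st []) (hconn : net.commGraph.Connected)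
    (v : V) : (st v).color = .black := by
  have hgrey : ∀ v, (st v).color ≠ .grey := fun v hv => by simpa using (h.grey v).2 hv
  -- A white viewed node would be pending at some node of the stack, which is empty.
  have hvb : ∀ v, (st v).status = .viewed → (st v).color = .black := by
    intro v hv
    cases hc : (st v).color with
    | black => rfl
    | grey => exact absurd hc (hgrey v)
    | white =>
      obtain ⟨w, hw, -⟩ := h.pend_grey v hc hv
      cases hw
  have hidle : ∀ v, (st v).phase ≠ .calling := fun v => by
    rw [h.idle v (by simp)]
    simp
  -- Viewed nodes are black, hence have explored their neighborhoods; so being viewed spreads along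
  -- walks, here from the source.
  have hreach : ∀ {u w : V}, net.commGraph.Walk u w →
      (st u).status = .viewed → (st w).status = .viewed := by
    intro u w W
    induction W with
    | nil => exact id
    | cons hadj _ ih =>
      intro hu
      refine ih (h.explored _ ?_ (hidle _) _ hadj)
      rw [hvb _ hu]
      simp
  exact hvb v (hreach (hconn.preconnected source v).some (h.viewed_of_color h.source_color))

/-- The contribution of a node to the remaining running time, if ESUN costs `B` and LUN costs `b`
for each explored node. -/
def State.weight (B b : ℕ) (σ : State N) : ℕ :=
  match σ.status with
  | .unexplored => B + 2 + b
  | _ =>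
    match σ.color with
    | .white => B + 2
    | .grey =>
      match σ.phase with
      | .calling => B + 1
      | _ => 1
    | .black => 0

/-- With the true costs `B` and `b` it bounds the remaining rounds; with `B = 1` and `b = 0` it
bounds the remaining actions of token owners. In the weight `B + 2` of a viewed white node, the two
extra units pay for passing the token to it and for its return. -/
def potential (B b : ℕ) (st : V → State N) : ℕ := ∑ v, (st v).weight B b

theorem potential_eq_add {B b : ℕ} {st st' : V → State N} (g : V → ℕ)
    (h : ∀ v, (st v).weight B b = (st' v).weight B b + g v) :
    potential B b st = potential B b st' + ∑ v, g v := by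
  rw [potential, potential, ← Finset.sum_add_distrib]
  exact Finset.sum_congr rfl fun v _ => h v

/-- The unexplored neighbors of `s`. -/
def unexploredNbrs (net : Network V) (st : V → State N) (s : V) : Finset V :=
  open Classical in
  Finset.univ.filter fun v => net.commGraph.Adj s v ∧ (st v).status = .unexplored

theorem mem_unexploredNbrs {s v : V} : v ∈ unexploredNbrs net st s ↔
    net.commGraph.Adj s v ∧ (st v).status = .unexplored := by
  simp [unexploredNbrs]

variable {s : V} {l : List V}

theorem Traversal.color_head (h : Traversal net name source st (s :: l)) :
    (st s).color = .grey := (h.grey s).1 (by simp)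

theorem Traversal.idle_of_ne (h : Traversal net name source st (s :: l)) {v : V} (hv : v ≠ s) :
    (st v).phase = .idle := h.idle v fun e => hv (by simpa using e.symm)

section Explore

/-- The states after `s` has explored its unexplored neighbors. -/
def exploreState (net : Network V) (name : V → Fin N) (st : V → State N) (s v : V) : State N :=
  if v = s then { st s with
    pending := (st s).pending ∪ (unexploredNbrs net st s).image name, phase := .passing }
  else if v ∈ unexploredNbrs net st s then { fresh (name v) with status := .viewed }
  else st v

theorem Traversal.ready (h : Traversal net name source st (s :: l)) :
    Ready net name st s (unexploredNbrs net st s) where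
  injective := h.injective
  me := h.me s
  idle := fun v hv => h.idle_of_ne hv
  not_called := fun v x => by
    rcases h.status v with e | e <;> rw [e]
    · simp [fresh]
    · simp
  mem_iff := fun v => mem_unexploredNbrs
  eq_fresh := fun v hv => h.eq_fresh (mem_unexploredNbrs.1 hv).2

theorem Traversal.color_unexplored (h : Traversal net name source st stk) {v : V}
    (hv : (st v).status = .unexplored) : (st v).color = .white := by
  rw [h.eq_fresh hv]
  rfl

/-- The nodes that become pending at `s` were unexplored, whereas whatever is pending elsewhere is
already viewed; so no node is pending twice. Afterwards all neighbors of `s` are viewed. -/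
theorem Traversal.explore (h : Traversal net name source st (s :: l))
    (hph : (st s).phase = .calling) :
    Traversal net name source (exploreState net name st s) (s :: l) := by
  have hr := h.ready
  set A := unexploredNbrs net st s with hA
  have hsA : s ∉ A := hr.notMem
  have hpend : (st s).pending = ∅ := by
    rcases h.owner s rfl with e | e
    · exact e.2
    · rw [hph] at e; cases e
  have es : exploreState net name st s s =
      { st s with pending := A.image name, phase := .passing } := by
    simp [exploreState, hpend, hA]
  have eA : ∀ v ∈ A, exploreState net name st s v = { fresh (name v) with status := .viewed } := by
    intro v hv
    have hvs : v ≠ s := fun e => hsA (e ▸ hv)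
    simp only [exploreState, hvs, if_false]
    exact if_pos hv
  have eo : ∀ v, v ≠ s → v ∉ A → exploreState net name st s v = st v := by
    intro v hvs hv
    simp only [exploreState, hvs, if_false]
    exact if_neg hv
  have hcolor : ∀ v, (exploreState net name st s v).color = (st v).color := by
    intro v
    by_cases hvs : v = s
    · rw [hvs, es]
    by_cases hv : v ∈ A
    · rw [eA v hv, hr.eq_fresh v hv]
    · rw [eo v hvs hv]
  have hparent : ∀ v, (exploreState net name st s v).parent = (st v).parent := by
    intro v
    by_cases hvs : v = s
    · rw [hvs, es]
    by_cases hv : v ∈ A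
    · rw [eA v hv, hr.eq_fresh v hv]
    · rw [eo v hvs hv]
  have hview : ∀ v, (st v).status = .viewed → (exploreState net name st s v).status = .viewed := by
    intro v hst
    by_cases hvs : v = s
    · rw [hvs, es, ← hvs]
      exact hst
    by_cases hv : v ∈ A
    · rw [eA v hv]
    · rw [eo v hvs hv]
      exact hst
  have hpe : ∀ v, v ≠ s → (exploreState net name st s v).pending = (st v).pending := by
    intro v hvs
    by_cases hv : v ∈ A
    · rw [eA v hv, hr.eq_fresh v hv]
    · rw [eo v hvs hv]
  have hps : (exploreState net name st s s).pending = A.image name := by rw [es]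
  have hphase : ∀ v, v ≠ s → (exploreState net name st s v).phase = .idle := by
    intro v hvs
    by_cases hv : v ∈ A
    · rw [eA v hv]; rfl
    · rw [eo v hvs hv]
      exact h.idle_of_ne hvs
  have hnotA : ∀ w ∈ A, (st w).status ≠ .viewed := fun w hw e => by
    rw [(mem_unexploredNbrs.1 hw).2] at e
    cases e
  have hmix : ∀ v x, v ≠ s → x ∈ (st v).pending → x ∉ A.image name := by
    intro v x _ hx hx'
    obtain ⟨w, rfl, -, -, hw⟩ := h.pend v x hx
    obtain ⟨w', hw', e⟩ := Finset.mem_image.1 hx'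
    rw [h.injective e] at hw'
    exact hnotA w hw' hw
  refine ⟨h.injective, fun v => ?_, fun v => ?_, fun v hv => ?_, fun v hv => ?_, h.nodup,
    fun v => ?_, h.chain.congr fun v _ => hparent v, fun v x hx => ?_, fun v v' x hx hx' => ?_,
    fun w hw hw' => ?_, fun w hw => ?_, fun v hv hp w hadj => ?_, ?_⟩
  · by_cases hvs : v = s
    · rw [hvs, es]
      exact h.me s
    by_cases hv : v ∈ A
    · rw [eA v hv]
      rfl
    · rw [eo v hvs hv, h.me]
  · by_cases hvs : v = s
    · right
      rw [hvs]
      refine hview s (h.viewed_of_color ?_)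
      rw [h.color_head]
      simp
    by_cases hv : v ∈ A
    · right
      rw [eA v hv]
    · rw [eo v hvs hv]
      exact h.status v
  · exact hphase v fun e => hv (by simp [e])
  · right
    simp only [List.head?_cons, Option.some.injEq] at hv
    rw [← hv, es]
  · rw [hcolor]
    exact h.grey v
  · by_cases hvs : v = s
    · subst hvs
      rw [hps] at hx
      obtain ⟨w, hw, rfl⟩ := Finset.mem_image.1 hx
      refine ⟨w, rfl, (mem_unexploredNbrs.1 hw).1, ?_, ?_⟩
      · rw [hcolor, h.color_unexplored (mem_unexploredNbrs.1 hw).2]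
      · rw [eA w hw]
    · rw [hpe v hvs] at hx
      obtain ⟨w, h1, h2, h3, h4⟩ := h.pend v x hx
      exact ⟨w, h1, h2, by rw [hcolor, h3], hview w h4⟩
  · by_cases hvs : v = s <;> by_cases hvs' : v' = s
    · rw [hvs, hvs']
    · subst hvs
      rw [hps] at hx
      rw [hpe v' hvs'] at hx'
      exact absurd hx (hmix v' x hvs' hx')
    · subst hvs'
      rw [hps] at hx'
      rw [hpe v hvs] at hx
      exact absurd hx' (hmix v x hvs hx)
    · rw [hpe v hvs] at hx
      rw [hpe v' hvs'] at hx'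
      exact h.pend_unique v v' x hx hx'
  · by_cases hwA : w ∈ A
    · exact ⟨s, by simp, by rw [hps]; exact Finset.mem_image_of_mem _ hwA⟩
    · rw [hcolor] at hw
      have hws : w ≠ s := fun e => by rw [e, h.color_head] at hw; cases hw
      rw [eo w hws hwA] at hw'
      obtain ⟨v, hv, hvp⟩ := h.pend_grey w hw hw'
      have hvs : v ≠ s := fun e => by rw [e, hpend] at hvp; simp at hvp
      exact ⟨v, hv, by rwa [hpe v hvs]⟩
  · rw [hcolor] at hw
    have hws : w ≠ s := fun e => by rw [e, h.color_head] at hw; cases hw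
    rw [hpe w hws]
    exact h.white w hw
  · rw [hcolor] at hv
    by_cases hvs : v = s
    · subst hvs
      by_cases hwA : w ∈ A
      · rw [eA w hwA]
      · refine hview w ?_
        rcases h.status w with e | e
        · exact absurd (mem_unexploredNbrs.2 ⟨hadj, by rw [e]; rfl⟩) hwA
        · exact e
    · refine hview w (h.explored v hv ?_ w hadj)
      rw [h.idle_of_ne hvs]
      simp
  · rw [hcolor]
    exact h.source_color

theorem Traversal.potential_explore (h : Traversal net name source st (s :: l))
    (hph : (st s).phase = .calling) (B b : ℕ) :
    potential B b st = potential B b (exploreState net name st s) +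
      (B + b * (unexploredNbrs net st s).card) := by
  have hr := h.ready
  have hsum : ∑ v, ((if v = s then B else 0) + if v ∈ unexploredNbrs net st s then b else 0) =
      B + b * (unexploredNbrs net st s).card := by
    simp [Finset.sum_add_distrib, mul_comm]
  rw [← hsum]
  refine potential_eq_add _ fun v => ?_
  by_cases hvs : v = s
  · subst hvs
    have hv : (st v).status = .viewed := h.viewed_of_color (by rw [h.color_head]; simp)
    simp only [exploreState, if_true, hr.notMem, if_false, State.weight, hv, h.color_head, hph]
    omega
  · by_cases hv : v ∈ unexploredNbrs net st s
    · simp only [exploreState, hvs, if_false, hv, if_true]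
      rw [hr.eq_fresh v hv]
      simp [State.weight, fresh]
    · simp [exploreState, hvs, hv]

end Explore

section Pass

/-- The states after `s` has passed the token to `w`. -/
def passState (name : V → Fin N) (st : V → State N) (s w v : V) : State N :=
  if v = s then { st s with pending := (st s).pending.erase (name w), phase := .idle }
  else if v = w then { st w with color := .grey, parent := some (name s), phase := .calling }
  else st v

theorem Traversal.pass (h : Traversal net name source st (s :: l)) (hph : (st s).phase = .passing)
    {w : V} (hw : name w ∈ (st s).pending) :
    Traversal net name source (passState name st s w) (w :: s :: l) := by
  obtain ⟨w', hw', hadj, hwc, hwv⟩ := h.pend s _ hw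
  obtain rfl := h.injective hw'
  have hws : w' ≠ s := hadj.1.symm
  have es : passState name st s w' s =
      { st s with pending := (st s).pending.erase (name w'), phase := .idle } := if_pos rfl
  have ew : passState name st s w' w' =
      { st w' with color := .grey, parent := some (name s), phase := .calling } := by
    simp [passState, hws]
  have eo : ∀ v, v ≠ s → v ≠ w' → passState name st s w' v = st v := by
    intro v h1 h2
    simp [passState, h1, h2]
  have hstatus : ∀ v, (passState name st s w' v).status = (st v).status := by
    intro v
    by_cases h1 : v = s
    · rw [h1, es]
    by_cases h2 : v = w'
    · rw [h2, ew]
    · rw [eo v h1 h2]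
  have hcolor : ∀ v, v ≠ w' → (passState name st s w' v).color = (st v).color := by
    intro v h2
    by_cases h1 : v = s
    · rw [h1, es]
    · rw [eo v h1 h2]
  have hpsub : ∀ v x, x ∈ (passState name st s w' v).pending → x ∈ (st v).pending := by
    intro v x
    by_cases h1 : v = s
    · rw [h1, es]
      exact fun hx => Finset.mem_of_mem_erase hx
    by_cases h2 : v = w'
    · rw [h2, ew]
      exact id
    · rw [eo v h1 h2]
      exact id
  have hwl : w' ∉ s :: l := fun e => by
    rw [(h.grey w').1 e] at hwc
    cases hwc
  have hpe : ∀ v x, x ∈ (st v).pending → x ≠ name w' → x ∈ (passState name st s w' v).pending := by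
    intro v x hx hne
    by_cases h1 : v = s
    · rw [h1, es]
      exact Finset.mem_erase.2 ⟨hne, h1 ▸ hx⟩
    by_cases h2 : v = w'
    · rw [h2, ew]
      exact h2 ▸ hx
    · rwa [eo v h1 h2]
  -- The new owner was pending at `s` only, so after its removal there it is pending nowhere, and
  -- pending nodes remain white.
  have hnw : ∀ v, name w' ∉ (passState name st s w' v).pending := by
    intro v hv
    have := h.pend_unique v s _ (hpsub v _ hv) hw
    rw [this, es] at hv
    simp at hv
  refine ⟨h.injective, fun v => ?_, fun v => ?_, fun v hv => ?_, fun v hv => ?_,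
    List.nodup_cons.2 ⟨hwl, h.nodup⟩, fun v => ?_, ⟨?_, hadj.symm, h.chain.congr fun v hv => ?_⟩,
    fun v x hx => ?_, fun v v' x hx hx' => h.pend_unique v v' x (hpsub v x hx) (hpsub v' x hx'),
    fun u hu hu' => ?_, fun u hu => ?_, fun v hv hp u hvu => ?_, ?_⟩
  · by_cases h1 : v = s
    · rw [h1, es]
      exact h.me s
    by_cases h2 : v = w'
    · rw [h2, ew]
      exact h.me w'
    · rw [eo v h1 h2, h.me]
  · by_cases h1 : v = s
    · right
      rw [hstatus, h1]
      exact h.viewed_of_color (by rw [h.color_head]; simp)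
    by_cases h2 : v = w'
    · right
      rw [hstatus, h2, hwv]
    · rw [eo v h1 h2]
      exact h.status v
  · have h2 : v ≠ w' := fun e => hv (by simp [e])
    by_cases h1 : v = s
    · rw [h1, es]
    · rw [eo v h1 h2]
      exact h.idle_of_ne h1
  · simp only [List.head?_cons, Option.some.injEq] at hv
    left
    rw [← hv, ew]
    exact ⟨rfl, h.white w' hwc⟩
  · by_cases h2 : v = w'
    · rw [h2, ew]
      simp
    · rw [hcolor v h2, ← h.grey v, List.mem_cons]
      simp [h2]
  · rw [ew]
  · have h2 : v ≠ w' := fun e => hwl (e ▸ hv)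
    by_cases h1 : v = s
    · rw [h1, es]
    · rw [eo v h1 h2]
  · obtain ⟨u, rfl, h1, h2, h3⟩ := h.pend v x (hpsub v x hx)
    have huw : u ≠ w' := fun e => hnw v (e ▸ hx)
    exact ⟨u, rfl, h1, by rw [hcolor u huw, h2], by rw [hstatus, h3]⟩
  · have huw : u ≠ w' := fun e => by
      rw [e, ew] at hu
      cases hu
    rw [hcolor u huw] at hu
    rw [hstatus] at hu'
    obtain ⟨v, hv, hvp⟩ := h.pend_grey u hu hu'
    exact ⟨v, List.mem_cons_of_mem _ hv, hpe v _ hvp (h.injective.ne huw)⟩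
  · have huw : u ≠ w' := fun e => by
      rw [e, ew] at hu
      cases hu
    rw [hcolor u huw] at hu
    rw [Finset.eq_empty_iff_forall_notMem]
    intro x hx
    have := hpsub u x hx
    rw [h.white u hu] at this
    simp at this
  · rw [hstatus]
    have h2 : v ≠ w' := fun e => hp (by rw [e, ew])
    rw [hcolor v h2] at hv
    refine h.explored v hv ?_ u hvu
    by_cases h1 : v = s
    · rw [h1, hph]
      simp
    · rw [h.idle_of_ne h1]
      simp
  · by_cases h2 : source = w'
    · rw [h2, ew]
      simp
    · rw [hcolor _ h2]
      exact h.source_color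

theorem Traversal.potential_pass (h : Traversal net name source st (s :: l))
    (hph : (st s).phase = .passing) {w : V} (hw : name w ∈ (st s).pending) (B b : ℕ) :
    potential B b st = potential B b (passState name st s w) + 1 := by
  obtain ⟨w', hw', hadj, hwc, hwv⟩ := h.pend s _ hw
  obtain rfl := h.injective hw'
  have hsum : ∑ v, (if v = w' then 1 else 0) = 1 := by simp
  rw [← hsum]
  refine potential_eq_add _ fun v => ?_
  by_cases h1 : v = s
  · subst h1
    have hv : (st v).status = .viewed := h.viewed_of_color (by rw [h.color_head]; simp)
    simp [passState, State.weight, hv, h.color_head, hph, hadj.1]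
  by_cases h2 : v = w'
  · subst h2
    simp [passState, State.weight, hwv, hwc, h1]
  · simp [passState, h1, h2]

end Pass

section Return

/-- The states after `s` has become black and has returned the token to its parent, the head of
`l`. -/
def returnState (st : V → State N) (s : V) (l : List V) (v : V) : State N :=
  if v = s then { st s with color := .black, phase := .idle }
  else if l.head? = some v then { st v with phase := .passing }
  else st v

/-- As nothing is pending at `s`, every white viewed node is still pending at some node of the
remaining stack. -/
theorem Traversal.giveBack (h : Traversal net name source st (s :: l))
    (hph : (st s).phase = .passing) (hpend : (st s).pending = ∅) :
    Traversal net name source (returnState st s l) l := by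
  have hsl : s ∉ l := (List.nodup_cons.1 h.nodup).1
  have es : returnState st s l s = { st s with color := .black, phase := .idle } := if_pos rfl
  have hphase : ∀ v, v ≠ s → l.head? = some v → (returnState st s l v).phase = .passing := by
    intro v h1 h2
    simp [returnState, h1, h2]
  have eo : ∀ v, v ≠ s → l.head? ≠ some v → returnState st s l v = st v := by
    intro v h1 h2
    simp [returnState, h1, h2]
  have hfield : ∀ v, (returnState st s l v).status = (st v).status ∧
      (returnState st s l v).pending = (st v).pending ∧
      (returnState st s l v).parent = (st v).parent ∧ (returnState st s l v).me = (st v).me := by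
    intro v
    simp only [returnState]
    split_ifs with h1 h2
    · subst h1
      exact ⟨rfl, rfl, rfl, rfl⟩
    · exact ⟨rfl, rfl, rfl, rfl⟩
    · exact ⟨rfl, rfl, rfl, rfl⟩
  have hcolor : ∀ v, v ≠ s → (returnState st s l v).color = (st v).color := by
    intro v h1
    simp only [returnState, h1, if_false]
    split_ifs <;> rfl
  have hwhite : ∀ v, (returnState st s l v).color = .white → v ≠ s ∧ (st v).color = .white := by
    intro v hv
    have h1 : v ≠ s := fun e => by
      rw [e, es] at hv
      cases hv
    exact ⟨h1, by rwa [hcolor v h1] at hv⟩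
  have hcs : (st s).color ≠ .white := by rw [h.color_head]; simp
  refine ⟨h.injective, fun v => by rw [(hfield v).2.2.2, h.me], fun v => ?_, fun v hv => ?_,
    fun v hv => ?_, (List.nodup_cons.1 h.nodup).2, fun v => ?_,
    h.chain.tail.congr fun v _ => (hfield v).2.2.1, fun v x hx => ?_, fun v v' x hx hx' => ?_,
    fun w hw hw' => ?_, fun w hw => ?_, fun v hv hp w hadj => ?_, ?_⟩
  · by_cases h1 : v = s
    · right
      rw [(hfield v).1, h1]
      exact h.viewed_of_color hcs
    by_cases h2 : l.head? = some v
    · right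
      rw [(hfield v).1]
      refine h.viewed_of_color ?_
      rw [(h.grey v).1 (List.mem_cons_of_mem _ (List.mem_of_mem_head? h2))]
      simp
    · rw [eo v h1 h2]
      exact h.status v
  · by_cases h1 : v = s
    · rw [h1, es]
    · rw [eo v h1 hv]
      exact h.idle_of_ne h1
  · right
    exact hphase v (fun e => hsl (e ▸ List.mem_of_mem_head? hv)) hv
  · by_cases h1 : v = s
    · rw [h1, es]
      simp [hsl]
    · rw [hcolor v h1, ← h.grey v]
      simp [h1]
  · rw [(hfield v).2.1] at hx
    obtain ⟨w, rfl, h1, h2, h3⟩ := h.pend v x hx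
    have hws : w ≠ s := fun e => hcs (e ▸ h2)
    exact ⟨w, rfl, h1, by rw [hcolor w hws, h2], by rw [(hfield w).1, h3]⟩
  · rw [(hfield _).2.1] at hx hx'
    exact h.pend_unique v v' x hx hx'
  · obtain ⟨h1, h2⟩ := hwhite w hw
    rw [(hfield w).1] at hw'
    obtain ⟨v, hv, hvp⟩ := h.pend_grey w h2 hw'
    have hvs : v ≠ s := fun e => by
      rw [e, hpend] at hvp
      simp at hvp
    exact ⟨v, (List.mem_cons.1 hv).resolve_left hvs, by rwa [(hfield v).2.1]⟩
  · rw [(hfield w).2.1]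
    exact h.white w (hwhite w hw).2
  · rw [(hfield w).1]
    by_cases h1 : v = s
    · rw [h1] at hadj
      exact h.explored s hcs (by rw [hph]; simp) w hadj
    · rw [hcolor v h1] at hv
      exact h.explored v hv (by rw [h.idle_of_ne h1]; simp) w hadj
  · by_cases h1 : source = s
    · rw [h1, es]
      simp
    · rw [hcolor _ h1]
      exact h.source_color

theorem Traversal.potential_return (h : Traversal net name source st (s :: l))
    (hph : (st s).phase = .passing) (B b : ℕ) :
    potential B b st = potential B b (returnState st s l) + 1 := by
  have hsum : ∑ v, (if v = s then 1 else 0) = 1 := by simp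
  rw [← hsum]
  refine potential_eq_add _ fun v => ?_
  by_cases h1 : v = s
  · subst h1
    have hv : (st v).status = .viewed := h.viewed_of_color (by rw [h.color_head]; simp)
    simp [returnState, State.weight, hv, h.color_head, hph]
  by_cases h2 : l.head? = some v
  · have hc := (h.grey v).1 (List.mem_cons_of_mem _ (List.mem_of_mem_head? h2))
    have hv : (st v).status = .viewed := h.viewed_of_color (by rw [hc]; simp)
    simp [returnState, State.weight, hv, hc, h1, h2, h.idle_of_ne h1]
  · simp [returnState, h1, h2]

end Return

end WirelessDFS

end SINR

/-! ### Execution of the traversal along a predetermined list of sets. -/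

namespace SINR

namespace WirelessDFS

variable {N : ℕ} {p : Params N} {V : Type} [Fintype V] {net : Network V} {ω : V → ℕ → Bool}
variable [DecidableEq V]

variable {name : V → Fin N} {source : V} {st : V → State N} {s : V} {l : List V}

theorem react_token_of_ne {σ : State N} {q v : Fin N} (h : v ≠ σ.me) :
    react σ (.token q v) = σ := by
  simp [react, h]

theorem Traversal.step_pass (h : Traversal net name source st (s :: l))
    (hph : (st s).phase = .passing) {w : V} (hw : name w ∈ (st s).pending)
    (hpick : p.pick (name s) (st s).pending = name w) (used : V → ℕ) :
    p.step net ω (fun v => (st v, used v)) = fun v => (passState name st s w v, used v) := by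
  obtain ⟨w', hw', hadj, hwc, hwv⟩ := h.pend s _ hw
  obtain rfl := h.injective hw'
  have hne : (st s).pending.Nonempty := ⟨_, hw⟩
  have hs : p.emit ω (fun v => (st v, used v)) s = some (.token (name s) (name w')) := by
    simp [Params.emit, Params.send, hph, hne, h.me, hpick]
  funext v
  by_cases h1 : v = s
  · subst h1
    simp [Params.step, Params.next, Params.coins, hph, hne, h.me, hpick, passState]
  rw [Params.step_of_lone hs (fun u hu => h.idle_of_ne hu) h1]
  by_cases h2 : v = w'
  · subst h2
    rw [if_pos hadj]
    simp [react, h.me, hwc, passState, h1]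
  · rw [react_token_of_ne (by rw [h.me]; exact fun e => h2 (h.injective e).symm), ite_self]
    simp [passState, h1, h2]

theorem Traversal.step_giveBack (h : Traversal net name source st (s :: l))
    (hph : (st s).phase = .passing) (hpend : (st s).pending = ∅) (used : V → ℕ) :
    p.step net ω (fun v => (st v, used v)) = fun v => (returnState st s l v, used v) := by
  have hself : p.step net ω (fun v => (st v, used v)) s = (returnState st s l s, used s) := by
    simp [Params.step, Params.next, Params.coins, hph, hpend, returnState]
  funext v
  by_cases h1 : v = s
  · rw [h1, hself]
  cases l with
  | nil =>
    have hpar : (st s).parent = none := h.chain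
    have hnone : ∀ u, p.emit ω (fun v => (st v, used v)) u = none := by
      intro u
      by_cases hu : u = s
      · subst hu
        simp [Params.emit, Params.send, hph, hpend, hpar]
      · exact p.emit_of_idle ω (h.idle_of_ne hu)
    rw [Params.step_of_idle (h.idle_of_ne h1)]
    · simp [returnState, h1]
    · intro m hm
      obtain ⟨u, -, hu⟩ := Params.exists_emit_of_heard hm
      rw [hnone u] at hu
      cases hu
  | cons q l =>
    obtain ⟨hpar, hadj, -⟩ := h.chain
    have hs : p.emit ω (fun v => (st v, used v)) s = some (.token (name s) (name q)) := by
      simp [Params.emit, Params.send, hph, hpend, hpar, h.me]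
    rw [Params.step_of_lone hs (fun u hu => h.idle_of_ne hu) h1]
    by_cases h2 : v = q
    · subst h2
      have hc := (h.grey v).1 (by simp)
      rw [if_pos hadj]
      simp [react, h.me, hc, returnState, h1]
    · rw [react_token_of_ne (by rw [h.me]; exact fun e => h2 (h.injective e).symm), ite_self]
      simp [returnState, h1, Ne.symm h2]

/-- If ESUN estimates certain sets of nodes well, which do not depend on the random bits, then the
traversal is completed in time. -/
theorem Traversal.exists_sets {K : ℝ} {κ : ℕ} (hsel : IsSelectorFamily K p.sel) (hκ : K ≤ κ)
    (hL : 1 ≤ lg N) (hs : 0 < p.esunLength)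
    (hpick : ∀ (s : Fin N) (R : Finset (Fin N)), R.Nonempty → p.pick s R ∈ R)
    (hconn : net.commGraph.Connected) (Φ : ℕ) :
    ∀ (st : V → State N) (stk : List V), Traversal net name source st stk →
      potential 1 0 st ≤ Φ →
    ∃ 𝒜 : List (Finset V), 𝒜.length ≤ Φ ∧ ∀ (ω : V → ℕ → Bool) (used : V → ℕ),
      (∀ v, (st v).status = .unexplored → used v = 0) → (∀ A ∈ 𝒜, p.Good ω A) →
      ∃ t ≤ potential p.esunCost (lunCost N κ) st, ∀ v,
        ((p.step net ω)^[t] (fun v => (st v, used v)) v).1.color = .black := by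
  -- In the potential with `B = 1` and `b = 0` every action costs at least one unit, so `Φ` bounds
  -- the number of actions and thereby the length of `𝒜`. The rounds are counted by the potential
  -- with the true costs.
  induction Φ with
  | zero =>
    intro st stk h hΦ
    cases stk with
    | nil => exact ⟨[], le_rfl, fun ω used _ _ => ⟨0, Nat.zero_le _, h.black hconn⟩⟩
    | cons s l =>
      -- Any owner can still lower the potential: `potential_return` does not ask for an empty
      -- `pending`, so it covers every passing owner.
      exfalso
      rcases h.owner s rfl with ⟨hph, -⟩ | hph
      · have := h.potential_explore hph 1 0
        omega
      · have := h.potential_return hph 1 0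
        omega
  | succ Φ ih =>
    intro st stk h hΦ
    cases stk with
    | nil => exact ⟨[], Nat.zero_le _, fun ω used _ _ => ⟨0, Nat.zero_le _, h.black hconn⟩⟩
    | cons s l =>
      rcases h.owner s rfl with ⟨hph, -⟩ | hph
      · have hpot := h.potential_explore hph
        obtain ⟨𝒜, hlen, h𝒜⟩ := ih _ _ (h.explore hph) (by have := hpot 1 0; omega)
        -- The list is extended before `ω` is introduced. This is possible because `exploreState`
        -- does not involve the random bits; they only influence the number `t` of rounds.
        refine ⟨unexploredNbrs net st s :: 𝒜, by simpa using hlen, fun ω used hu hgood => ?_⟩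
        obtain ⟨t, ht, used', hused, hrun⟩ := h.ready.iterate_explore (p := p) (ω := ω) hph hsel hκ
          hL hs (fun v hv => hu v (mem_unexploredNbrs.1 hv).2) (hgood _ (by simp))
        have hst : arena name st s (unexploredNbrs net st s)
            ((st s).pending ∪ (unexploredNbrs net st s).image name) .passing ∅ .idle used' =
              fun v => (exploreState net name st s v, used' v) := by
          funext v
          simp [arena, exploreState]
        obtain ⟨t', ht', hblack⟩ := h𝒜 ω used' (fun v hv => by
          by_cases hvA : v ∈ unexploredNbrs net st s
          · have hvs : v ≠ s := fun e => h.ready.notMem (e ▸ hvA)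
            simp [exploreState, hvs, hvA] at hv
          · rw [hused v hvA]
            refine hu v ?_
            by_cases hvs : v = s
            · subst hvs
              simpa [exploreState] using hv
            · simpa [exploreState, hvs, hvA] using hv)
          fun A hA => hgood A (List.mem_cons_of_mem _ hA)
        refine ⟨t' + t, ?_, fun v => ?_⟩
        · rw [hpot]
          omega
        · rw [Function.iterate_add_apply, hrun, hst]
          exact hblack v
      · by_cases hpend : (st s).pending = ∅
        · have hpot := h.potential_return hph
          obtain ⟨𝒜, hlen, h𝒜⟩ := ih _ _ (h.giveBack hph hpend) (by have := hpot 1 0; omega)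
          refine ⟨𝒜, by omega, fun ω used hu hgood => ?_⟩
          obtain ⟨t', ht', hblack⟩ := h𝒜 ω used (fun v hv => hu v (by
            simp only [returnState] at hv
            split_ifs at hv with h1 h2
            · exact h1 ▸ hv
            · exact hv
            · exact hv)) hgood
          refine ⟨t' + 1, ?_, fun v => ?_⟩
          · rw [hpot]
            omega
          · rw [Function.iterate_add_apply, Function.iterate_one, h.step_giveBack hph hpend]
            exact hblack v
        · have hmem := hpick (name s) _ (Finset.nonempty_iff_ne_empty.2 hpend)
          obtain ⟨w, hw, -⟩ := h.pend s _ hmem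
          rw [← hw] at hmem
          have hpot := h.potential_pass hph hmem
          obtain ⟨𝒜, hlen, h𝒜⟩ := ih _ _ (h.pass hph hmem) (by have := hpot 1 0; omega)
          refine ⟨𝒜, by omega, fun ω used hu hgood => ?_⟩
          obtain ⟨t', ht', hblack⟩ := h𝒜 ω used (fun v hv => hu v (by
            simp only [passState] at hv
            split_ifs at hv with h1 h2
            · exact h1 ▸ hv
            · exact h2 ▸ hv
            · exact hv)) hgood
          refine ⟨t' + 1, ?_, fun v => ?_⟩
          · rw [hpot]
            omega
          · rw [Function.iterate_add_apply, Function.iterate_one, h.step_pass hph hmem hw.symm]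
            exact hblack v

/-- The states at the start. -/
def initialState (name : V → Fin N) (source v : V) : State N :=
  if v = source then { fresh (name v) with color := .grey, status := .viewed, phase := .calling }
  else fresh (name v)

theorem initial_eq : initial name source = fun v => (initialState name source v, 0) := by
  funext v
  by_cases hv : v = source <;> simp [initial, initialState, hv]

theorem traversal_initialState (hname : Function.Injective name) :
    Traversal net name source (initialState name source) [source] := by
  have es : initialState name source source =
      { fresh (name source) with color := .grey, status := .viewed, phase := .calling } := if_pos rfl
  have eo : ∀ v, v ≠ source → initialState name source v = fresh (name v) := fun v hv => if_neg hv
  have hp : ∀ v, (initialState name source v).pending = ∅ := by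
    intro v
    by_cases hv : v = source
    · rw [hv, es]; rfl
    · rw [eo v hv]; rfl
  refine ⟨hname, fun v => ?_, fun v => ?_, fun v hv => ?_, fun v hv => ?_, by simp, fun v => ?_, ?_,
    fun v x hx => ?_, fun v v' x hx => ?_, fun w hw hw' => ?_, fun w _ => hp w,
    fun v hv hph => ?_, by rw [es]; simp⟩
  · by_cases hv : v = source
    · rw [hv, es]; rfl
    · rw [eo v hv]; rfl
  · by_cases hv : v = source
    · right
      rw [hv, es]
    · exact Or.inl (eo v hv)
  · rw [eo v fun e => hv (by simp [e])]
    rfl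
  · simp only [List.head?_cons, Option.some.injEq] at hv
    left
    exact ⟨by rw [← hv, es], hp v⟩
  · by_cases hv : v = source
    · rw [hv, es]; simp
    · rw [eo v hv]; simp [hv, fresh]
  · rw [ParentChain, es]; rfl
  · rw [hp] at hx
    simp at hx
  · rw [hp] at hx
    simp at hx
  · by_cases hv : w = source
    · rw [hv, es] at hw
      cases hw
    · rw [eo w hv] at hw'
      cases hw'
  · by_cases hvs : v = source
    · rw [hvs, es] at hph
      exact absurd rfl hph
    · rw [eo v hvs] at hv
      exact absurd rfl hv

theorem potential_initialState_le (B b : ℕ) :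
    potential B b (initialState name source) ≤ Fintype.card V * (B + 2 + b) := by
  refine (Finset.sum_le_card_nsmul _ _ (B + 2 + b) fun v _ => ?_).trans_eq
    (by rw [smul_eq_mul, Finset.card_univ])
  by_cases hv : v = source
  · simp only [initialState, hv, if_true, State.weight]
    omega
  · simp [initialState, hv, State.weight, fresh]

/-- Rounding up adds at most `1`, and `1 ≤ Real.logb 2 N` as `2 ≤ N`. -/
theorem lg_le_two_mul_logb (hN : 2 ≤ N) : (lg N : ℝ) ≤ 2 * Real.logb 2 N := by
  have h1 : 1 ≤ lg N := Nat.clog_pos one_lt_two hN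
  have h2 := Nat.pow_pred_clog_lt_self one_lt_two hN
  have h3 : 1 ≤ Real.logb 2 N := by
    rw [Real.le_logb_iff_rpow_le one_lt_two (by positivity)]
    simpa using (by exact_mod_cast hN : (2 : ℝ) ≤ N)
  have h4 : ((lg N - 1 : ℕ) : ℝ) ≤ Real.logb 2 N := by
    rw [Real.le_logb_iff_rpow_le one_lt_two (by positivity), Real.rpow_natCast]
    exact_mod_cast h2.le
  rw [Nat.cast_sub h1] at h4
  push_cast at h4
  linarith

end WirelessDFS

end SINR

/-! ### Constants and conclusion. -/

open SINR SINR.WirelessDFS in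
theorem exists_completed_run {d : ℕ} (hd : 1 ≤ d) {ε : ℝ} {K : ℝ}
    {sel : (L : ℕ) → ℕ → List (Finset (Fin (2 ^ L)))} (hsel : IsSelectorFamily K sel) {N : ℕ}
    (hN : 2 ≤ N) {pick : Fin N → Finset (Fin N) → Fin N} (hpick : ∀ s R, R.Nonempty → pick s R ∈ R)
    {V : Type} [Fintype V] (net : Network V) (hconn : net.commGraph.Connected) {name : V → Fin N}
    (hname : Function.Injective name) (source : V) :
    ∃ 𝒜 : List (Finset V), 𝒜.length ≤ 3 * Fintype.card V ∧
      ∀ ω : V → ℕ → Bool, (∀ A ∈ 𝒜, Params.Good ⟨d, ε, sel, pick⟩ ω A) →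
      ∃ t : ℕ, (t : ℝ) ≤ (8 * (200 + d + 192 * ⌈K⌉₊) : ℕ) * Fintype.card V * Real.logb 2 N ^ 2 ∧
        ∀ v, ((Params.step ⟨d, ε, sel, pick⟩ net ω)^[t] (initial name source) v).1.color
          = .black := by
  classical
  have hL : 1 ≤ lg N := Nat.clog_pos one_lt_two hN
  have hs : 0 < Params.esunLength ⟨d, ε, sel, pick⟩ := Nat.mul_pos hL (Nat.mul_pos hd hL)
  obtain ⟨𝒜, hlen, h𝒜⟩ := Traversal.exists_sets (p := ⟨d, ε, sel, pick⟩) hsel (Nat.le_ceil K) hL hs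
    hpick hconn _ _ _ (traversal_initialState (net := net) (source := source) hname) le_rfl
  refine ⟨𝒜, hlen.trans ((potential_initialState_le 1 0).trans_eq (mul_comm _ _)),
    fun ω hgood => ?_⟩
  obtain ⟨t, ht, hblack⟩ := h𝒜 ω (fun _ => 0) (fun _ _ => rfl) hgood
  refine ⟨t, ?_, fun v => by rw [initial_eq]; exact hblack v⟩
  have h1 := ht.trans (potential_initialState_le _ _)
  -- The left-hand side is `196 + d (lg N) ^ 2 + 192 ⌈K⌉₊ lg N`.
  have h2 : Params.esunCost ⟨d, ε, sel, pick⟩ + 2 + lunCost N ⌈K⌉₊ ≤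
      (200 + d + 192 * ⌈K⌉₊) * lg N ^ 2 := by
    simp only [Params.esunCost, Params.esunLength, Params.subLength, lunCost]
    nlinarith [Nat.mul_le_mul hL hL, Nat.mul_le_mul_left (192 * ⌈K⌉₊ * lg N) hL]
  have h3 : (t : ℝ) ≤ Fintype.card V * ((200 + d + 192 * ⌈K⌉₊ : ℕ) * (lg N : ℝ) ^ 2) := by
    exact_mod_cast h1.trans (Nat.mul_le_mul_left _ h2)
  have h4 := lg_le_two_mul_logb hN
  -- A factor `4` would do; with `8` the same constant also covers the cube `(2 log N) ^ 3` in the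
  -- bound on random bits.
  have h5 : (lg N : ℝ) ^ 2 ≤ 8 * Real.logb 2 N ^ 2 := by
    have h0 : (0 : ℝ) ≤ lg N := by positivity
    nlinarith [sq_nonneg (Real.logb 2 N)]
  calc (t : ℝ) ≤ Fintype.card V * ((200 + d + 192 * ⌈K⌉₊ : ℕ) * (lg N : ℝ) ^ 2) := h3
    _ ≤ Fintype.card V * ((200 + d + 192 * ⌈K⌉₊ : ℕ) * (8 * Real.logb 2 N ^ 2)) := by gcongr
    _ = _ := by push_cast; ring

end

theorem mainTheorem1 :
    -- selectors of the required length exist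
    (∃ (K : ℝ) (sel : (L : ℕ) → ℕ → List (Finset (Fin (2 ^ L)))), SINR.IsSelectorFamily K sel) ∧
    -- for every threshold constant `ε`, every exponent `a` of the failure probability, and every
    -- sufficiently large constant `d`, with any selectors of length `O(x log N)`:
    (∀ ε : ℝ, 0 < ε → ε < 1 / 2 → ∀ a : ℕ, ∃ d₀ : ℕ, ∀ d : ℕ, d₀ ≤ d → ∀ K : ℝ, ∃ C : ℝ,
      ∀ sel : (L : ℕ) → ℕ → List (Finset (Fin (2 ^ L))), SINR.IsSelectorFamily K sel →
      ∀ (n N : ℕ), 2 ≤ N →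
      ∀ pick : Fin N → Finset (Fin N) → Fin N,
        (∀ (s : Fin N) (R : Finset (Fin N)), R.Nonempty → pick s R ∈ R) →
      ∀ (net : SINR.Network (Fin n)), net.commGraph.Connected →
      ∀ (name : Fin n → Fin N), Function.Injective name →
      ∀ (source : Fin n) (Rumor : Type) (r : Rumor),
        -- every node gets the rumor and the traversal completes, with high probability
        1 - 1 / (n : ℝ) ^ a ≤ (SINR.coins (Fin n)).real
          {ω | ∃ t : ℕ, (t : ℝ) ≤ C * n * Real.logb 2 N ^ 2 ∧
            ∀ v, ∃ nd, SINR.run net (SINR.WirelessDFS.algorithm ⟨d, ε, sel, pick⟩) name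
                (fun u i => ω (u, i)) source r t v = some nd ∧
              nd.rumor = r ∧ nd.state.color = .black} ∧
        -- no node ever uses more than `O(log³ N)` random bits
        ∀ (ω : Fin n → ℕ → Bool) (t : ℕ) (v : Fin n)
          (nd : SINR.Node Rumor (SINR.WirelessDFS.State N)),
          SINR.run net (SINR.WirelessDFS.algorithm ⟨d, ε, sel, pick⟩) name ω source r t v
              = some nd →
            (nd.used : ℝ) ≤ C * Real.logb 2 N ^ 3) := by
  refine ⟨SINR.exists_selectorFamily, fun ε hε hε' a => ?_⟩
  -- This is what the union bound asks for; the added `1` makes `1 ≤ d` immediate.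
  refine ⟨⌈((a + 4 : ℕ) : ℝ) * 64 / ε ^ 2⌉₊ + 1, fun d hd K => ?_⟩
  refine ⟨(8 * (200 + d + 192 * ⌈K⌉₊) : ℕ), ?_⟩
  intro sel hsel n N hN pick hpick net hconn name hname source Rumor r
  have hd' : ((a + 4 : ℕ) : ℝ) * 64 / ε ^ 2 ≤ d :=
    (Nat.le_ceil _).trans (by exact_mod_cast (Nat.le_succ _).trans hd)
  have hL : 1 ≤ SINR.WirelessDFS.lg N := Nat.clog_pos one_lt_two hN
  set p : SINR.WirelessDFS.Params N := ⟨d, ε, sel, pick⟩ with hp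
  constructor
  · obtain ⟨𝒜, hlen, h𝒜⟩ := exists_completed_run (d := d) (ε := ε) (by omega) hsel hN hpick net
      hconn hname source
    have hcard : Fintype.card (Fin n) = n := Fintype.card_fin n
    have hn : 1 ≤ n := Fin.pos source
    have hnN : n ≤ N := by simpa using Fintype.card_le_of_injective name hname
    have hgood := p.one_sub_le_measure_good (V := Fin n) hN (by simpa using hn) (by simpa using hnN)
      hε hε' a hd' 𝒜 hlen
    rw [hcard] at hgood
    refine hgood.trans (MeasureTheory.measureReal_mono fun ω hω => ?_)
    obtain ⟨t, ht, hblack⟩ := h𝒜 _ hω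
    rw [hcard] at ht
    refine ⟨t, ht, fun v => ?_⟩
    have hdesc := SINR.WirelessDFS.describes_run (p := p) (net := net) (ω := fun u i => ω (u, i))
      (name := name) (source := source) (r := r) t v
    -- A node that is still passive is described as `fresh`, hence white. So a black node is awake
    -- and holds the rumor.
    rcases hdesc with ⟨-, h2⟩ | h2
    · have := hblack v
      rw [h2] at this
      cases this
    · exact ⟨_, h2, rfl, hblack v⟩
  · intro ω t v nd hnd
    have hs : 0 < p.esunLength := Nat.mul_pos hL (Nat.mul_pos (show 0 < d by omega) hL)
    have hfr := SINR.WirelessDFS.Params.frugal_run (p := p) net ω hs name source t v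
    have hdesc := SINR.WirelessDFS.describes_run (p := p) (net := net) (ω := ω)
      (name := name) (source := source) (r := r) t v
    have hused : nd.used ≤ d * SINR.WirelessDFS.lg N ^ 3 := by
      rcases hdesc with ⟨h1, -⟩ | h1
      · rw [h1] at hnd
        cases hnd
      · rw [h1] at hnd
        cases hnd
        exact hfr.le.trans p.tape_esunLength_le
    have h4 := SINR.WirelessDFS.lg_le_two_mul_logb hN
    calc (nd.used : ℝ) ≤ d * (SINR.WirelessDFS.lg N : ℝ) ^ 3 := by exact_mod_cast hused
      _ ≤ d * (2 * Real.logb 2 N) ^ 3 := by gcongr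
      _ = (8 * d : ℕ) * Real.logb 2 N ^ 3 := by push_cast; ring
      _ ≤ _ := by
        have h5 : 0 ≤ Real.logb 2 N := by
          have : (0 : ℝ) ≤ SINR.WirelessDFS.lg N := by positivity
          linarith
        gcongr
        omega
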